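/- **Setting.** Let $\mathcal I,\mathcal J$ be finite sets of agents, $\mathcal C$ a measurable space of contexts, $\Upsilon$ a measurable space of planner's actions, and $H,K\ge 0$, $d\ge 1$ integers. At step $h\in[H]$ the agents $I_h\subseteq\mathcal I$, $J_h\subseteq\mathcal J$ participate; the utilities are $u_h(C,e,i,j)=\langle\Phi(C,e,i,j),\theta_h\rangle$ and $v_h(C,e,i,j)=\langle\Phi(C,e,i,j),\gamma_h\rangle$ with $\Phi(C,e,i,j)=\mathrm{vec}(\psi(C,e)\phi(i,j)^\top)\in\mathbb R^{d^2}$, where $\psi,\phi$ are known features in $\mathbb R^d$ of Euclidean norm at most $1$ ($\psi$ measurable), $\|\theta_h\|_2,\|\gamma_h\|_2\le d$ and $|u_h|,|v_h|\le 1$. Contexts move by Markov kernels $\mathbb P_h(A\mid C,e)=\langle\psi(C,e),\mu_h(A)\rangle$ with $\mathbb R^d$-valued measures $\mu_h$ such that $\|\mu_h(A)\|_2\le\sqrt d$ and $\|\int f\,d\mu_h\|_2\le\sqrt d$ whenever $|f|\le1$. Let $W_h>0$ bound the total utility of the max-weight matching on $(I_h,J_h)$ for all $(C,e)$. A matching $X$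 is a set of pairs in which each agent occurs at most once; unmatched agents get utility $0$; $u(i,X(i))$ and $v(X(j),j)$ denote the agents' utilities under $X$. The Subset Instability of a matching with transfers $(X,\tau)$, $\tau:I\cup J\to\mathbb R$, with respect to utilities $u,v$ is $$\mathrm{SI}(X,\tau;I,J,u,v)=\max_{I'\subseteq I,\,J'\subseteq J}\Big[\max_{X'}\Big(\sum_{i\in I'}u(i,X'(i))+\sum_{j\in J'}v(X'(j),j)\Big)-\sum_{i\in I'}\big(u(i,X(i))+\tau(i)\big)-\sum_{j\in J'}\big(v(X(j),j)+\tau(j)\big)\Big],$$ $X'$ ranging over the matchings between $I'$ and $J'$. **Algorithm (Sequential Optimistic Matching).** In episode $k=1,\dots,K$ the learner starts from an initial context $C_1^k$ (arbitrary, it may depend on the past). In context $C_h^k$ at step $h$ it takes an action $e_h^k$, implements a matching with transfers $(X_h^k,\tau_h^k)$ on $(I_h,J_h)$, observes for each $(i,j)\in X_h^k$ the values of $u_h(C_h^k,e_h^k,i,j)$ and $v_h(C_h^k,e_h^k,i,j)$ plus noise, and $C_{h+1}^k\sim\mathbb P_h(\cdot\mid C_h^k,e_h^k)$; the noise variables are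 independent (of each other and of the past) and $1$-subgaussian. Put $\Sigma_h^k=\lambda I+\sum_{t<k}\sum_{(i,j)\in X_h^t}\Phi\Phi^\top$ with $\Phi=\Phi(C_h^t,e_h^t,i,j)$, let $\theta_h^k,\gamma_h^k=(\Sigma_h^k)^{-1}\sum_{t<k}\sum_{(i,j)\in X_h^t}\Phi\cdot(\text{observed utility of the respective side})$, and let $$u_h^k=\big(\langle\Phi,\theta_h^k\rangle+\beta_u\|\Phi\|_{(\Sigma_h^k)^{-1}}\big)_{[-1,1]},\qquad v_h^k=\big(\langle\Phi,\gamma_h^k\rangle+\beta_u\|\Phi\|_{(\Sigma_h^k)^{-1}}\big)_{[-1,1]}\qquad(k\ge2),$$ and $u_h^1=v_h^1\equiv1$, where $(\cdot)_{[a,b]}$ is truncation to $[a,b]$. With $\bar Q_{H+1}^k\equiv0$ let $$\bar Q_h^k(C,e)=\Big(\hat r_h^k(C,e)+\psi(C,e)^\top w_h^k+\beta_V\|\psi(C,e)\|_{(\Lambda_h^k)^{-1}}\Big)_{[0,\sum_{l\ge h}W_l]},$$ where $\hat r_h^k(C,e)$ is the optimal value of the matching linear program $\max\sum_{I_h\times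 J_h} w_{ij}(u_h^k+v_h^k)(C,e,i,j)$ over $w\ge0$ with row and column sums at most $1$, $\Lambda_h^k=\lambda I+\sum_{t<k}\psi\psi^\top$ with $\psi=\psi(C_h^t,e_h^t)$, and $w_h^k=(\Lambda_h^k)^{-1}\sum_{t<k}\psi(C_h^t,e_h^t)\max_{e'}\bar Q_{h+1}^k(C_{h+1}^t,e')$. The policy $\pi_k$ of episode $k$ takes in context $C$ at step $h$ an action $e$ maximizing $\bar Q_h^k(C,\cdot)$ and a matching with transfers $(X,\tau)$ where $X$ solves the linear program for $u_h^k(C,e,\cdot,\cdot),v_h^k(C,e,\cdot,\cdot)$ and $\tau(i)=p(i)-u_h^k(C,e,i,X(i))$, $\tau(j)=p(j)-v_h^k(C,e,X(j),j)$ for a solution $p$ of its dual program; ties are broken arbitrarily (measurably). The agents' regret is $R^M(K)=\sum_{k=1}^K\mathbb E_{\pi_k}\big[\sum_{h=1}^H\mathrm{SI}(X_h,\tau_h;I_h,J_h,u_h(C_h,e_h,\cdot,\cdot),v_h(C_h,e_h,\cdot,\cdot))\big]$, where $\mathbb E_{\pi_k}$ is the expectation over a fresh trajectory started at $C_1^k$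 and following $\pi_k$; it is a random variable through $\pi_k$ and $C_1^k$. **Theorem (Agents' regret).** There is a universal constant $c>0$ such that in every such setting, for every $\delta>0$, if the algorithm is run with $\lambda=1$, any $\beta_V\in\mathbb R$, and $$\beta_u=\sqrt{\max\{d^2,2\}\,\log\frac{2\,(1+d^2K\max_h\min\{|I_h|,|J_h|\})}{\delta}}+d,$$ then with probability at least $1-2\delta$ $$R^M(K)\le c\,d^2\Big(\sum_{h=1}^H\min\{|I_h|,|J_h|\}\Big)\,\kappa\,\sqrt K,\qquad \kappa=\log\frac{dK\min(|\mathcal I|,|\mathcal J|)}{\delta}$$ (with the convention $\log 0=0$ when $K\min(|\mathcal I|,|\mathcal J|)=0$, where the regret is $0$). -/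

import Mathlib

open MeasureTheory ProbabilityTheory Matrix

namespace MarkovMatching

/-! ### Matchings with transferable utilities -/

section Static

variable {𝓘 𝓙 : Type*}

/-- `X` is a matching between `I` and `J`: a set of pairs in which every agent occurs at most once. -/
def IsMatching (I : Finset 𝓘) (J : Finset 𝓙) (X : Finset (𝓘 × 𝓙)) : Prop :=
  (∀ p ∈ X, p.1 ∈ I ∧ p.2 ∈ J) ∧ ∀ p ∈ X, ∀ q ∈ X, (p.1 = q.1 ∨ p.2 = q.2) → p = q

open scoped Classical in
/-- `u(i, X(i))`: the utility of the side-1 agent `i` under the matching `X`, which is `0` if `i` is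
unmatched. -/
noncomputable def utilI (u : 𝓘 → 𝓙 → ℝ) (X : Finset (𝓘 × 𝓙)) (i : 𝓘) : ℝ :=
  ∑ p ∈ X with p.1 = i, u p.1 p.2

open scoped Classical in
/-- `v(X(j), j)`: the utility of the side-2 agent `j` under the matching `X`, which is `0` if `j` is
unmatched. -/
noncomputable def utilJ (v : 𝓘 → 𝓙 → ℝ) (X : Finset (𝓘 × 𝓙)) (j : 𝓙) : ℝ :=
  ∑ p ∈ X with p.2 = j, v p.1 p.2

open scoped Classical in
/-- The set of all matchings between `I` and `J`. -/
noncomputable def matchings (I : Finset 𝓘) (J : Finset 𝓙) : Finset (Finset (𝓘 × 𝓙)) :=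
  {X ∈ (I ×ˢ J).powerset | IsMatching I J X}

theorem matchings_nonempty (I : Finset 𝓘) (J : Finset 𝓙) : (matchings I J).Nonempty :=
  ⟨∅, by classical exact Finset.mem_filter.2 ⟨by simp, by simp [IsMatching]⟩⟩

/-- The total utility of a max-weight matching between `I` and `J`. -/
noncomputable def maxWelfare (I : Finset 𝓘) (J : Finset 𝓙) (u v : 𝓘 → 𝓙 → ℝ) : ℝ :=
  (matchings I J).sup' (matchings_nonempty I J) fun X =>
    ∑ i ∈ I, utilI u X i + ∑ j ∈ J, utilJ v X j

/-- The Subset Instability of the matching with transfers `(X, τ)` on `(I, J)` with respect to the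
utilities `(u, v)`. -/
noncomputable def subsetInstability (X : Finset (𝓘 × 𝓙)) (τ : 𝓘 ⊕ 𝓙 → ℝ)
    (I : Finset 𝓘) (J : Finset 𝓙) (u v : 𝓘 → 𝓙 → ℝ) : ℝ :=
  (I.powerset ×ˢ J.powerset).sup' ⟨(∅, ∅), by simp⟩ fun S =>
    maxWelfare S.1 S.2 u v
      - ∑ i ∈ S.1, (utilI u X i + τ (Sum.inl i)) - ∑ j ∈ S.2, (utilJ v X j + τ (Sum.inr j))

/-- Feasibility in the matching linear program. -/
def LPFeasible (I : Finset 𝓘) (J : Finset 𝓙) (w : 𝓘 → 𝓙 → ℝ) : Prop :=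
  (∀ i ∈ I, ∑ j ∈ J, w i j ≤ 1) ∧ (∀ j ∈ J, ∑ i ∈ I, w i j ≤ 1) ∧ ∀ i ∈ I, ∀ j ∈ J, 0 ≤ w i j

/-- The objective of the matching linear program. -/
def lpObjective (I : Finset 𝓘) (J : Finset 𝓙) (u v w : 𝓘 → 𝓙 → ℝ) : ℝ :=
  ∑ i ∈ I, ∑ j ∈ J, w i j * (u i j + v i j)

/-- The optimal value of the matching linear program. -/
noncomputable def lpValue (I : Finset 𝓘) (J : Finset 𝓙) (u v : 𝓘 → 𝓙 → ℝ) : ℝ :=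
  sSup (lpObjective I J u v '' {w | LPFeasible I J w})

/-- Feasibility in the dual program. -/
def DPFeasible (I : Finset 𝓘) (J : Finset 𝓙) (u v : 𝓘 → 𝓙 → ℝ) (p : 𝓘 ⊕ 𝓙 → ℝ) : Prop :=
  (∀ i ∈ I, 0 ≤ p (Sum.inl i)) ∧ (∀ j ∈ J, 0 ≤ p (Sum.inr j)) ∧
    ∀ i ∈ I, ∀ j ∈ J, u i j + v i j ≤ p (Sum.inl i) + p (Sum.inr j)

/-- The objective of the dual program. -/
def dpObjective (I : Finset 𝓘) (J : Finset 𝓙) (p : 𝓘 ⊕ 𝓙 → ℝ) : ℝ :=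
  ∑ i ∈ I, p (Sum.inl i) + ∑ j ∈ J, p (Sum.inr j)

open scoped Classical in
/-- `(X, τ)` is an output of the optimal matching oracle: `X` is a matching whose indicator solves
the linear program, and `τ = p - (utility under X)` for a solution `p` of the dual program. No rule
is fixed for choosing among several solutions. -/
def IsOptimalMatching (I : Finset 𝓘) (J : Finset 𝓙) (u v : 𝓘 → 𝓙 → ℝ)
    (X : Finset (𝓘 × 𝓙)) (τ : 𝓘 ⊕ 𝓙 → ℝ) : Prop :=
  IsMatching I J X ∧
  (∀ w, LPFeasible I J w →
    lpObjective I J u v w ≤ lpObjective I J u v (fun i j => if (i, j) ∈ X then 1 else 0)) ∧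
  ∃ p, DPFeasible I J u v p ∧ (∀ q, DPFeasible I J u v q → dpObjective I J p ≤ dpObjective I J q) ∧
    (∀ i ∈ I, τ (Sum.inl i) = p (Sum.inl i) - utilI u X i) ∧
    ∀ j ∈ J, τ (Sum.inr j) = p (Sum.inr j) - utilJ v X j

end Static

/-! ### Markov matching markets and policies -/

/-- A Markov matching market with horizon `H`, contexts `𝒞`, planner's actions `Υ` and agents `𝓘`,
`𝓙`: participating agents, context transitions and utilities at each of the `H` steps. -/
structure Market (𝒞 Υ 𝓘 𝓙 : Type*) [MeasurableSpace 𝒞] [MeasurableSpace Υ] (H : ℕ) where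
  I : Fin H → Finset 𝓘
  J : Fin H → Finset 𝓙
  P : Fin H → Kernel (𝒞 × Υ) 𝒞
  markov : ∀ h, IsMarkovKernel (P h)
  u : Fin H → 𝒞 → Υ → 𝓘 → 𝓙 → ℝ
  v : Fin H → 𝒞 → Υ → 𝓘 → 𝓙 → ℝ

/-- A (deterministic, Markov) joint policy: in context `c` at step `h` it takes the planner's action
`act h c` and implements the matching `mat h c` with transfers `tr h c`. -/
structure Policy (𝒞 Υ 𝓘 𝓙 : Type*) [MeasurableSpace 𝒞] [MeasurableSpace Υ] (H : ℕ) where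
  act : Fin H → 𝒞 → Υ
  measurable_act : ∀ h, Measurable (act h)
  mat : Fin H → 𝒞 → Finset (𝓘 × 𝓙)
  tr : Fin H → 𝒞 → 𝓘 ⊕ 𝓙 → ℝ

section Dynamics

variable {𝒞 Υ 𝓘 𝓙 : Type*} [MeasurableSpace 𝒞] [MeasurableSpace Υ] {H : ℕ}

/-- The law of the context following the contexts `x 0, …, x n` when `π` is followed. After step `H`
(steps being numbered `0, …, H - 1`) the context stays put; this part is never used. -/
noncomputable def Market.stepKernel (M : Market 𝒞 Υ 𝓘 𝓙 H) (π : Policy 𝒞 Υ 𝓘 𝓙 H) (n : ℕ) :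
    Kernel (Finset.Iic n → 𝒞) 𝒞 :=
  if h : n < H then
    (M.P ⟨n, h⟩).comap
      (fun x => (x ⟨n, Finset.mem_Iic.2 le_rfl⟩, π.act ⟨n, h⟩ (x ⟨n, Finset.mem_Iic.2 le_rfl⟩)))
      ((measurable_pi_apply _).prodMk ((π.measurable_act _).comp (measurable_pi_apply _)))
  else Kernel.deterministic (fun x => x ⟨n, Finset.mem_Iic.2 le_rfl⟩) (measurable_pi_apply _)

instance (M : Market 𝒞 Υ 𝓘 𝓙 H) (π : Policy 𝒞 Υ 𝓘 𝓙 H) (n : ℕ) :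
    IsMarkovKernel (M.stepKernel π n) := by
  unfold Market.stepKernel
  split_ifs with h
  · have := M.markov ⟨n, h⟩
    infer_instance
  · infer_instance

/-- The law of the sequence of contexts when `π` is followed from the initial context `c`. -/
noncomputable def Market.trajLaw (M : Market 𝒞 Υ 𝓘 𝓙 H) (π : Policy 𝒞 Υ 𝓘 𝓙 H) (c : 𝒞) :
    Measure (ℕ → 𝒞) :=
  Kernel.traj (X := fun _ => 𝒞) (M.stepKernel π) 0 (fun _ => c)

/-- The Subset Instability, with respect to the true utilities, of what `π` implements in context
`c` at step `h`. -/
noncomputable def Market.stepSI (M : Market 𝒞 Υ 𝓘 𝓙 H) (π : Policy 𝒞 Υ 𝓘 𝓙 H) (h : Fin H)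
    (c : 𝒞) : ℝ :=
  subsetInstability (π.mat h c) (π.tr h c) (M.I h) (M.J h)
    (M.u h c (π.act h c)) (M.v h c (π.act h c))

/-- `𝔼_π [∑ₕ SI(sₕ, aₕ, uₕ, vₕ)]`, for the trajectory started at `c`. -/
noncomputable def Market.expectedSI (M : Market 𝒞 Υ 𝓘 𝓙 H) (π : Policy 𝒞 Υ 𝓘 𝓙 H) (c : 𝒞) : ℝ :=
  ∫ x, ∑ h : Fin H, M.stepSI π h (x h) ∂(M.trajLaw π c)

/-- `maxₕ min {|Iₕ|, |Jₕ|}`. -/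
def Market.maxSize (M : Market 𝒞 Υ 𝓘 𝓙 H) : ℕ :=
  Finset.univ.sup fun h => min (M.I h).card (M.J h).card

/-- The vectorized feature `vec (ψ φᵀ)`, a vector with `d ^ 2` coordinates. -/
def feature {d : ℕ} (ψ : 𝒞 → Υ → EuclideanSpace ℝ (Fin d)) (φ : 𝓘 → 𝓙 → EuclideanSpace ℝ (Fin d))
    (c : 𝒞) (e : Υ) (i : 𝓘) (j : 𝓙) : Fin d × Fin d → ℝ :=
  vec (vecMulVec (ψ c e).ofLp (φ i j).ofLp)

/-- The assumptions on the market: linear utilities and linear transitions with features `ψ`, `φ`,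
and the normalizations. -/
structure Market.IsLinear (M : Market 𝒞 Υ 𝓘 𝓙 H) {d : ℕ}
    (ψ : 𝒞 → Υ → EuclideanSpace ℝ (Fin d)) (φ : 𝓘 → 𝓙 → EuclideanSpace ℝ (Fin d))
    (θ γ : Fin H → EuclideanSpace ℝ (Fin d × Fin d))
    (ν : Fin H → VectorMeasure 𝒞 (EuclideanSpace ℝ (Fin d))) (W : Fin H → ℝ) : Prop where
  measurable_ψ : Measurable (Function.uncurry ψ)
  u_eq : ∀ h c e i j, M.u h c e i j = feature ψ φ c e i j ⬝ᵥ (θ h).ofLp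
  v_eq : ∀ h c e i j, M.v h c e i j = feature ψ φ c e i j ⬝ᵥ (γ h).ofLp
  transition_eq : ∀ h c e (A : Set 𝒞), MeasurableSet A →
    (M.P h (c, e)).real A = inner ℝ (ψ c e) (ν h A)
  u_le : ∀ h c e i j, |M.u h c e i j| ≤ 1
  v_le : ∀ h c e i j, |M.v h c e i j| ≤ 1
  W_pos : ∀ h, 0 < W h
  welfare_le : ∀ h c e, maxWelfare (M.I h) (M.J h) (M.u h c e) (M.v h c e) ≤ W h
  ψ_le : ∀ c e, ‖ψ c e‖ ≤ 1
  φ_le : ∀ i j, ‖φ i j‖ ≤ 1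
  θ_le : ∀ h, ‖θ h‖ ≤ d
  γ_le : ∀ h, ‖γ h‖ ≤ d
  ν_le : ∀ h (A : Set 𝒞), ‖ν h A‖ ≤ √d
  integral_le : ∀ h (f : 𝒞 → ℝ), Measurable f → (∀ c, |f c| ≤ 1) →
    ‖(ν h).integral f (ContinuousLinearMap.lsmul ℝ ℝ)‖ ≤ √d

end Dynamics

/-! ### The algorithm -/

/-- Truncation of `x` into `[a, b]`. -/
def clip (a b x : ℝ) : ℝ := max a (min x b)

/-- The norm `‖x‖_A = √(xᵀ A x)`. -/
noncomputable def matNorm {ι : Type*} [Fintype ι] (A : Matrix ι ι ℝ) (x : ι → ℝ) : ℝ :=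
  √(x ⬝ᵥ A *ᵥ x)

/-- What is recorded in the `K` episodes: contexts, planner's actions, implemented matchings, and
observed utilities; `obsU t h i j`, `obsV t h i j` are only meaningful for `(i, j) ∈ mat t h`. The
estimates for episode `k` below read only the records of the episodes `t < k`, and the observations
of matched pairs. -/
structure Record (𝒞 Υ 𝓘 𝓙 : Type*) (H K : ℕ) where
  ctx : Fin K → Fin (H + 1) → 𝒞
  act : Fin K → Fin H → Υ
  mat : Fin K → Fin H → Finset (𝓘 × 𝓙)
  obsU : Fin K → Fin H → 𝓘 → 𝓙 → ℝ
  obsV : Fin K → Fin H → 𝓘 → 𝓙 → ℝ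

section Algorithm

variable {𝒞 Υ 𝓘 𝓙 : Type*} {H K d : ℕ}

/-- `Σₕᵏ = λ I + ∑_{t < k} ∑_{(i, j) ∈ Xₕᵗ} Φ Φᵀ`. -/
noncomputable def Record.gram (D : Record 𝒞 Υ 𝓘 𝓙 H K) (ψ : 𝒞 → Υ → EuclideanSpace ℝ (Fin d))
    (φ : 𝓘 → 𝓙 → EuclideanSpace ℝ (Fin d)) (lam : ℝ) (k : Fin K) (h : Fin H) :
    Matrix (Fin d × Fin d) (Fin d × Fin d) ℝ :=
  lam • 1 + ∑ t ∈ Finset.Iio k, ∑ p ∈ D.mat t h,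
    vecMulVec (feature ψ φ (D.ctx t h.castSucc) (D.act t h) p.1 p.2)
      (feature ψ φ (D.ctx t h.castSucc) (D.act t h) p.1 p.2)

/-- The ridge regression estimate `(Σₕᵏ)⁻¹ ∑_{t < k} ∑_{(i, j) ∈ Xₕᵗ} Φ y`, where `y` are the
observations. -/
noncomputable def Record.ridge (D : Record 𝒞 Υ 𝓘 𝓙 H K) (ψ : 𝒞 → Υ → EuclideanSpace ℝ (Fin d))
    (φ : 𝓘 → 𝓙 → EuclideanSpace ℝ (Fin d)) (lam : ℝ) (y : Fin K → Fin H → 𝓘 → 𝓙 → ℝ)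
    (k : Fin K) (h : Fin H) : Fin d × Fin d → ℝ :=
  (D.gram ψ φ lam k h)⁻¹ *ᵥ ∑ t ∈ Finset.Iio k, ∑ p ∈ D.mat t h,
    y t h p.1 p.2 • feature ψ φ (D.ctx t h.castSucc) (D.act t h) p.1 p.2

/-- The optimistic truncated utility estimate from the observations `y`; identically `1` in the first
episode, when there are no data. -/
noncomputable def Record.ucb (D : Record 𝒞 Υ 𝓘 𝓙 H K) (ψ : 𝒞 → Υ → EuclideanSpace ℝ (Fin d))
    (φ : 𝓘 → 𝓙 → EuclideanSpace ℝ (Fin d)) (lam βu : ℝ) (y : Fin K → Fin H → 𝓘 → 𝓙 → ℝ)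
    (k : Fin K) (h : Fin H) (c : 𝒞) (e : Υ) (i : 𝓘) (j : 𝓙) : ℝ :=
  if (k : ℕ) = 0 then 1
  else clip (-1) 1 (feature ψ φ c e i j ⬝ᵥ D.ridge ψ φ lam y k h
    + βu * matNorm (D.gram ψ φ lam k h)⁻¹ (feature ψ φ c e i j))

/-- `Λₕᵏ = ∑_{t < k} ψ ψᵀ + λ I`. -/
noncomputable def Record.ctxGram (D : Record 𝒞 Υ 𝓘 𝓙 H K)
    (ψ : 𝒞 → Υ → EuclideanSpace ℝ (Fin d)) (lam : ℝ) (k : Fin K) (h : Fin H) :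
    Matrix (Fin d) (Fin d) ℝ :=
  ∑ t ∈ Finset.Iio k, vecMulVec (ψ (D.ctx t h.castSucc) (D.act t h)).ofLp
    (ψ (D.ctx t h.castSucc) (D.act t h)).ofLp + lam • 1

/-- The optimistic estimate of the expected next value: `ψᵀ w + β_V ‖ψ‖_{Λ⁻¹}`, where `w` is the
ridge regression of `V (Cₕ₊₁ᵗ)` on `ψ (Cₕᵗ, eₕᵗ)` over the episodes `t < k`. -/
noncomputable def Record.nextValue (D : Record 𝒞 Υ 𝓘 𝓙 H K)
    (ψ : 𝒞 → Υ → EuclideanSpace ℝ (Fin d)) (lam βV : ℝ) (k : Fin K) (h : Fin H) (V : 𝒞 → ℝ)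
    (c : 𝒞) (e : Υ) : ℝ :=
  (ψ c e).ofLp ⬝ᵥ ((D.ctxGram ψ lam k h)⁻¹ *ᵥ ∑ t ∈ Finset.Iio k,
      V (D.ctx t h.succ) • (ψ (D.ctx t h.castSucc) (D.act t h)).ofLp)
    + βV * matNorm (D.ctxGram ψ lam k h)⁻¹ (ψ c e).ofLp

/-- The estimated Q-functions of episode `k`, by backward recursion from `0` after the last step. -/
noncomputable def Record.qFun (D : Record 𝒞 Υ 𝓘 𝓙 H K) (I : Fin H → Finset 𝓘)
    (J : Fin H → Finset 𝓙) (ψ : 𝒞 → Υ → EuclideanSpace ℝ (Fin d))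
    (φ : 𝓘 → 𝓙 → EuclideanSpace ℝ (Fin d)) (W : Fin H → ℝ) (lam βu βV : ℝ) (k : Fin K)
    (h : Fin (H + 1)) : 𝒞 → Υ → ℝ :=
  Fin.reverseInduction (motive := fun _ => 𝒞 → Υ → ℝ) (fun _ _ => 0)
    (fun h Qnext c e => clip 0 (∑ l ∈ Finset.Ici h, W l)
      (lpValue (I h) (J h) (D.ucb ψ φ lam βu D.obsU k h c e) (D.ucb ψ φ lam βu D.obsV k h c e)
        + D.nextValue ψ lam βV k h (fun c' => ⨆ e', Qnext c' e') c e)) h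

/-- `π` is a policy that the algorithm may follow in episode `k`: the planner acts greedily with
respect to the estimated Q-function, and the matching with transfers is an output of the optimal
matching oracle for the estimated utilities. -/
def IsSOMPolicy [MeasurableSpace 𝒞] [MeasurableSpace Υ]
    (D : Record 𝒞 Υ 𝓘 𝓙 H K) (I : Fin H → Finset 𝓘) (J : Fin H → Finset 𝓙)
    (ψ : 𝒞 → Υ → EuclideanSpace ℝ (Fin d)) (φ : 𝓘 → 𝓙 → EuclideanSpace ℝ (Fin d))
    (W : Fin H → ℝ) (lam βu βV : ℝ) (k : Fin K) (π : Policy 𝒞 Υ 𝓘 𝓙 H) : Prop :=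
  ∀ h c,
    (∀ e, D.qFun I J ψ φ W lam βu βV k h.castSucc c e
      ≤ D.qFun I J ψ φ W lam βu βV k h.castSucc c (π.act h c)) ∧
    IsOptimalMatching (I h) (J h) (D.ucb ψ φ lam βu D.obsU k h c (π.act h c))
      (D.ucb ψ φ lam βu D.obsV k h c (π.act h c)) (π.mat h c) (π.tr h c)

end Algorithm

/-- The two sides of a matched pair, each of which reports a noisy utility. -/
inductive Side
  | buyer
  | seller

/-- The interaction of a learner with the market `M` over `K` episodes, on a probability space.
`ctx k h` is the context at step `h` of episode `k` (`ctx k 0` is the initial context, `ctx k H` the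
one after the last step), `pol k` the policy followed in episode `k`, and `noise k h s i j` the noise
in the utility reported by side `s` of the pair `(i, j)`. -/
structure Interaction {𝒞 Υ 𝓘 𝓙 : Type*} [MeasurableSpace 𝒞] [MeasurableSpace Υ] {H : ℕ}
    (M : Market 𝒞 Υ 𝓘 𝓙 H) (K : ℕ) {Ω : Type*} [mΩ : MeasurableSpace Ω] (μ : Measure Ω) where
  ctx : Fin K → Fin (H + 1) → Ω → 𝒞
  pol : Fin K → Ω → Policy 𝒞 Υ 𝓘 𝓙 H
  noise : Fin K → Fin H → Side → 𝓘 → 𝓙 → Ω → ℝ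
  /-- `ℱ (k * (H + 1) + h)` is the information available when the context at step `h` of episode `k`
  has been received. -/
  ℱ : Filtration ℕ mΩ
  measurable_ctx : ∀ (k : Fin K) (h : Fin (H + 1)), Measurable[ℱ (k * (H + 1) + h)] (ctx k h)
  measurable_noise : ∀ (k : Fin K) (h : Fin H) s i j,
    Measurable[ℱ (k * (H + 1) + h + 1)] (noise k h s i j)
  /-- The policy of episode `k` is determined by the information at the start of that episode. -/
  measurable_act : ∀ (k : Fin K) (h : Fin H),
    Measurable[(ℱ (k * (H + 1))).prod ‹MeasurableSpace 𝒞›]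
      fun p : Ω × 𝒞 => (pol k p.1).act h p.2
  measurable_mat : ∀ (k : Fin K) (h : Fin H) (q : 𝓘 × 𝓙),
    MeasurableSet[(ℱ (k * (H + 1))).prod ‹MeasurableSpace 𝒞›]
      {p : Ω × 𝒞 | q ∈ (pol k p.1).mat h p.2}
  measurable_tr : ∀ (k : Fin K) (h : Fin H) (a : 𝓘 ⊕ 𝓙),
    Measurable[(ℱ (k * (H + 1))).prod ‹MeasurableSpace 𝒞›]
      fun p : Ω × 𝒞 => (pol k p.1).tr h p.2 a
  /-- The next context is drawn from the transition kernel. -/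
  transition : ∀ (k : Fin K) (h : Fin H) (A : Set 𝒞), MeasurableSet A →
    μ[(ctx k h.succ ⁻¹' A).indicator (fun _ => (1 : ℝ)) | ℱ (k * (H + 1) + h)] =ᵐ[μ]
      fun ω => (M.P h (ctx k h.castSucc ω,
        (pol k ω).act h (ctx k h.castSucc ω))).real A
  /-- The noise is independent and 1-subgaussian. -/
  noise_indep_past : ∀ (k : Fin K) (h : Fin H),
    Indep (MeasurableSpace.comap (fun ω (q : Side × 𝓘 × 𝓙) => noise k h q.1 q.2.1 q.2.2 ω)
      inferInstance) (ℱ (k * (H + 1) + h)) μ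
  noise_indep : ∀ (k : Fin K) (h : Fin H),
    iIndepFun (fun (q : Side × 𝓘 × 𝓙) => noise k h q.1 q.2.1 q.2.2) μ
  noise_subgaussian : ∀ k h s i j, HasSubgaussianMGF (noise k h s i j) 1 μ

section Interaction

variable {𝒞 Υ 𝓘 𝓙 : Type*} [MeasurableSpace 𝒞] [MeasurableSpace Υ] {H K d : ℕ}
  {M : Market 𝒞 Υ 𝓘 𝓙 H} {Ω : Type*} [MeasurableSpace Ω] {μ : Measure Ω}

/-- The record of an interaction; the observed utilities are the true ones plus noise. -/
def Interaction.record (R : Interaction M K μ) (ω : Ω) : Record 𝒞 Υ 𝓘 𝓙 H K where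
  ctx k h := R.ctx k h ω
  act k h := (R.pol k ω).act h (R.ctx k h.castSucc ω)
  mat k h := (R.pol k ω).mat h (R.ctx k h.castSucc ω)
  obsU k h i j := M.u h (R.ctx k h.castSucc ω)
    ((R.pol k ω).act h (R.ctx k h.castSucc ω)) i j + R.noise k h Side.buyer i j ω
  obsV k h i j := M.v h (R.ctx k h.castSucc ω)
    ((R.pol k ω).act h (R.ctx k h.castSucc ω)) i j + R.noise k h Side.seller i j ω

/-- The learner runs Sequential Optimistic Matching with parameters `lam`, `βu`, `βV`. -/
def Interaction.FollowsSOM (R : Interaction M K μ) (ψ : 𝒞 → Υ → EuclideanSpace ℝ (Fin d))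
    (φ : 𝓘 → 𝓙 → EuclideanSpace ℝ (Fin d)) (W : Fin H → ℝ) (lam βu βV : ℝ) : Prop :=
  ∀ k ω, IsSOMPolicy (R.record ω) M.I M.J ψ φ W lam βu βV k (R.pol k ω)

/-- The agents' regret: the sum over the episodes of the expected total Subset Instability of the
policy of the episode. -/
noncomputable def Interaction.agentsRegret (R : Interaction M K μ) (ω : Ω) : ℝ :=
  ∑ k, M.expectedSI (R.pol k ω) (R.ctx k 0 ω)

end Interaction

/-- The confidence parameter of the utility estimates, where `m = maxₕ min {|Iₕ|, |Jₕ|}`. The factor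
`max (d ^ 2) 2` is `d ^ 2` unless `d ≤ 1`; with the factor `1` the confidence bounds for `d = 1` would
fail with a probability that is not bounded by `δ`. -/
noncomputable def betaU (d K m : ℕ) (lam δ : ℝ) : ℝ :=
  √(max ((d : ℝ) ^ 2) 2 * Real.log (2 * (1 + (d : ℝ) ^ 2 * K * m) / (lam * δ))) + √lam * d

end MarkovMatching

/-! Instability is measured at the action actually taken, so only the errors of the utility
estimates matter. Under the implemented matching every agent receives its dual price minus the
overestimation of its own utility. A dual feasible price vector dominates the estimated welfare of
every coalition. Hence (`subsetInstability_le`) overestimation is paid only on the implemented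
pairs, where data are collected, while underestimation is paid uniformly, once for each pair of a
competing matching.

The error of an estimate is the truncated confidence width plus an excess `max (s - b) 0 * ‖Φ‖`,
where `s` is the self-normalized norm of the noise, `b` is its assumed radius and `‖Φ‖` is the norm
of the feature for the inverse Gram matrix. A union bound over the steps would put the horizon into
the logarithm. It is avoided by never asking that all confidence bounds hold: the excess is bounded
at every episode and step by a small factor times the likelihood ratio `exp (s ^ 2 / 2) / √det` of
the method of mixtures (`Record.excess_le`). These ratios have mean at most `1`
(`Interaction.lintegral_mixture_le_one`), so one Markov inequality for their weighted sum over all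
episodes, steps and sides suffices. The small factor is at most `δ / √K`
(`tailFactor_noiseRadius_le`). This is possible because `det A • A⁻¹` is bounded by a power of the
sample size one lower than `det A` is, and the missing power pays for `K`.

The widths are summed along the trajectories really played by the elliptical potential argument. The
Gram matrix changes only between episodes, so each vector of a batch is charged the whole increase
of `log det`; this costs the factor `min {|Iₕ|, |Jₕ|}` (`sum_min_one_matNorm_le`). The regret,
however, involves expectations over fresh trajectories. Given the information at the start of an
episode, the played trajectory has the law of a fresh one (`Interaction.lintegral_ctx`), and a
multiplicative concentration inequality (`measure_log_le_sum_le`) passes from expected to realized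
widths at the price of a factor `2` and an additive logarithm. The two exceptional events have
probability at most `δ` each. -/

namespace MarkovMatching

/-! ### Positive definite matrices, determinants and Gaussian integrals -/

section MatrixLemmas

variable {ι : Type*} [Fintype ι]

/-- Cauchy-Schwarz for a positive semidefinite form. -/
theorem posSemidef_cauchySchwarz {A : Matrix ι ι ℝ} (hA : A.PosSemidef) (x y : ι → ℝ) :
    (x ⬝ᵥ A *ᵥ y) ^ 2 ≤ (x ⬝ᵥ A *ᵥ x) * (y ⬝ᵥ A *ᵥ y) := by
  have hsymm : y ⬝ᵥ A *ᵥ x = x ⬝ᵥ A *ᵥ y := by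
    have h : Aᵀ = A := by rw [← conjTranspose_eq_transpose_of_trivial]; exact hA.1
    rw [dotProduct_mulVec, ← mulVec_transpose, h, dotProduct_comm]
  have key : ∀ t : ℝ, 0 ≤ (y ⬝ᵥ A *ᵥ y) * (t * t) + 2 * (x ⬝ᵥ A *ᵥ y) * t + x ⬝ᵥ A *ᵥ x := by
    intro t
    have h := hA.dotProduct_mulVec_nonneg (x + t • y)
    simp only [star_trivial, mulVec_add, mulVec_smul, dotProduct_add, add_dotProduct,
      smul_dotProduct, dotProduct_smul, smul_eq_mul, hsymm] at h
    linarith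
  have h := discrim_le_zero key
  rw [discrim] at h
  nlinarith

theorem posDef_add_sum_vecMulVec {A : Matrix ι ι ℝ} (hA : A.PosDef) {α : Type*} (s : Finset α)
    (v : α → ι → ℝ) : (A + ∑ p ∈ s, vecMulVec (v p) (v p)).PosDef :=
  hA.add_posSemidef (posSemidef_sum s fun p _ => by
    simpa using posSemidef_vecMulVec_self_star (v p))

/-- The normalizing constant of the mixing density only has to be cancelled, so its value is
irrelevant. -/
theorem lintegral_gaussian_pos_lt_top :
    (∫⁻ x : ι → ℝ, ENNReal.ofReal (Real.exp (-(x ⬝ᵥ x) / 2))) ≠ 0 ∧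
      (∫⁻ x : ι → ℝ, ENNReal.ofReal (Real.exp (-(x ⬝ᵥ x) / 2))) ≠ ⊤ := by
  constructor
  · have hm : Measurable fun x : ι → ℝ => ENNReal.ofReal (Real.exp (-(x ⬝ᵥ x) / 2)) := by
      refine ENNReal.measurable_ofReal.comp (Real.measurable_exp.comp ?_)
      unfold dotProduct
      fun_prop
    rw [Ne, lintegral_eq_zero_iff hm]
    intro h
    obtain ⟨x, hx⟩ := h.exists
    simp only [Pi.zero_apply, ENNReal.ofReal_eq_zero] at hx
    exact absurd hx (not_le.2 (Real.exp_pos _))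
  · have hprod : (fun x : ι → ℝ => Real.exp (-(x ⬝ᵥ x) / 2))
        = fun x => ∏ i, Real.exp (-(1 / 2) * x i ^ 2) := by
      funext x
      rw [← Real.exp_sum, ← Finset.mul_sum]
      congr 1
      simp only [dotProduct, sq]
      ring
    have hI : Integrable (fun x : ι → ℝ => Real.exp (-(x ⬝ᵥ x) / 2)) := by
      rw [hprod]
      exact Integrable.fintype_prod fun _ => integrable_exp_neg_mul_sq (by norm_num)
    have := hI.lintegral_lt_top
    exact this.ne

variable [DecidableEq ι]

theorem mulVec_inv_mulVec {A : Matrix ι ι ℝ} (hA : A.PosDef) (x : ι → ℝ) :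
    A *ᵥ (A⁻¹ *ᵥ x) = x := by
  rw [mulVec_mulVec, mul_nonsing_inv _ ((isUnit_iff_isUnit_det A).1 hA.isUnit), one_mulVec]

theorem dotProduct_sq_le_of_posDef {A : Matrix ι ι ℝ} (hA : A.PosDef) (x y : ι → ℝ) :
    (x ⬝ᵥ y) ^ 2 ≤ (x ⬝ᵥ A *ᵥ x) * (y ⬝ᵥ A⁻¹ *ᵥ y) := by
  have h := posSemidef_cauchySchwarz hA.posSemidef x (A⁻¹ *ᵥ y)
  rw [mulVec_inv_mulVec hA] at h
  rwa [dotProduct_comm (A⁻¹ *ᵥ y) y] at h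

/-- With `z = A⁻¹ y`, the hypothesis gives `z · z ≤ y · z`, and `0 ≤ ‖y - z‖²` then yields `y · z ≤
y · y`. -/
theorem inv_quadForm_le_of_one_le {A : Matrix ι ι ℝ} (hA : A.PosDef)
    (h1 : ∀ x, x ⬝ᵥ x ≤ x ⬝ᵥ A *ᵥ x) (y : ι → ℝ) : y ⬝ᵥ A⁻¹ *ᵥ y ≤ y ⬝ᵥ y := by
  have h := h1 (A⁻¹ *ᵥ y)
  rw [mulVec_inv_mulVec hA, dotProduct_comm _ y] at h
  have h2 : 0 ≤ (y - A⁻¹ *ᵥ y) ⬝ᵥ (y - A⁻¹ *ᵥ y) := by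
    simpa using dotProduct_star_self_nonneg (y - A⁻¹ *ᵥ y)
  simp only [sub_dotProduct, dotProduct_sub] at h2
  rw [dotProduct_comm (A⁻¹ *ᵥ y) y] at h2
  linarith

/-- Diagonalization of a symmetric real matrix as a sum of squares. -/
theorem exists_sum_sq {A : Matrix ι ι ℝ} (hA : A.IsHermitian) :
    ∃ b : ι → ι → ℝ, (∀ i, b i ⬝ᵥ b i = 1) ∧
      (∀ i, b i ⬝ᵥ A *ᵥ b i = hA.eigenvalues i) ∧
      (∀ x, x ⬝ᵥ x = ∑ i, (b i ⬝ᵥ x) ^ 2) ∧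
      ∀ x, x ⬝ᵥ A *ᵥ x = ∑ i, hA.eigenvalues i * (b i ⬝ᵥ x) ^ 2 := by
  have hin : ∀ x y : EuclideanSpace ℝ ι, inner ℝ x y = x.ofLp ⬝ᵥ y.ofLp := fun x y => by
    rw [EuclideanSpace.inner_eq_star_dotProduct, star_trivial, dotProduct_comm]
  have hpar : ∀ x y : ι → ℝ, x ⬝ᵥ y
      = ∑ i, ((hA.eigenvectorBasis i).ofLp ⬝ᵥ x) * ((hA.eigenvectorBasis i).ofLp ⬝ᵥ y) := by
    intro x y
    have h := hA.eigenvectorBasis.sum_inner_mul_inner (WithLp.toLp 2 x) (WithLp.toLp 2 y)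
    simp only [hin] at h
    rw [← h]
    exact Finset.sum_congr rfl fun i _ => by rw [dotProduct_comm x]
  have hb1 : ∀ i, (hA.eigenvectorBasis i).ofLp ⬝ᵥ (hA.eigenvectorBasis i).ofLp = 1 := fun i => by
    rw [← hin, real_inner_self_eq_norm_sq, hA.eigenvectorBasis.norm_eq_one, one_pow]
  have hev : ∀ i x, (hA.eigenvectorBasis i).ofLp ⬝ᵥ A *ᵥ x
      = hA.eigenvalues i * ((hA.eigenvectorBasis i).ofLp ⬝ᵥ x) := by
    intro i x
    have hT : Aᵀ = A := by rw [← conjTranspose_eq_transpose_of_trivial]; exact hA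
    rw [dotProduct_mulVec, ← mulVec_transpose, hT, hA.mulVec_eigenvectorBasis i, smul_dotProduct]
    simp
  refine ⟨fun i => (hA.eigenvectorBasis i).ofLp, hb1, fun i => ?_, fun x => ?_, fun x => ?_⟩
  · rw [hev, hb1, mul_one]
  · rw [hpar x x]
    exact Finset.sum_congr rfl fun i _ => by ring
  · rw [hpar x]
    exact Finset.sum_congr rfl fun i _ => by rw [hev]; ring

/-- If `A ≤ c`, then `det A ≤ c ^ n` and `(det A) A⁻¹ ≤ c ^ (n - 1)`. -/
theorem det_le_and_det_mul_inv_quadForm_le {A : Matrix ι ι ℝ} (hA : A.PosDef) {c : ℝ} (hc : 0 < c)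
    (hle : ∀ x, x ⬝ᵥ A *ᵥ x ≤ c * (x ⬝ᵥ x)) :
    A.det ≤ c ^ Fintype.card ι ∧
      ∀ x, A.det * (x ⬝ᵥ A⁻¹ *ᵥ x) ≤ c ^ (Fintype.card ι - 1) * (x ⬝ᵥ x) := by
  have hB := hA.inv
  obtain ⟨b, hb1, hbe, hx1, hxe⟩ := exists_sum_sq hB.isHermitian
  set κ := hB.isHermitian.eigenvalues
  -- For a unit eigenvector `b` of `A⁻¹`, Cauchy-Schwarz gives `1 ≤ (b · A b) (b · A⁻¹ b) ≤ c κ`.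
  have hκ : ∀ i, 1 / c ≤ κ i := by
    intro i
    have h := dotProduct_sq_le_of_posDef hA (b i) (b i)
    rw [hb1, hbe] at h
    have h2 := hle (b i)
    rw [hb1, mul_one] at h2
    have hpos : 0 < κ i := hB.eigenvalues_pos i
    rw [div_le_iff₀ hc]
    nlinarith
  have hpos : ∀ i, 0 < κ i := fun i => hB.eigenvalues_pos i
  have hdet : A.det * ∏ i, κ i = 1 := by
    have h : A⁻¹.det = ∏ i, κ i := by simpa using hB.isHermitian.det_eq_prod_eigenvalues
    rw [← h, det_nonsing_inv, Ring.mul_inverse_cancel]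
    exact (isUnit_iff_isUnit_det A).1 hA.isUnit
  have hd : 0 < A.det := hA.det_pos
  constructor
  · have h : (1 / c) ^ Fintype.card ι ≤ ∏ i, κ i := by
      rw [← Finset.card_univ, ← Finset.prod_const]
      exact Finset.prod_le_prod (fun _ _ => by positivity) fun i _ => hκ i
    rw [one_div, inv_pow, inv_le_iff_one_le_mul₀ (by positivity)] at h
    calc A.det = A.det * 1 := by ring
      _ ≤ A.det * (c ^ Fintype.card ι * ∏ i, κ i) := by gcongr; linarith
      _ = (A.det * ∏ i, κ i) * c ^ Fintype.card ι := by ring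
      _ = _ := by rw [hdet, one_mul]
  · intro x
    rw [hxe, hx1, Finset.mul_sum, Finset.mul_sum]
    refine Finset.sum_le_sum fun i _ => ?_
    rw [← mul_assoc]
    refine mul_le_mul_of_nonneg_right ?_ (sq_nonneg _)
    -- Since `det A * ∏ κ = 1`, the product `det A * κ i` is the inverse of the product of the other
    -- eigenvalues, which has one factor fewer.
    have h : (1 / c) ^ (Fintype.card ι - 1) ≤ ∏ j ∈ Finset.univ.erase i, κ j := by
      rw [← Finset.card_univ, ← Finset.card_erase_of_mem (Finset.mem_univ i), ← Finset.prod_const]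
      exact Finset.prod_le_prod (fun _ _ => by positivity) fun i _ => hκ i
    rw [one_div, inv_pow, inv_le_iff_one_le_mul₀ (by positivity)] at h
    have hp := Finset.mul_prod_erase Finset.univ κ (Finset.mem_univ i)
    have := hpos i
    calc A.det * κ i = A.det * κ i * 1 := by ring
      _ ≤ A.det * κ i * (c ^ (Fintype.card ι - 1) * ∏ j ∈ Finset.univ.erase i, κ j) := by
          gcongr; linarith
      _ = (A.det * (κ i * ∏ j ∈ Finset.univ.erase i, κ j)) * c ^ (Fintype.card ι - 1) := by ring
      _ = _ := by rw [hp, hdet, one_mul]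

theorem det_add_vecMulVec_self {A : Matrix ι ι ℝ} (hA : A.PosDef) (v : ι → ℝ) :
    (A + vecMulVec v v).det = A.det * (1 + v ⬝ᵥ A⁻¹ *ᵥ v) := by
  have h := det_add_replicateCol_mul_replicateRow (ι := Unit)
    ((isUnit_iff_isUnit_det A).1 hA.isUnit) v v
  rw [vecMulVec_eq Unit, h]
  congr 1
  rw [det_unique]
  simp [Matrix.mul_apply, replicateRow, replicateCol, dotProduct, mulVec, Finset.mul_sum,
    Finset.sum_mul, mul_assoc]
  exact Finset.sum_comm

theorem det_le_det_add_sum {A : Matrix ι ι ℝ} (hA : A.PosDef) {α : Type*} (s : Finset α)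
    (v : α → ι → ℝ) : A.det ≤ (A + ∑ p ∈ s, vecMulVec (v p) (v p)).det := by
  classical
  induction s using Finset.induction_on with
  | empty => simp
  | insert a s ha ih =>
    have hP := posDef_add_sum_vecMulVec hA s v
    rw [Finset.sum_insert ha, add_comm (vecMulVec _ _), ← add_assoc, det_add_vecMulVec_self hP]
    refine ih.trans (le_mul_of_one_le_right hP.det_pos.le ?_)
    have := hP.inv.posSemidef.dotProduct_mulVec_nonneg (v a)
    simp only [star_trivial] at this
    linarith

/-- The vector `v a` alone multiplies the determinant by `1 + v a · A⁻¹ v a`, and the others can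
only increase it. Thus every vector of a batch is controlled by the same determinant ratio, with the
Gram matrix from before the batch. -/
theorem det_mul_one_add_le {A : Matrix ι ι ℝ} (hA : A.PosDef) {α : Type*} (s : Finset α)
    (v : α → ι → ℝ) {a : α} (ha : a ∈ s) :
    A.det * (1 + v a ⬝ᵥ A⁻¹ *ᵥ v a) ≤ (A + ∑ p ∈ s, vecMulVec (v p) (v p)).det := by
  classical
  rw [← det_add_vecMulVec_self hA, ← Finset.add_sum_erase s _ ha, ← add_assoc]
  have hP := posDef_add_sum_vecMulVec hA {a} v
  rw [Finset.sum_singleton] at hP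
  exact det_le_det_add_sum hP _ v

theorem quadForm_one_add_sum {α : Type*} (s : Finset α) (v : α → ι → ℝ) (x : ι → ℝ) :
    x ⬝ᵥ (1 + ∑ p ∈ s, vecMulVec (v p) (v p)) *ᵥ x = x ⬝ᵥ x + ∑ p ∈ s, (x ⬝ᵥ v p) ^ 2 := by
  rw [add_mulVec, one_mulVec, dotProduct_add, sum_mulVec, dotProduct_sum]
  congr 1
  refine Finset.sum_congr rfl fun p _ => ?_
  rw [vecMulVec_mulVec, op_smul_eq_smul, dotProduct_smul, smul_eq_mul, dotProduct_comm (v p) x, sq]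

open scoped MatrixOrder in
/-- The Gaussian integral `∫ exp (x · s - xᵀ A x / 2) dx`, relative to the standard one. -/
theorem lintegral_gaussian_quadForm {A : Matrix ι ι ℝ} (hA : A.PosDef) (s : ι → ℝ) :
    ∫⁻ x : ι → ℝ, ENNReal.ofReal (Real.exp (x ⬝ᵥ s - (x ⬝ᵥ A *ᵥ x) / 2)) =
      ENNReal.ofReal (Real.exp ((s ⬝ᵥ A⁻¹ *ᵥ s) / 2) / √A.det) *
        ∫⁻ x : ι → ℝ, ENNReal.ofReal (Real.exp (-(x ⬝ᵥ x) / 2)) := by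
  obtain ⟨R, rfl⟩ : ∃ R : Matrix ι ι ℝ, A = Rᴴ * R := by
    obtain ⟨R, hR⟩ := CStarAlgebra.nonneg_iff_eq_star_mul_self.1 hA.posSemidef.nonneg
    exact ⟨R, hR⟩
  set A := Rᴴ * R with hAdef
  have hdetA : A.det = R.det ^ 2 := by
    rw [hAdef, det_mul, conjTranspose_eq_transpose_of_trivial, det_transpose, sq]
  have hR : R.det ≠ 0 := fun h => by
    have := hA.det_pos
    rw [hdetA, h] at this
    simp at this
  have hquad : ∀ y : ι → ℝ, y ⬝ᵥ A *ᵥ y = R *ᵥ y ⬝ᵥ R *ᵥ y := fun y => by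
    rw [hAdef, ← mulVec_mulVec, dotProduct_mulVec, conjTranspose_eq_transpose_of_trivial,
      vecMul_transpose]
  have hsymm : ∀ x y : ι → ℝ, x ⬝ᵥ A *ᵥ y = y ⬝ᵥ A *ᵥ x := fun x y => by
    have h : Aᵀ = A := by rw [← conjTranspose_eq_transpose_of_trivial]; exact hA.1
    rw [dotProduct_mulVec, ← mulVec_transpose, h, dotProduct_comm]
  set c := A⁻¹ *ᵥ s with hc
  have hAc : A *ᵥ c = s := mulVec_inv_mulVec hA s
  -- Completing the square at `c = A⁻¹ s`; the translation by `c` and the linear change of variables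
  -- `R` then reduce to the standard Gaussian.
  have hsq : ∀ x : ι → ℝ, x ⬝ᵥ s - (x ⬝ᵥ A *ᵥ x) / 2
      = (s ⬝ᵥ c) / 2 + -(R *ᵥ (x - c) ⬝ᵥ R *ᵥ (x - c)) / 2 := fun x => by
    rw [← hquad, mulVec_sub, dotProduct_sub, sub_dotProduct, sub_dotProduct, hsymm c x, hAc,
      dotProduct_comm c s]
    ring
  set f : (ι → ℝ) → ENNReal := fun y => ENNReal.ofReal (Real.exp (-(y ⬝ᵥ y) / 2)) with hf
  have hfm : Measurable f := by
    refine ENNReal.measurable_ofReal.comp (Real.measurable_exp.comp ?_)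
    unfold dotProduct
    fun_prop
  have hRm : Measurable fun x : ι → ℝ => R *ᵥ x := by
    refine measurable_pi_lambda _ fun i => ?_
    simp only [mulVec, dotProduct]
    fun_prop
  have hmap := Real.map_matrix_volume_pi_eq_smul_volume_pi hR
  have hint : ∫⁻ x : ι → ℝ, f (R *ᵥ x) = ENNReal.ofReal (1 / √A.det) * ∫⁻ x, f x := by
    rw [← lintegral_map hfm hRm]
    have hm2 : Measure.map (fun x : ι → ℝ => R *ᵥ x) volume
        = ENNReal.ofReal |R.det⁻¹| • volume := hmap
    rw [hm2, lintegral_smul_measure, hdetA, Real.sqrt_sq_eq_abs, abs_inv, one_div, smul_eq_mul]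
  calc ∫⁻ x : ι → ℝ, ENNReal.ofReal (Real.exp (x ⬝ᵥ s - (x ⬝ᵥ A *ᵥ x) / 2))
      = ∫⁻ x : ι → ℝ, ENNReal.ofReal (Real.exp ((s ⬝ᵥ c) / 2)) * f (R *ᵥ (x - c)) := by
        refine lintegral_congr fun x => ?_
        rw [hsq, Real.exp_add, ENNReal.ofReal_mul (Real.exp_pos _).le]
    _ = ENNReal.ofReal (Real.exp ((s ⬝ᵥ c) / 2)) * ∫⁻ x : ι → ℝ, f (R *ᵥ (x - c)) :=
        lintegral_const_mul _ (hfm.comp (hRm.comp (measurable_id.sub_const c)))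
    _ = ENNReal.ofReal (Real.exp ((s ⬝ᵥ c) / 2)) * ∫⁻ x : ι → ℝ, f (R *ᵥ x) := by
        rw [lintegral_sub_right_eq_self (fun x => f (R *ᵥ x)) c]
    _ = _ := by
        rw [hint, ← mul_assoc, ← ENNReal.ofReal_mul (Real.exp_pos _).le, mul_one_div]

end MatrixLemmas

/-! ### Subset Instability of a matching computed from wrong utilities -/

section Static

variable {𝓘 𝓙 : Type*}

theorem IsMatching.card_le {I : Finset 𝓘} {J : Finset 𝓙} {X : Finset (𝓘 × 𝓙)}
    (hX : IsMatching I J X) : X.card ≤ min I.card J.card := by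
  refine le_min ?_ ?_
  · exact Finset.card_le_card_of_injOn Prod.fst (fun p hp => (hX.1 p hp).1)
      fun p hp q hq h => hX.2 p hp q hq (Or.inl h)
  · exact Finset.card_le_card_of_injOn Prod.snd (fun p hp => (hX.1 p hp).2)
      fun p hp q hq h => hX.2 p hp q hq (Or.inr h)

theorem sum_utilI {I : Finset 𝓘} {J : Finset 𝓙} {X : Finset (𝓘 × 𝓙)} (hX : IsMatching I J X)
    (u : 𝓘 → 𝓙 → ℝ) : ∑ i ∈ I, utilI u X i = ∑ p ∈ X, u p.1 p.2 := by
  classical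
  unfold utilI
  exact Finset.sum_fiberwise_of_maps_to (fun p hp => (hX.1 p hp).1) _

theorem sum_utilJ {I : Finset 𝓘} {J : Finset 𝓙} {X : Finset (𝓘 × 𝓙)} (hX : IsMatching I J X)
    (v : 𝓘 → 𝓙 → ℝ) : ∑ j ∈ J, utilJ v X j = ∑ p ∈ X, v p.1 p.2 := by
  classical
  unfold utilJ
  exact Finset.sum_fiberwise_of_maps_to (fun p hp => (hX.1 p hp).2) _

/-- The first projection is injective on a matching, so no agent is counted twice. -/
theorem sum_fst_le_of_isMatching {I : Finset 𝓘} {J : Finset 𝓙} {X : Finset (𝓘 × 𝓙)}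
    (hX : IsMatching I J X) {f : 𝓘 → ℝ} (hf : ∀ i ∈ I, 0 ≤ f i) :
    ∑ p ∈ X, f p.1 ≤ ∑ i ∈ I, f i := by
  classical
  rw [← Finset.sum_image (f := f) (g := Prod.fst) (s := X)
    fun p hp q hq h => hX.2 p hp q hq (Or.inl h)]
  refine Finset.sum_le_sum_of_subset_of_nonneg ?_ fun i hi _ => hf i hi
  intro i hi
  obtain ⟨p, hp, rfl⟩ := Finset.mem_image.1 hi
  exact (hX.1 p hp).1

theorem sum_snd_le_of_isMatching {I : Finset 𝓘} {J : Finset 𝓙} {X : Finset (𝓘 × 𝓙)}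
    (hX : IsMatching I J X) {f : 𝓙 → ℝ} (hf : ∀ j ∈ J, 0 ≤ f j) :
    ∑ p ∈ X, f p.2 ≤ ∑ j ∈ J, f j := by
  classical
  rw [← Finset.sum_image (f := f) (g := Prod.snd) (s := X)
    fun p hp q hq h => hX.2 p hp q hq (Or.inr h)]
  refine Finset.sum_le_sum_of_subset_of_nonneg ?_ fun i hi _ => hf i hi
  intro i hi
  obtain ⟨p, hp, rfl⟩ := Finset.mem_image.1 hi
  exact (hX.1 p hp).2

/-- On any set of agents the utilities under `X` differ by at most the total deviation over the
pairs of `X`. -/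
theorem sum_utilI_sub_le {I I' : Finset 𝓘} {J : Finset 𝓙} {X : Finset (𝓘 × 𝓙)}
    (hX : IsMatching I J X) (hI : I' ⊆ I) {u u' f : 𝓘 → 𝓙 → ℝ}
    (h : ∀ i j, u' i j - u i j ≤ f i j) (hf : ∀ i j, 0 ≤ f i j) :
    ∑ i ∈ I', (utilI u' X i - utilI u X i) ≤ ∑ p ∈ X, f p.1 p.2 := by
  classical
  rw [← sum_utilI hX]
  calc _ ≤ ∑ i ∈ I', utilI f X i := by
        refine Finset.sum_le_sum fun i _ => ?_
        unfold utilI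
        rw [← Finset.sum_sub_distrib]
        exact Finset.sum_le_sum fun p _ => h _ _
    _ ≤ _ := Finset.sum_le_sum_of_subset_of_nonneg hI fun i _ _ =>
        Finset.sum_nonneg fun p _ => hf _ _

theorem sum_utilJ_sub_le {I : Finset 𝓘} {J J' : Finset 𝓙} {X : Finset (𝓘 × 𝓙)}
    (hX : IsMatching I J X) (hJ : J' ⊆ J) {v v' f : 𝓘 → 𝓙 → ℝ}
    (h : ∀ i j, v' i j - v i j ≤ f i j) (hf : ∀ i j, 0 ≤ f i j) :
    ∑ j ∈ J', (utilJ v' X j - utilJ v X j) ≤ ∑ p ∈ X, f p.1 p.2 := by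
  classical
  rw [← sum_utilJ hX]
  calc _ ≤ ∑ j ∈ J', utilJ f X j := by
        refine Finset.sum_le_sum fun i _ => ?_
        unfold utilJ
        rw [← Finset.sum_sub_distrib]
        exact Finset.sum_le_sum fun p _ => h _ _
    _ ≤ _ := Finset.sum_le_sum_of_subset_of_nonneg hJ fun i _ _ =>
        Finset.sum_nonneg fun p _ => hf _ _

/-- The Subset Instability, for the utilities `(u, v)`, of an optimal matching with transfers for
the utilities `(u', v')`: the overestimation counts on the matched pairs only, and the
underestimation `a` once for each pair of a competing matching. -/
theorem subsetInstability_le {I : Finset 𝓘} {J : Finset 𝓙} {u v u' v' : 𝓘 → 𝓙 → ℝ}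
    {X : Finset (𝓘 × 𝓙)} {τ : 𝓘 ⊕ 𝓙 → ℝ} (hX : IsOptimalMatching I J u' v' X τ)
    {f g : 𝓘 → 𝓙 → ℝ} {a : ℝ} (ha : 0 ≤ a)
    (hle : ∀ i j, u i j + v i j ≤ u' i j + v' i j + a)
    (hu : ∀ i j, u' i j - u i j ≤ f i j) (hf : ∀ i j, 0 ≤ f i j)
    (hv : ∀ i j, v' i j - v i j ≤ g i j) (hg : ∀ i j, 0 ≤ g i j) :
    subsetInstability X τ I J u v ≤
      ∑ p ∈ X, (f p.1 p.2 + g p.1 p.2) + (min I.card J.card : ℕ) * a := by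
  classical
  obtain ⟨hXm, -, p, ⟨hp1, hp2, hp3⟩, -, hτI, hτJ⟩ := hX
  unfold subsetInstability
  refine Finset.sup'_le _ _ fun S hS => ?_
  rw [Finset.mem_product, Finset.mem_powerset, Finset.mem_powerset] at hS
  obtain ⟨hS1, hS2⟩ := hS
  -- Weak duality for the coalition: the restriction of `p` is dual feasible for the estimated
  -- utilities, which underestimate each pair by at most `a`.
  have hw : maxWelfare S.1 S.2 u v ≤
      ∑ i ∈ S.1, p (Sum.inl i) + ∑ j ∈ S.2, p (Sum.inr j) + (min I.card J.card : ℕ) * a := by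
    unfold maxWelfare
    refine Finset.sup'_le _ _ fun X' hX' => ?_
    have hM : IsMatching S.1 S.2 X' := (Finset.mem_filter.1 hX').2
    rw [sum_utilI hM, sum_utilJ hM, ← Finset.sum_add_distrib]
    have hcard : (X'.card : ℝ) ≤ (min I.card J.card : ℕ) := by
      exact_mod_cast hM.card_le.trans
        (min_le_min (Finset.card_le_card hS1) (Finset.card_le_card hS2))
    calc ∑ q ∈ X', (u q.1 q.2 + v q.1 q.2)
        ≤ ∑ q ∈ X', (p (Sum.inl q.1) + p (Sum.inr q.2) + a) := by
          refine Finset.sum_le_sum fun q hq => ?_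
          have h1 := hle q.1 q.2
          have h2 := hp3 q.1 (hS1 (hM.1 q hq).1) q.2 (hS2 (hM.1 q hq).2)
          linarith
      _ = ∑ q ∈ X', p (Sum.inl q.1) + ∑ q ∈ X', p (Sum.inr q.2) + X'.card * a := by
          rw [Finset.sum_add_distrib, Finset.sum_add_distrib, Finset.sum_const, nsmul_eq_mul]
      _ ≤ _ := by
          have h1 := sum_fst_le_of_isMatching hM (f := fun i => p (Sum.inl i))
            fun i hi => hp1 i (hS1 hi)
          have h2 := sum_snd_le_of_isMatching hM (f := fun j => p (Sum.inr j))
            fun j hj => hp2 j (hS2 hj)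
          have h3 := mul_le_mul_of_nonneg_right hcard ha
          linarith
  -- Transfers are prices minus estimated utilities, so true utility plus transfer is the price
  -- minus the overestimation.
  have hI : ∑ i ∈ S.1, (utilI u X i + τ (Sum.inl i))
      = ∑ i ∈ S.1, p (Sum.inl i) - ∑ i ∈ S.1, (utilI u' X i - utilI u X i) := by
    rw [← Finset.sum_sub_distrib]
    refine Finset.sum_congr rfl fun i hi => ?_
    rw [hτI i (hS1 hi)]
    ring
  have hJ : ∑ j ∈ S.2, (utilJ v X j + τ (Sum.inr j))
      = ∑ j ∈ S.2, p (Sum.inr j) - ∑ j ∈ S.2, (utilJ v' X j - utilJ v X j) := by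
    rw [← Finset.sum_sub_distrib]
    refine Finset.sum_congr rfl fun i hi => ?_
    rw [hτJ i (hS2 hi)]
    ring
  have h1 := sum_utilI_sub_le hXm hS1 hu hf
  have h2 := sum_utilJ_sub_le hXm hS2 hv hg
  have h3 : ∑ q ∈ X, (f q.1 q.2 + g q.1 q.2) = ∑ q ∈ X, f q.1 q.2 + ∑ q ∈ X, g q.1 q.2 :=
    Finset.sum_add_distrib
  linarith

theorem subsetInstability_nonneg (X : Finset (𝓘 × 𝓙)) (τ : 𝓘 ⊕ 𝓙 → ℝ) (I : Finset 𝓘)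
    (J : Finset 𝓙) (u v : 𝓘 → 𝓙 → ℝ) : 0 ≤ subsetInstability X τ I J u v := by
  classical
  have h : (0 : ℝ) ≤ maxWelfare ∅ ∅ u v := by
    unfold maxWelfare
    refine Finset.le_sup'_of_le _ (b := ∅) ?_ (by simp)
    exact Finset.mem_filter.2 ⟨by simp, by simp [IsMatching]⟩
  unfold subsetInstability
  exact Finset.le_sup'_of_le _ (b := (∅, ∅)) (by simp) (by simpa using h)

end Static

/-! ### Ridge regression and its confidence norms -/

section Regression

variable {ι α : Type*} [Fintype ι]

theorem matNorm_nonneg (A : Matrix ι ι ℝ) (x : ι → ℝ) : 0 ≤ matNorm A x := Real.sqrt_nonneg _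

theorem matNorm_sq {A : Matrix ι ι ℝ} (hA : A.PosSemidef) (x : ι → ℝ) :
    matNorm A x ^ 2 = x ⬝ᵥ A *ᵥ x :=
  Real.sq_sqrt (by simpa using hA.dotProduct_mulVec_nonneg x)

theorem abs_dotProduct_mulVec_le {A : Matrix ι ι ℝ} (hA : A.PosSemidef) (x y : ι → ℝ) :
    |x ⬝ᵥ A *ᵥ y| ≤ matNorm A x * matNorm A y := by
  refine abs_le_of_sq_le_sq ?_ (mul_nonneg (matNorm_nonneg _ _) (matNorm_nonneg _ _))
  rw [mul_pow, matNorm_sq hA, matNorm_sq hA]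
  exact posSemidef_cauchySchwarz hA x y

variable [DecidableEq ι]

theorem posDef_one_add_sum (s : Finset α) (v : α → ι → ℝ) :
    (1 + ∑ p ∈ s, vecMulVec (v p) (v p)).PosDef := posDef_add_sum_vecMulVec PosDef.one s v

/-- The error of ridge regression, with regularization `1`, in the direction `x`. -/
theorem abs_ridge_sub_le (s : Finset α) (v : α → ι → ℝ) (θ : ι → ℝ) (ε : α → ℝ)
    {A : Matrix ι ι ℝ} (hA : A = 1 + ∑ p ∈ s, vecMulVec (v p) (v p)) (x : ι → ℝ) :
    |x ⬝ᵥ A⁻¹ *ᵥ (∑ p ∈ s, (v p ⬝ᵥ θ + ε p) • v p) - x ⬝ᵥ θ| ≤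
      matNorm A⁻¹ x * (√(θ ⬝ᵥ θ) + matNorm A⁻¹ (∑ p ∈ s, ε p • v p)) := by
  have hP : A.PosDef := hA ▸ posDef_one_add_sum s v
  -- The noiseless part is `(A - 1) θ`, so after applying `A⁻¹` the bias is `-A⁻¹ θ`, of `A`-norm at
  -- most `‖θ‖` because `A ≥ 1`.
  have hsum : ∑ p ∈ s, (v p ⬝ᵥ θ + ε p) • v p = A *ᵥ θ - θ + ∑ p ∈ s, ε p • v p := by
    rw [hA, add_mulVec, one_mulVec, sum_mulVec, add_sub_cancel_left, ← Finset.sum_add_distrib]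
    refine Finset.sum_congr rfl fun p _ => ?_
    rw [add_smul, vecMulVec_mulVec, op_smul_eq_smul]
  have hinv : A⁻¹ *ᵥ (A *ᵥ θ) = θ := by
    rw [mulVec_mulVec, nonsing_inv_mul _ ((isUnit_iff_isUnit_det A).1 hP.isUnit), one_mulVec]
  rw [hsum, mulVec_add, mulVec_sub, hinv, dotProduct_add, dotProduct_sub]
  have h1 := abs_dotProduct_mulVec_le hP.inv.posSemidef x θ
  have h2 := abs_dotProduct_mulVec_le hP.inv.posSemidef x (∑ p ∈ s, ε p • v p)
  have h3 : matNorm A⁻¹ θ ≤ √(θ ⬝ᵥ θ) := by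
    refine Real.sqrt_le_sqrt (inv_quadForm_le_of_one_le hP (fun y => ?_) θ)
    rw [hA, quadForm_one_add_sum]
    exact le_add_of_nonneg_right (Finset.sum_nonneg fun p _ => sq_nonneg _)
  have h4 := mul_le_mul_of_nonneg_left h3 (matNorm_nonneg A⁻¹ x)
  rw [abs_le] at h1 h2 ⊢
  constructor <;> nlinarith

theorem one_add_sum_quadForm_le (s : Finset α) (v : α → ι → ℝ) (hv : ∀ p, v p ⬝ᵥ v p ≤ 1)
    {N : ℝ} (hN : (s.card : ℝ) ≤ N) (x : ι → ℝ) :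
    x ⬝ᵥ (1 + ∑ p ∈ s, vecMulVec (v p) (v p)) *ᵥ x ≤ (1 + N) * (x ⬝ᵥ x) := by
  rw [quadForm_one_add_sum]
  have hx : 0 ≤ x ⬝ᵥ x := by simpa using dotProduct_star_self_nonneg x
  have h : ∀ p ∈ s, (x ⬝ᵥ v p) ^ 2 ≤ x ⬝ᵥ x := fun p _ => by
    have := posSemidef_cauchySchwarz (PosSemidef.one (n := ι) (R := ℝ)) x (v p)
    simp only [one_mulVec] at this
    exact this.trans (mul_le_of_le_one_right hx (hv p))
  have := Finset.sum_le_card_nsmul s _ _ h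
  rw [nsmul_eq_mul] at this
  nlinarith

theorem det_one_add_sum_le (s : Finset α) (v : α → ι → ℝ) (hv : ∀ p, v p ⬝ᵥ v p ≤ 1)
    {N : ℝ} (hN : (s.card : ℝ) ≤ N) :
    (1 + ∑ p ∈ s, vecMulVec (v p) (v p)).det ≤ (1 + N) ^ Fintype.card ι :=
  (det_le_and_det_mul_inv_quadForm_le (posDef_one_add_sum s v)
    (by have : (0 : ℝ) ≤ s.card := by positivity
        linarith) (one_add_sum_quadForm_le s v hv hN)).1

/-- The bound on `det A • A⁻¹` is used in place of one on `A⁻¹`: the factor `1 / √det A` completes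
the likelihood ratio, and the exponent is one less than the dimension. -/
theorem matNorm_inv_le_of_one_add_sum (s : Finset α) (v : α → ι → ℝ) (hv : ∀ p, v p ⬝ᵥ v p ≤ 1)
    {N : ℝ} (hN : (s.card : ℝ) ≤ N) {A : Matrix ι ι ℝ}
    (hA : A = 1 + ∑ p ∈ s, vecMulVec (v p) (v p)) {x : ι → ℝ} (hx : x ⬝ᵥ x ≤ 1) :
    matNorm A⁻¹ x ≤ √((1 + N) ^ (Fintype.card ι - 1)) / √A.det := by
  have hP : A.PosDef := hA ▸ posDef_one_add_sum s v
  have h0 : (0 : ℝ) ≤ s.card := by positivity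
  have h := (det_le_and_det_mul_inv_quadForm_le hP (c := 1 + N) (by linarith)
    (hA ▸ one_add_sum_quadForm_le s v hv hN)).2 x
  rw [← Real.sqrt_div (pow_nonneg (by linarith) _)]
  refine Real.sqrt_le_sqrt ?_
  rw [le_div_iff₀ hP.det_pos, mul_comm]
  refine h.trans (mul_le_of_le_one_right (pow_nonneg (by linarith) _) hx)

end Regression

/-! ### Truncated confidence bounds and their excess -/

section Clip

theorem clip_mem {x : ℝ} : -1 ≤ clip (-1) 1 x ∧ clip (-1) 1 x ≤ 1 := by
  unfold clip
  exact ⟨le_max_left _ _, max_le (by norm_num) (min_le_right _ _)⟩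

/-- Optimism of a truncated upper confidence bound, up to the excess of the actual deviation `s`
over the assumed one `b`. -/
theorem sub_clip_le {u z n s b d : ℝ} (hu : |u| ≤ 1) (hn : 0 ≤ n)
    (hz : |z - u| ≤ n * (d + s)) :
    u - clip (-1) 1 (z + (b + d) * n) ≤ max (s - b) 0 * n := by
  have h0 : 0 ≤ max (s - b) 0 * n := mul_nonneg (le_max_right _ _) hn
  have h1 : (s - b) * n ≤ max (s - b) 0 * n := mul_le_mul_of_nonneg_right (le_max_left _ _) hn
  rw [abs_le] at hu hz
  unfold clip
  have h2 : u - max (s - b) 0 * n ≤ min (z + (b + d) * n) 1 :=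
    le_min (by nlinarith) (by linarith)
  linarith [le_max_right (-1) (min (z + (b + d) * n) 1)]

/-- If the width `(b + d) * n` is at least `1`, both values lie in `[-1, 1]` and the error is at
most `2`. Otherwise the ridge error and the added width give `n * (d + s) + (b + d) * n = 2 * ((b +
d) * n) + (s - b) * n`. -/
theorem clip_sub_le {u z n s b d : ℝ} (hu : |u| ≤ 1) (hn : 0 ≤ n)
    (hz : |z - u| ≤ n * (d + s)) (hb : 0 ≤ b) (hd : 0 ≤ d) :
    clip (-1) 1 (z + (b + d) * n) - u ≤ 2 * min 1 ((b + d) * n) + max (s - b) 0 * n := by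
  have h0 : 0 ≤ max (s - b) 0 * n := mul_nonneg (le_max_right _ _) hn
  have h1 : (s - b) * n ≤ max (s - b) 0 * n := mul_le_mul_of_nonneg_right (le_max_left _ _) hn
  have hc := clip_mem (x := z + (b + d) * n)
  have hbn : 0 ≤ (b + d) * n := by positivity
  rw [abs_le] at hu hz
  rcases le_total 1 ((b + d) * n) with h | h
  · rw [min_eq_left h]; linarith
  · rw [min_eq_right h]
    have : clip (-1) 1 (z + (b + d) * n) ≤ u + (2 * ((b + d) * n) + max (s - b) 0 * n) := by
      unfold clip
      refine max_le (by nlinarith) ((min_le_left _ _).trans ?_)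
      nlinarith
    linarith

/-- The tail of a Gaussian density. -/
theorem max_sub_mul_exp_le {s b : ℝ} (hb : 0 ≤ b) :
    max (s - b) 0 ≤ Real.exp (-(b ^ 2) / 2) * Real.exp (s ^ 2 / 2) := by
  rw [← Real.exp_add]
  refine max_le ?_ (Real.exp_pos _).le
  rcases le_total s b with h | h
  · linarith [Real.exp_pos (-b ^ 2 / 2 + s ^ 2 / 2)]
  · have h1 := Real.add_one_le_exp (-b ^ 2 / 2 + s ^ 2 / 2)
    -- With `t = s - b ≥ 0` the exponent is `b t + t² / 2`, and `1 + t² / 2 ≥ t`.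
    nlinarith [sq_nonneg (s - b - 1), mul_nonneg hb (sub_nonneg.2 h)]

end Clip

/-! ### Estimates built from the record, and the likelihood ratio -/

section Record

variable {𝒞 Υ 𝓘 𝓙 : Type*} {H K d : ℕ}

/-- The Frobenius norm of a rank-one matrix is the product of the norms of its factors. -/
theorem feature_dotProduct_self (ψ : 𝒞 → Υ → EuclideanSpace ℝ (Fin d))
    (φ : 𝓘 → 𝓙 → EuclideanSpace ℝ (Fin d)) (c : 𝒞) (e : Υ) (i : 𝓘) (j : 𝓙) :
    feature ψ φ c e i j ⬝ᵥ feature ψ φ c e i j = ‖ψ c e‖ ^ 2 * ‖φ i j‖ ^ 2 := by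
  rw [EuclideanSpace.real_norm_sq_eq, EuclideanSpace.real_norm_sq_eq, Finset.sum_mul_sum,
    dotProduct, Fintype.sum_prod_type, Finset.sum_comm]
  refine Finset.sum_congr rfl fun a _ => Finset.sum_congr rfl fun b _ => ?_
  simp only [feature, vec, vecMulVec_apply]
  ring

theorem feature_dotProduct_self_le {ψ : 𝒞 → Υ → EuclideanSpace ℝ (Fin d)}
    {φ : 𝓘 → 𝓙 → EuclideanSpace ℝ (Fin d)} (hψ : ∀ c e, ‖ψ c e‖ ≤ 1) (hφ : ∀ i j, ‖φ i j‖ ≤ 1)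
    (c : 𝒞) (e : Υ) (i : 𝓘) (j : 𝓙) : feature ψ φ c e i j ⬝ᵥ feature ψ φ c e i j ≤ 1 := by
  rw [feature_dotProduct_self]
  exact mul_le_one₀ (pow_le_one₀ (norm_nonneg _) (hψ c e)) (by positivity)
    (pow_le_one₀ (norm_nonneg _) (hφ i j))

/-- The feature of the pair `p` at step `h` of episode `t`. -/
def Record.feat (D : Record 𝒞 Υ 𝓘 𝓙 H K) (ψ : 𝒞 → Υ → EuclideanSpace ℝ (Fin d))
    (φ : 𝓘 → 𝓙 → EuclideanSpace ℝ (Fin d)) (h : Fin H) (t : Fin K) (p : 𝓘 × 𝓙) :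
    Fin d × Fin d → ℝ :=
  feature ψ φ (D.ctx t h.castSucc) (D.act t h) p.1 p.2

/-- The observations at step `h` in the episodes before `k`. -/
def Record.samples (D : Record 𝒞 Υ 𝓘 𝓙 H K) (k : Fin K) (h : Fin H) :
    Finset (Σ _ : Fin K, 𝓘 × 𝓙) :=
  (Finset.Iio k).sigma fun t => D.mat t h

/-- The noise part `∑ ε Φ` of the ridge regression. -/
def Record.noiseSum (D : Record 𝒞 Υ 𝓘 𝓙 H K) (ψ : 𝒞 → Υ → EuclideanSpace ℝ (Fin d))
    (φ : 𝓘 → 𝓙 → EuclideanSpace ℝ (Fin d)) (ε : Fin K → Fin H → 𝓘 → 𝓙 → ℝ)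
    (k : Fin K) (h : Fin H) : Fin d × Fin d → ℝ :=
  ∑ t ∈ Finset.Iio k, ∑ p ∈ D.mat t h, ε t h p.1 p.2 • D.feat ψ φ h t p

theorem Record.gram_eq (D : Record 𝒞 Υ 𝓘 𝓙 H K) (ψ : 𝒞 → Υ → EuclideanSpace ℝ (Fin d))
    (φ : 𝓘 → 𝓙 → EuclideanSpace ℝ (Fin d)) (k : Fin K) (h : Fin H) :
    D.gram ψ φ 1 k h = 1 + ∑ x ∈ D.samples k h,
      vecMulVec (D.feat ψ φ h x.1 x.2) (D.feat ψ φ h x.1 x.2) := by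
  rw [Record.gram, one_smul, Record.samples, Finset.sum_sigma]
  rfl

theorem Record.card_samples_le {D : Record 𝒞 Υ 𝓘 𝓙 H K} {h : Fin H} {m : ℕ}
    (hm : ∀ t, (D.mat t h).card ≤ m) (k : Fin K) : ((D.samples k h).card : ℝ) ≤ K * m := by
  have : (D.samples k h).card ≤ K * m := by
    rw [Record.samples, Finset.card_sigma]
    calc _ ≤ (Finset.Iio k).card • m := Finset.sum_le_card_nsmul _ _ _ fun t _ => hm t
      _ ≤ _ := by
        rw [smul_eq_mul]
        exact Nat.mul_le_mul_right _ ((Finset.card_le_univ _).trans (by simp))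
  exact_mod_cast this

theorem Record.gram_posDef (D : Record 𝒞 Υ 𝓘 𝓙 H K) (ψ : 𝒞 → Υ → EuclideanSpace ℝ (Fin d))
    (φ : 𝓘 → 𝓙 → EuclideanSpace ℝ (Fin d)) (k : Fin K) (h : Fin H) :
    (D.gram ψ φ 1 k h).PosDef := D.gram_eq ψ φ k h ▸ posDef_one_add_sum _ _

theorem Record.abs_ridge_sub_le (D : Record 𝒞 Υ 𝓘 𝓙 H K)
    (ψ : 𝒞 → Υ → EuclideanSpace ℝ (Fin d)) (φ : 𝓘 → 𝓙 → EuclideanSpace ℝ (Fin d))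
    (y ε : Fin K → Fin H → 𝓘 → 𝓙 → ℝ) (k : Fin K) (h : Fin H)
    (θ : EuclideanSpace ℝ (Fin d × Fin d)) (hθ : ‖θ‖ ≤ d)
    (hy : ∀ t i j, y t h i j = D.feat ψ φ h t (i, j) ⬝ᵥ θ.ofLp + ε t h i j)
    (x : Fin d × Fin d → ℝ) :
    |x ⬝ᵥ D.ridge ψ φ 1 y k h - x ⬝ᵥ θ.ofLp| ≤ matNorm (D.gram ψ φ 1 k h)⁻¹ x *
      (d + matNorm (D.gram ψ φ 1 k h)⁻¹ (D.noiseSum ψ φ ε k h)) := by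
  have h1 := MarkovMatching.abs_ridge_sub_le (D.samples k h) (fun x => D.feat ψ φ h x.1 x.2) θ.ofLp
    (fun x => ε x.1 h x.2.1 x.2.2) (D.gram_eq ψ φ k h) x
  have hr : ∑ x ∈ D.samples k h, (D.feat ψ φ h x.1 x.2 ⬝ᵥ θ.ofLp + ε x.1 h x.2.1 x.2.2)
      • D.feat ψ φ h x.1 x.2 = ∑ t ∈ Finset.Iio k, ∑ p ∈ D.mat t h,
      y t h p.1 p.2 • feature ψ φ (D.ctx t h.castSucc) (D.act t h) p.1 p.2 := by
    rw [Record.samples, Finset.sum_sigma]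
    exact Finset.sum_congr rfl fun t _ => Finset.sum_congr rfl fun p _ => by rw [hy]; rfl
  have hn : ∑ x ∈ D.samples k h, ε x.1 h x.2.1 x.2.2 • D.feat ψ φ h x.1 x.2
      = D.noiseSum ψ φ ε k h := by
    rw [Record.samples, Finset.sum_sigma]; rfl
  rw [hr, hn] at h1
  refine h1.trans (mul_le_mul_of_nonneg_left ?_ (matNorm_nonneg _ _))
  have : √(θ.ofLp ⬝ᵥ θ.ofLp) = ‖θ‖ := by
    rw [EuclideanSpace.norm_eq]
    congr 1
    exact Finset.sum_congr rfl fun i _ => by rw [Real.norm_eq_abs, sq_abs, sq]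
  linarith

/-- The likelihood ratio `exp (‖S‖² / 2) / √det` of the method of mixtures. -/
noncomputable def Record.mixture (D : Record 𝒞 Υ 𝓘 𝓙 H K)
    (ψ : 𝒞 → Υ → EuclideanSpace ℝ (Fin d)) (φ : 𝓘 → 𝓙 → EuclideanSpace ℝ (Fin d))
    (ε : Fin K → Fin H → 𝓘 → 𝓙 → ℝ) (k : Fin K) (h : Fin H) : ℝ :=
  Real.exp ((D.noiseSum ψ φ ε k h ⬝ᵥ (D.gram ψ φ 1 k h)⁻¹ *ᵥ D.noiseSum ψ φ ε k h) / 2)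
    / √(D.gram ψ φ 1 k h).det

theorem Record.mixture_nonneg (D : Record 𝒞 Υ 𝓘 𝓙 H K)
    (ψ : 𝒞 → Υ → EuclideanSpace ℝ (Fin d)) (φ : 𝓘 → 𝓙 → EuclideanSpace ℝ (Fin d))
    (ε : Fin K → Fin H → 𝓘 → 𝓙 → ℝ) (k : Fin K) (h : Fin H) : 0 ≤ D.mixture ψ φ ε k h :=
  div_nonneg (Real.exp_pos _).le (Real.sqrt_nonneg _)

/-- The failure of optimism is controlled by the likelihood ratio: where the noise exceeds its
confidence radius `b`, its effect on any prediction is small in proportion. -/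
theorem Record.excess_le {D : Record 𝒞 Υ 𝓘 𝓙 H K}
    {ψ : 𝒞 → Υ → EuclideanSpace ℝ (Fin d)} {φ : 𝓘 → 𝓙 → EuclideanSpace ℝ (Fin d)}
    (hψ : ∀ c e, ‖ψ c e‖ ≤ 1) (hφ : ∀ i j, ‖φ i j‖ ≤ 1) {m : ℕ} {h : Fin H}
    (hm : ∀ t, (D.mat t h).card ≤ m) (ε : Fin K → Fin H → 𝓘 → 𝓙 → ℝ) (k : Fin K)
    {b : ℝ} (hb : 0 ≤ b) {x : Fin d × Fin d → ℝ} (hx : x ⬝ᵥ x ≤ 1) :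
    max (matNorm (D.gram ψ φ 1 k h)⁻¹ (D.noiseSum ψ φ ε k h) - b) 0
        * matNorm (D.gram ψ φ 1 k h)⁻¹ x ≤
      Real.exp (-(b ^ 2) / 2) * √((1 + (K : ℝ) * m) ^ (d ^ 2 - 1)) * D.mixture ψ φ ε k h := by
  have h1 := max_sub_mul_exp_le
    (s := matNorm (D.gram ψ φ 1 k h)⁻¹ (D.noiseSum ψ φ ε k h)) hb
  rw [matNorm_sq (D.gram_posDef ψ φ k h).inv.posSemidef] at h1
  have h2 := matNorm_inv_le_of_one_add_sum (D.samples k h) (fun x => D.feat ψ φ h x.1 x.2)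
    (fun x => feature_dotProduct_self_le hψ hφ _ _ _ _) (D.card_samples_le hm k)
    (D.gram_eq ψ φ k h) hx
  have hc : Fintype.card (Fin d × Fin d) = d ^ 2 := by simp [sq]
  rw [hc] at h2
  refine (mul_le_mul h1 h2 (matNorm_nonneg _ _) (by positivity)).trans (le_of_eq ?_)
  rw [Record.mixture]
  ring

end Record

/-! ### Elliptical potential with batch updates -/

section Potential

variable {ι α : Type*} [DecidableEq ι]

/-- Through `min 1 q ≤ 2 q / (1 + q)` and `1 - 1 / y ≤ log y` at `y = 1 + q`. -/
theorem min_one_le_two_mul_log {q : ℝ} (hq : 0 ≤ q) : min 1 q ≤ 2 * Real.log (1 + q) := by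
  have h := Real.one_sub_inv_le_log_of_pos (show 0 < 1 + q by linarith)
  have h2 : min 1 q ≤ 2 * (1 - (1 + q)⁻¹) := by
    have h3 : 1 - (1 + q)⁻¹ = q / (1 + q) := by field_simp; ring
    rw [h3, ← mul_div_assoc, le_div_iff₀ (by linarith)]
    rcases le_total 1 q with h | h
    · rw [min_eq_left h]; linarith
    · rw [min_eq_right h]; nlinarith
  linarith

/-- The regularized Gram matrix of the vectors in the batches before `n`. -/
noncomputable def batchGram (X : ℕ → Finset α) (v : ℕ → α → ι → ℝ) (n : ℕ) : Matrix ι ι ℝ :=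
  1 + ∑ t ∈ Finset.range n, ∑ p ∈ X t, vecMulVec (v t p) (v t p)

theorem batchGram_succ (X : ℕ → Finset α) (v : ℕ → α → ι → ℝ) (n : ℕ) :
    batchGram X v (n + 1) = batchGram X v n + ∑ p ∈ X n, vecMulVec (v n p) (v n p) := by
  rw [batchGram, Finset.sum_range_succ, ← add_assoc, batchGram]

theorem batchGram_eq_sigma (X : ℕ → Finset α) (v : ℕ → α → ι → ℝ) (n : ℕ) :
    batchGram X v n = 1 + ∑ x ∈ (Finset.range n).sigma X,
      vecMulVec (v x.1 x.2) (v x.1 x.2) := by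
  rw [batchGram, Finset.sum_sigma]

variable [Fintype ι]

theorem batchGram_posDef (X : ℕ → Finset α) (v : ℕ → α → ι → ℝ) (n : ℕ) :
    (batchGram X v n).PosDef := batchGram_eq_sigma X v n ▸ posDef_one_add_sum _ _

/-- The elliptical potential bound when the Gram matrix is updated in batches of at most `m`
vectors. -/
theorem sum_min_one_matNorm_le {X : ℕ → Finset α} {v : ℕ → α → ι → ℝ}
    (hv : ∀ n p, v n p ⬝ᵥ v n p ≤ 1) {m m' : ℕ} (hm : ∀ n, (X n).card ≤ m) (hm' : m ≤ m') {β : ℝ}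
    (hβ : 1 ≤ β) (K : ℕ) :
    ∑ n ∈ Finset.range K, ∑ p ∈ X n, min 1 (β * matNorm (batchGram X v n)⁻¹ (v n p)) ≤
      m * (β * (√K * √(2 * (Fintype.card ι * Real.log (1 + (K : ℝ) * m'))))) := by
  set ℓ : ℕ → ℝ := fun n => Real.log (batchGram X v n).det with hℓ
  have hpos : ∀ n, 0 < (batchGram X v n).det := fun n => (batchGram_posDef X v n).det_pos
  -- Each vector of batch `n` is charged the entire increase of `log det` over that batch. The
  -- truncation at `1` is what lets the logarithm dominate, and `β ≥ 1` can be pulled out of it.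
  have hstep : ∀ n, ∀ p ∈ X n, min 1 (β * matNorm (batchGram X v n)⁻¹ (v n p)) ≤
      β * √(2 * (ℓ (n + 1) - ℓ n)) := by
    intro n p hp
    set x := matNorm (batchGram X v n)⁻¹ (v n p)
    have hx : 0 ≤ x := matNorm_nonneg _ _
    have hxq : x ^ 2 = v n p ⬝ᵥ (batchGram X v n)⁻¹ *ᵥ v n p :=
      matNorm_sq (batchGram_posDef X v n).inv.posSemidef _
    have h1 : min 1 (β * x) ≤ β * min 1 x := by
      rcases le_total 1 x with h | h
      · rw [min_eq_left h]; exact (min_le_left _ _).trans (by linarith)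
      · rw [min_eq_right h]; exact min_le_right _ _
    refine h1.trans (mul_le_mul_of_nonneg_left (Real.le_sqrt_of_sq_le ?_) (by linarith))
    have h2 : min 1 x ^ 2 ≤ min 1 (x ^ 2) := by
      rcases le_total 1 x with h | h
      · rw [min_eq_left h, min_eq_left (by nlinarith)]; norm_num
      · rw [min_eq_right h, min_eq_right (by nlinarith)]
    refine h2.trans ((min_one_le_two_mul_log (sq_nonneg x)).trans ?_)
    have h3 := det_mul_one_add_le (batchGram_posDef X v n) (X n) (v n) hp
    rw [← batchGram_succ, ← hxq] at h3
    have h4 : Real.log (1 + x ^ 2) ≤ ℓ (n + 1) - ℓ n := by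
      rw [le_sub_iff_add_le, add_comm, hℓ]
      simp only
      rw [← Real.log_mul (hpos n).ne' (by positivity)]
      exact Real.log_le_log (mul_pos (hpos n) (by positivity)) h3
    linarith
  have hmono : ∀ n, 0 ≤ ℓ (n + 1) - ℓ n := fun n => by
    rw [sub_nonneg]
    refine Real.log_le_log (hpos n) ?_
    rw [batchGram_succ]
    exact det_le_det_add_sum (batchGram_posDef X v n) _ _
  have htel : ∑ n ∈ Finset.range K, (ℓ (n + 1) - ℓ n) ≤
      Fintype.card ι * Real.log (1 + (K : ℝ) * m') := by
    rw [Finset.sum_range_sub]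
    have h0 : ℓ 0 = 0 := by simp [hℓ, batchGram]
    rw [h0, sub_zero, ← Real.log_pow]
    refine Real.log_le_log (hpos K) ?_
    rw [batchGram_eq_sigma]
    refine det_one_add_sum_le _ _ (fun x => hv x.1 x.2) ?_
    have : ((Finset.range K).sigma X).card ≤ K * m' := by
      rw [Finset.card_sigma]
      refine (Finset.sum_le_card_nsmul _ _ _ fun t _ => (hm t).trans hm').trans ?_
      simp
    exact_mod_cast this
  -- Cauchy-Schwarz over the episodes only. The batch size `m` enters as a factor at the end,
  -- whereas `m'` occurs only inside the logarithm, so that one logarithm serves all steps `h`.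
  have hcs : ∑ n ∈ Finset.range K, √(2 * (ℓ (n + 1) - ℓ n)) ≤
      √K * √(2 * (Fintype.card ι * Real.log (1 + (K : ℝ) * m'))) := by
    rw [← Real.sqrt_mul (by positivity)]
    refine Real.le_sqrt_of_sq_le ?_
    have h := sq_sum_le_card_mul_sum_sq (s := Finset.range K)
      (f := fun n => √(2 * (ℓ (n + 1) - ℓ n)))
    rw [Finset.card_range] at h
    refine h.trans (mul_le_mul_of_nonneg_left ?_ (by positivity))
    rw [Finset.sum_congr rfl fun n _ => Real.sq_sqrt (mul_nonneg zero_le_two (hmono n)),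
      ← Finset.mul_sum]
    linarith
  calc _ ≤ ∑ n ∈ Finset.range K, m * (β * √(2 * (ℓ (n + 1) - ℓ n))) := by
        refine Finset.sum_le_sum fun n _ => ?_
        refine (Finset.sum_le_card_nsmul _ _ _ (hstep n)).trans ?_
        rw [nsmul_eq_mul]
        refine mul_le_mul_of_nonneg_right (by exact_mod_cast hm n) ?_
        exact mul_nonneg (by linarith) (Real.sqrt_nonneg _)
    _ = m * (β * ∑ n ∈ Finset.range K, √(2 * (ℓ (n + 1) - ℓ n))) := by
        rw [Finset.mul_sum, Finset.mul_sum]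
    _ ≤ _ := by gcongr

variable {𝒞 Υ 𝓘 𝓙 : Type*} {H K d : ℕ}

theorem sum_Iio_fin_eq {M : Type*} [AddCommMonoid M] (f : ℕ → M) (k : Fin K) :
    ∑ t ∈ Finset.Iio k, f t = ∑ t ∈ Finset.range k, f t := by
  rw [← Nat.Iio_eq_range, ← Fin.map_valEmbedding_Iio, Finset.sum_map]
  rfl

/-- The sum of the exploration bonuses at step `h` along the record. -/
theorem Record.sum_bonus_le {D : Record 𝒞 Υ 𝓘 𝓙 H K}
    {ψ : 𝒞 → Υ → EuclideanSpace ℝ (Fin d)} {φ : 𝓘 → 𝓙 → EuclideanSpace ℝ (Fin d)}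
    (hψ : ∀ c e, ‖ψ c e‖ ≤ 1) (hφ : ∀ i j, ‖φ i j‖ ≤ 1) {m m' : ℕ} {h : Fin H}
    (hm : ∀ t, (D.mat t h).card ≤ m) (hm' : m ≤ m') {β : ℝ} (hβ : 1 ≤ β) :
    ∑ k, ∑ p ∈ D.mat k h, min 1 (β * matNorm (D.gram ψ φ 1 k h)⁻¹ (D.feat ψ φ h k p)) ≤
      m * (β * (√K * √(2 * ((d : ℝ) ^ 2 * Real.log (1 + (K : ℝ) * m'))))) := by
  classical
  -- Beyond the last episode the record is continued by empty batches, so that the telescoping sum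
  -- can run over `ℕ`.
  set X : ℕ → Finset (𝓘 × 𝓙) := fun n => if hn : n < K then D.mat ⟨n, hn⟩ h else ∅ with hX
  set v : ℕ → 𝓘 × 𝓙 → Fin d × Fin d → ℝ :=
    fun n p => if hn : n < K then D.feat ψ φ h ⟨n, hn⟩ p else 0 with hv
  have hXk : ∀ k : Fin K, X k = D.mat k h := fun k => by simp [hX]
  have hvk : ∀ k : Fin K, v k = D.feat ψ φ h k := fun k => by funext p; simp [hv]
  have hg : ∀ k : Fin K, batchGram X v k = D.gram ψ φ 1 k h := fun k => by
    rw [batchGram, ← sum_Iio_fin_eq (fun t => ∑ p ∈ X t, vecMulVec (v t p) (v t p)), Record.gram,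
      one_smul]
    congr 1
    exact Finset.sum_congr rfl fun t _ => by rw [hXk, hvk]; rfl
  have key := sum_min_one_matNorm_le (X := X) (v := v) (m := m) (m' := m') (β := β)
    (fun n p => by
      by_cases hn : n < K
      · simp only [hv, hn, dite_true]
        exact feature_dotProduct_self_le hψ hφ _ _ _ _
      · simp [hv, hn])
    (fun n => by
      by_cases hn : n < K
      · simp only [hX, hn, dite_true]; exact hm _
      · simp [hX, hn]) hm' hβ K
  rw [← Fin.sum_univ_eq_sum_range
    (fun n => ∑ p ∈ X n, min 1 (β * matNorm (batchGram X v n)⁻¹ (v n p)))] at key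
  have hc : (Fintype.card (Fin d × Fin d) : ℝ) = (d : ℝ) ^ 2 := by simp [sq]
  rw [hc] at key
  refine le_trans (le_of_eq (Finset.sum_congr rfl fun k _ => ?_)) key
  rw [hXk, hvk, hg]

end Potential

/-! ### One step of the exponential supermartingale -/

section SubgaussianStep

variable {ι Ω S : Type*} [Fintype ι] [MeasurableSpace Ω] [MeasurableSpace S] {μ : Measure Ω}

/-- By independence the linear combination is subgaussian with variance proxy `∑ a q ^ 2`; the
subtracted term is its log-moment bound at `1`. -/
theorem lintegral_exp_sum_sub_le_one {ε : ι → Ω → ℝ} (hind : iIndepFun ε μ)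
    (hsub : ∀ q, HasSubgaussianMGF (ε q) 1 μ) (a : ι → ℝ) :
    ∫⁻ ω, ENNReal.ofReal (Real.exp (∑ q, (a q * ε q ω - a q ^ 2 / 2))) ∂μ ≤ 1 := by
  have h := HasSubgaussianMGF.sum_of_iIndepFun (s := Finset.univ)
    (hind.comp (fun q x => a q * x) fun q => measurable_const_mul _)
    (c := fun q => (a q ^ 2).toNNReal) fun q _ => by
      have h := (hsub q).const_mul (a q)
      convert h using 1
      · rfl
      · refine NNReal.eq ?_
        rw [Real.coe_toNNReal _ (sq_nonneg _)]
        exact (mul_one (a q ^ 2)).symm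
  have hint := h.integrable_exp_mul 1
  have hmgf := h.mgf_le 1
  rw [mgf] at hmgf
  simp only [one_mul, Function.comp_apply, mul_one, one_pow, NNReal.coe_sum,
    Real.coe_toNNReal _ (sq_nonneg _)]
    at hint hmgf
  have hsplit : ∀ ω, Real.exp (∑ q, (a q * ε q ω - a q ^ 2 / 2))
      = Real.exp (∑ q, a q * ε q ω) * Real.exp (-((∑ q, a q ^ 2) / 2)) := fun ω => by
    rw [← Real.exp_add, Finset.sum_sub_distrib, Finset.sum_div, sub_eq_add_neg]
  simp_rw [hsplit]
  rw [← ofReal_integral_eq_lintegral_ofReal (hint.mul_const _)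
    (ae_of_all _ fun ω => by positivity), integral_mul_const]
  rw [ENNReal.ofReal_le_one]
  calc _ ≤ Real.exp ((∑ q, a q ^ 2) / 2) * Real.exp (-((∑ q, a q ^ 2) / 2)) := by gcongr
    _ = 1 := by rw [← Real.exp_add, add_neg_cancel, Real.exp_zero]

variable [IsProbabilityMeasure μ]

/-- One step of the exponential supermartingale: the coefficients `a` and the weight `Z` are
functions of the past `f`, of which the noise `ε` is independent. -/
theorem lintegral_mul_exp_le_of_indepFun {ε : ι → Ω → ℝ} {f : Ω → S} (hf : Measurable f)
    (hε : ∀ q, Measurable (ε q)) (hind : iIndepFun ε μ)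
    (hpast : IndepFun f (fun ω q => ε q ω) μ)
    (hsub : ∀ q, HasSubgaussianMGF (ε q) 1 μ) {a : ι → S → ℝ} (ha : ∀ q, Measurable (a q))
    {Z : S → ENNReal} (hZ : Measurable Z) :
    ∫⁻ ω, Z (f ω) * ENNReal.ofReal
        (Real.exp (∑ q, (a q (f ω) * ε q ω - a q (f ω) ^ 2 / 2))) ∂μ ≤
      ∫⁻ ω, Z (f ω) ∂μ := by
  have hεm : Measurable fun ω q => ε q ω := measurable_pi_lambda _ hε
  set F : S × (ι → ℝ) → ENNReal := fun p => Z p.1 * ENNReal.ofReal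
    (Real.exp (∑ q, (a q p.1 * p.2 q - a q p.1 ^ 2 / 2))) with hF
  have hFm : Measurable F := by
    refine (hZ.comp measurable_fst).mul (ENNReal.measurable_ofReal.comp
      (Real.measurable_exp.comp (Finset.measurable_sum _ fun q _ => ?_)))
    have h1 : Measurable fun p : S × (ι → ℝ) => a q p.1 := (ha q).comp measurable_fst
    have h2 : Measurable fun p : S × (ι → ℝ) => p.2 q :=
      (measurable_pi_apply q).comp measurable_snd
    exact (h1.mul h2).sub ((h1.pow_const 2).div_const 2)
  have hmap := (indepFun_iff_map_prod_eq_prod_map_map hf.aemeasurable hεm.aemeasurable).1 hpast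
  have : IsProbabilityMeasure (μ.map fun ω q => ε q ω) :=
    Measure.isProbabilityMeasure_map hεm.aemeasurable
  calc _ = ∫⁻ ω, F (f ω, fun q => ε q ω) ∂μ := rfl
    _ = ∫⁻ p, F p ∂(μ.map fun ω => (f ω, fun q => ε q ω)) :=
        (lintegral_map hFm (hf.prodMk hεm)).symm
    _ = ∫⁻ s, ∫⁻ e, F (s, e) ∂(μ.map fun ω q => ε q ω) ∂(μ.map f) := by
        rw [hmap, lintegral_prod _ hFm.aemeasurable]
    -- The joint law is a product, so the noise is integrated first, with the past `s`, and hence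
    -- all coefficients, frozen.
    _ ≤ ∫⁻ s, Z s ∂(μ.map f) := by
        refine lintegral_mono fun s => ?_
        have hFs : Measurable fun e => F (s, e) := hFm.comp measurable_prodMk_left
        rw [lintegral_map hFs hεm]
        simp only [hF]
        rw [lintegral_const_mul]
        · exact mul_le_of_le_one_right' (lintegral_exp_sum_sub_le_one hind hsub _)
        · refine ENNReal.measurable_ofReal.comp
            (Real.measurable_exp.comp (Finset.measurable_sum _ fun q _ => ?_))
          exact ((hε q).const_mul _).sub_const _
    _ = _ := lintegral_map hZ hf

end SubgaussianStep

/-! ### Mean of the likelihood ratio along the interaction -/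

section Interaction

variable {𝒞 Υ 𝓘 𝓙 : Type*} [MeasurableSpace 𝒞] [MeasurableSpace Υ] {H K d : ℕ}
  {M : Market 𝒞 Υ 𝓘 𝓙 H} {Ω : Type*} [mΩ : MeasurableSpace Ω] {μ : Measure Ω}

theorem measurable_feature {T : Type*} [MeasurableSpace T]
    {ψ : 𝒞 → Υ → EuclideanSpace ℝ (Fin d)} (hψ : Measurable (Function.uncurry ψ))
    (φ : 𝓘 → 𝓙 → EuclideanSpace ℝ (Fin d)) {c : T → 𝒞} {e : T → Υ} (hc : Measurable c)
    (he : Measurable e) (i : 𝓘) (j : 𝓙) :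
    Measurable fun x => feature ψ φ (c x) (e x) i j := by
  have h : Measurable fun x => ψ (c x) (e x) := hψ.comp (hc.prodMk he)
  refine measurable_pi_lambda _ fun q => ?_
  simp only [feature, vec, vecMulVec_apply]
  refine Measurable.mul_const ?_ _
  exact (measurable_pi_apply q.2).comp ((WithLp.measurable_ofLp 2 _).comp h)

/-- The noise of a step becomes known one time index after its context; this still precedes every
step of a later episode. -/
theorem Interaction.le_index {k t : Fin K} (hkt : t < k) (h h' : Fin H) :
    (t : ℕ) * (H + 1) + h + 1 ≤ k * (H + 1) + h' := by
  have h1 : (t : ℕ) + 1 ≤ k := hkt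
  have h2 := Nat.mul_le_mul_right (H + 1) h1
  have := h.2
  nlinarith

theorem Interaction.measurable_id_le (R : Interaction M K μ) {a b : ℕ} (hab : a ≤ b) :
    @Measurable Ω Ω (R.ℱ b) (R.ℱ a) id :=
  measurable_id'' (R.ℱ.mono hab)

/-- A policy is a joint function of the information at the start of its episode and a context.
Composing with this map evaluates it at the current context. -/
theorem Interaction.measurable_pair (R : Interaction M K μ) (k : Fin K) (h : Fin H) :
    @Measurable Ω (Ω × 𝒞) (R.ℱ (k * (H + 1) + h)) ((R.ℱ (k * (H + 1))).prod ‹MeasurableSpace 𝒞›)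
      fun ω => (ω, R.ctx k h.castSucc ω) :=
  (R.measurable_id_le (Nat.le_add_right _ _)).prodMk (R.measurable_ctx k h.castSucc)

theorem Interaction.measurable_record_act (R : Interaction M K μ) (k : Fin K) (h : Fin H) :
    Measurable[R.ℱ (k * (H + 1) + h)] fun ω => (R.record ω).act k h :=
  (R.measurable_act k h).comp (R.measurable_pair k h)

theorem Interaction.measurable_feat (R : Interaction M K μ)
    {ψ : 𝒞 → Υ → EuclideanSpace ℝ (Fin d)} (hψ : Measurable (Function.uncurry ψ))
    (φ : 𝓘 → 𝓙 → EuclideanSpace ℝ (Fin d)) (k : Fin K) (h : Fin H) (p : 𝓘 × 𝓙) :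
    Measurable[R.ℱ (k * (H + 1) + h)] fun ω => (R.record ω).feat ψ φ h k p :=
  @measurable_feature _ _ _ _ _ _ _ _ (R.ℱ (k * (H + 1) + h)) ψ hψ φ _ _
    (R.measurable_ctx k h.castSucc) (R.measurable_record_act k h) p.1 p.2

theorem Interaction.measurableSet_mem_mat (R : Interaction M K μ) (k : Fin K) (h : Fin H)
    (p : 𝓘 × 𝓙) : MeasurableSet[R.ℱ (k * (H + 1) + h)] {ω | p ∈ (R.record ω).mat k h} :=
  (R.measurable_pair k h) (R.measurable_mat k h p)

open scoped Classical in
/-- The coefficient of the noise of the pair `p` at step `h` of episode `t` in the direction `x`. -/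
noncomputable def Interaction.coef (R : Interaction M K μ) (ψ : 𝒞 → Υ → EuclideanSpace ℝ (Fin d))
    (φ : 𝓘 → 𝓙 → EuclideanSpace ℝ (Fin d)) (h : Fin H) (t : Fin K) (p : 𝓘 × 𝓙)
    (x : Fin d × Fin d → ℝ) (ω : Ω) : ℝ :=
  if p ∈ (R.record ω).mat t h then x ⬝ᵥ (R.record ω).feat ψ φ h t p else 0

theorem measurable_dotProduct {T ι : Type*} [Fintype ι] [MeasurableSpace T] {f g : T → ι → ℝ}
    (hf : Measurable f) (hg : Measurable g) : Measurable fun x => f x ⬝ᵥ g x := by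
  unfold dotProduct
  exact Finset.measurable_sum _ fun i _ =>
    ((measurable_pi_apply i).comp hf).mul ((measurable_pi_apply i).comp hg)

theorem Interaction.measurable_coef (R : Interaction M K μ)
    {ψ : 𝒞 → Υ → EuclideanSpace ℝ (Fin d)} (hψ : Measurable (Function.uncurry ψ))
    (φ : 𝓘 → 𝓙 → EuclideanSpace ℝ (Fin d)) (h : Fin H) (t : Fin K) (p : 𝓘 × 𝓙)
    (x : Fin d × Fin d → ℝ) :
    Measurable[R.ℱ (t * (H + 1) + h)] (R.coef ψ φ h t p x) := by
  unfold Interaction.coef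
  exact Measurable.ite (R.measurableSet_mem_mat t h p)
    (@measurable_dotProduct _ _ _ (R.ℱ (t * (H + 1) + h)) _ _ (@measurable_const _ _ _ _ x)
      (R.measurable_feat hψ φ t h p)) (@measurable_const _ _ _ _ 0)

theorem Interaction.measurable_coef_prod (R : Interaction M K μ)
    {ψ : 𝒞 → Υ → EuclideanSpace ℝ (Fin d)} (hψ : Measurable (Function.uncurry ψ))
    (φ : 𝓘 → 𝓙 → EuclideanSpace ℝ (Fin d)) (h : Fin H) (t : Fin K) (p : 𝓘 × 𝓙) :
    Measurable fun y : Ω × (Fin d × Fin d → ℝ) => R.coef ψ φ h t p y.2 y.1 := by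
  classical
  have h1 : MeasurableSet {ω | p ∈ (R.record ω).mat t h} :=
    R.ℱ.le _ _ (R.measurableSet_mem_mat t h p)
  have h2 : Measurable fun ω => (R.record ω).feat ψ φ h t p :=
    (R.measurable_feat hψ φ t h p).mono (R.ℱ.le _) le_rfl
  unfold Interaction.coef
  exact Measurable.ite (measurable_fst h1)
    (measurable_dotProduct measurable_snd (h2.comp measurable_fst)) measurable_const

/-- The noise of one side, as in the definition of the record. -/
def Interaction.sideNoise (R : Interaction M K μ) (s : Side) (ω : Ω) :
    Fin K → Fin H → 𝓘 → 𝓙 → ℝ := fun t h i j => R.noise t h s i j ω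

variable [Fintype 𝓘] [Fintype 𝓙]

/-- The Gram form is `x · x` plus the sum of the squared coefficients, so the exponent splits into
the Gaussian prior and the exponent of the supermartingale. Coefficients vanishing off the matching
replace the random index set by all pairs. -/
theorem Interaction.dotProduct_noiseSum_sub (R : Interaction M K μ) (s : Side)
    (ψ : 𝒞 → Υ → EuclideanSpace ℝ (Fin d)) (φ : 𝓘 → 𝓙 → EuclideanSpace ℝ (Fin d)) (k : Fin K)
    (h : Fin H) (x : Fin d × Fin d → ℝ) (ω : Ω) :
    x ⬝ᵥ (R.record ω).noiseSum ψ φ (R.sideNoise s ω) k h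
        - (x ⬝ᵥ (R.record ω).gram ψ φ 1 k h *ᵥ x) / 2 =
      -(x ⬝ᵥ x) / 2 + ∑ t ∈ Finset.Iio k, ∑ p : 𝓘 × 𝓙,
        (R.coef ψ φ h t p x ω * R.noise t h s p.1 p.2 ω - R.coef ψ φ h t p x ω ^ 2 / 2) := by
  classical
  rw [Record.gram_eq, quadForm_one_add_sum, Record.samples, Finset.sum_sigma, Record.noiseSum,
    dotProduct_sum, add_div, Finset.sum_div, sub_add_eq_sub_sub, sub_right_comm,
    ← Finset.sum_sub_distrib, sub_eq_add_neg, add_comm, neg_div]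
  congr 1
  refine Finset.sum_congr rfl fun t _ => ?_
  rw [dotProduct_sum, Finset.sum_div, ← Finset.sum_sub_distrib,
    ← Finset.sum_subset (Finset.subset_univ ((R.record ω).mat t h))]
  · refine Finset.sum_congr rfl fun p hp => ?_
    rw [Interaction.coef, if_pos hp, dotProduct_smul, smul_eq_mul, mul_comm]
    rfl
  · intro p _ hp
    rw [Interaction.coef, if_neg hp]
    ring

variable [IsProbabilityMeasure μ]

/-- The exponential supermartingale of the noise of one side, in the direction `x`. -/
theorem Interaction.lintegral_exp_noise_le_one (R : Interaction M K μ) (s : Side)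
    {ψ : 𝒞 → Υ → EuclideanSpace ℝ (Fin d)} (hψ : Measurable (Function.uncurry ψ))
    (φ : 𝓘 → 𝓙 → EuclideanSpace ℝ (Fin d)) (h : Fin H) (x : Fin d × Fin d → ℝ) (n : ℕ) :
    ∫⁻ ω, ENNReal.ofReal (Real.exp (∑ t : Fin K with t.1 < n, ∑ p : 𝓘 × 𝓙,
      (R.coef ψ φ h t p x ω * R.noise t h s p.1 p.2 ω - R.coef ψ φ h t p x ω ^ 2 / 2))) ∂μ ≤ 1 := by
  induction n with
  | zero => simp
  | succ n ih =>
    by_cases hn : n < K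
    · set k : Fin K := ⟨n, hn⟩ with hk
      have hset : (Finset.univ.filter fun t : Fin K => t.1 < n + 1)
          = insert k (Finset.univ.filter fun t : Fin K => t.1 < n) := by
        ext t
        simp only [Finset.mem_filter, Finset.mem_univ, true_and, Finset.mem_insert, Fin.ext_iff, hk]
        omega
      have hnot : k ∉ (Finset.univ.filter fun t : Fin K => t.1 < n) := by simp [hk]
      set L : Fin K → Ω → ℝ := fun t ω => ∑ p : 𝓘 × 𝓙,
        (R.coef ψ φ h t p x ω * R.noise t h s p.1 p.2 ω - R.coef ψ φ h t p x ω ^ 2 / 2) with hL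
      set Z : Ω → ENNReal := fun ω =>
        ENNReal.ofReal (Real.exp (∑ t : Fin K with t.1 < n, L t ω)) with hZ
      set N : ℕ := k * (H + 1) + h with hN
      have hLm : ∀ t : Fin K, t.1 < n → Measurable[R.ℱ N] (L t) := by
        intro t ht
        have hle : (t : ℕ) * (H + 1) + h + 1 ≤ k * (H + 1) + h :=
          Interaction.le_index (show t < k from ht) h h
        refine @Finset.measurable_sum _ _ _ _ _ _ (R.ℱ N) _ _ fun p _ => ?_
        have h1 : Measurable[R.ℱ N] (R.coef ψ φ h t p x) :=
          (R.measurable_coef hψ φ h t p x).mono (R.ℱ.mono (by omega)) le_rfl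
        have h2 : Measurable[R.ℱ N] (R.noise t h s p.1 p.2) :=
          (R.measurable_noise t h s p.1 p.2).mono (R.ℱ.mono hle) le_rfl
        exact (h1.mul h2).sub ((h1.pow_const 2).div_const 2)
      have hZm : Measurable[R.ℱ N] Z := by
        refine ENNReal.measurable_ofReal.comp (Real.measurable_exp.comp ?_)
        refine @Finset.measurable_sum _ _ _ _ _ _ (R.ℱ N) _ _ fun t ht => hLm t ?_
        simpa using ht
      -- The past is `Ω` itself with the σ-algebra `ℱ N`, read off by `id`, so every `ℱ
      -- N`-measurable coefficient or weight is admissible.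
      have hpast : @IndepFun Ω Ω (𝓘 × 𝓙 → ℝ) mΩ (R.ℱ N) _ id
          (fun ω p => R.noise k h s p.1 p.2 ω) μ := by
        have h0 : @IndepFun Ω (Side × 𝓘 × 𝓙 → ℝ) Ω mΩ _ (R.ℱ N)
            (fun ω q => R.noise k h q.1 q.2.1 q.2.2 ω) id μ := by
          refine (@IndepFun_iff_Indep _ _ _ _ _ (R.ℱ N) _ _ _).2 ?_
          rw [MeasurableSpace.comap_id]
          exact R.noise_indep_past k h
        have h1 := h0.comp (φ := fun (y : Side × 𝓘 × 𝓙 → ℝ) (p : 𝓘 × 𝓙) => y (s, p))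
          (measurable_pi_lambda _ fun p => measurable_pi_apply _)
          (@measurable_id _ (R.ℱ N))
        exact h1.symm
      have hiind : iIndepFun (fun (p : 𝓘 × 𝓙) => R.noise k h s p.1 p.2) μ :=
        (R.noise_indep k h).precomp (g := fun p : 𝓘 × 𝓙 => (s, p)) (Prod.mk_right_injective s)
      have key := @lintegral_mul_exp_le_of_indepFun (𝓘 × 𝓙) Ω Ω _ mΩ (R.ℱ N) μ _
        (fun p => R.noise k h s p.1 p.2) id (measurable_id'' (R.ℱ.le _))
        (fun p => (R.measurable_noise k h s p.1 p.2).mono (R.ℱ.le _) le_rfl) hiind hpast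
        (fun p => R.noise_subgaussian k h s p.1 p.2) (fun p => R.coef ψ φ h k p x)
        (fun p => R.measurable_coef hψ φ h k p x) Z hZm
      refine le_trans (le_of_eq ?_) (key.trans ih)
      refine lintegral_congr fun ω => ?_
      rw [hset, Finset.sum_insert hnot, add_comm, Real.exp_add,
        ENNReal.ofReal_mul (Real.exp_pos _).le]
      rfl
    · refine le_trans (le_of_eq ?_) ih
      refine lintegral_congr fun ω => ?_
      congr 3
      ext t
      have := t.2
      simp only [Finset.mem_filter, Finset.mem_univ, true_and]
      omega

/-- Method of mixtures: averaging the exponential supermartingale over a standard Gaussian direction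
`x` gives exactly `Record.mixture`, and Tonelli transfers the bound `1` from each fixed direction.
Measurability also comes from this integral representation. -/
theorem Interaction.lintegral_mixture_le_one (R : Interaction M K μ) (s : Side)
    {ψ : 𝒞 → Υ → EuclideanSpace ℝ (Fin d)} (hψ : Measurable (Function.uncurry ψ))
    (φ : 𝓘 → 𝓙 → EuclideanSpace ℝ (Fin d)) (k : Fin K) (h : Fin H) :
    (∫⁻ ω, ENNReal.ofReal ((R.record ω).mixture ψ φ (R.sideNoise s ω) k h) ∂μ ≤ 1) ∧
    Measurable fun ω => ENNReal.ofReal ((R.record ω).mixture ψ φ (R.sideNoise s ω) k h) := by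
  set G : ENNReal := ∫⁻ x : Fin d × Fin d → ℝ, ENNReal.ofReal (Real.exp (-(x ⬝ᵥ x) / 2)) with hG
  obtain ⟨hG0, hGt⟩ := lintegral_gaussian_pos_lt_top (ι := Fin d × Fin d)
  set F : Ω → (Fin d × Fin d → ℝ) → ENNReal := fun ω x => ENNReal.ofReal (Real.exp
    (x ⬝ᵥ (R.record ω).noiseSum ψ φ (R.sideNoise s ω) k h
      - (x ⬝ᵥ (R.record ω).gram ψ φ 1 k h *ᵥ x) / 2)) with hF
  have hFm : Measurable (Function.uncurry F) := by
    refine ENNReal.measurable_ofReal.comp (Real.measurable_exp.comp ?_)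
    simp only [R.dotProduct_noiseSum_sub s ψ φ k h]
    refine Measurable.add ?_ (Finset.measurable_sum _ fun t _ => Finset.measurable_sum _
      fun p _ => ?_)
    · exact ((measurable_dotProduct measurable_snd measurable_snd).neg).div_const 2
    · have h1 := R.measurable_coef_prod hψ φ h t p
      have h2 : Measurable (R.noise t h s p.1 p.2) :=
        (R.measurable_noise t h s p.1 p.2).mono (R.ℱ.le _) le_rfl
      exact (h1.mul (h2.comp measurable_fst)).sub ((h1.pow_const 2).div_const 2)
  have hmix : ∀ ω, ∫⁻ x, F ω x
      = ENNReal.ofReal ((R.record ω).mixture ψ φ (R.sideNoise s ω) k h) * G := fun ω =>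
    lintegral_gaussian_quadForm ((R.record ω).gram_posDef ψ φ k h) _
  have hmix' : ∀ ω, ENNReal.ofReal ((R.record ω).mixture ψ φ (R.sideNoise s ω) k h)
      = (∫⁻ x, F ω x) / G := fun ω => by
    rw [hmix, ENNReal.mul_div_cancel_right hG0 hGt]
  have hm : Measurable fun ω => ∫⁻ x, F ω x := hFm.lintegral_prod_right
  simp_rw [hmix']
  refine ⟨?_, hm.div_const G⟩
  simp_rw [div_eq_mul_inv]
  rw [lintegral_mul_const _ hm, ← div_eq_mul_inv]
  refine ENNReal.div_le_of_le_mul ?_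
  rw [one_mul, lintegral_lintegral_swap hFm.aemeasurable]
  refine lintegral_mono fun x => ?_
  have hIio : (Finset.Iio k) = Finset.univ.filter fun t : Fin K => t.1 < k.1 := by
    ext t; simp
  have hx : ∀ ω, F ω x = ENNReal.ofReal (Real.exp (-(x ⬝ᵥ x) / 2)) * ENNReal.ofReal (Real.exp
      (∑ t : Fin K with t.1 < k.1, ∑ p : 𝓘 × 𝓙, (R.coef ψ φ h t p x ω * R.noise t h s p.1 p.2 ω
        - R.coef ψ φ h t p x ω ^ 2 / 2))) := fun ω => by
    rw [← ENNReal.ofReal_mul (Real.exp_pos _).le, ← Real.exp_add, ← hIio,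
      ← R.dotProduct_noiseSum_sub s ψ φ k h]
  simp_rw [hx]
  rw [lintegral_const_mul' _ _ ENNReal.ofReal_ne_top]
  exact mul_le_of_le_one_right' (R.lintegral_exp_noise_le_one s hψ φ h x k)

end Interaction

/-! ### Multiplicative concentration of bounded variables -/

section Concentration

variable {Ω : Type*} [mΩ : MeasurableSpace Ω] {μ : Measure Ω}

theorem exp_neg_le_one_sub_half {y : ℝ} (h0 : 0 ≤ y) (h1 : y ≤ 1) : Real.exp (-y) ≤ 1 - y / 2 := by
  rw [Real.exp_neg]
  have h2 : 0 < 1 - y / 2 := by linarith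
  rw [inv_le_comm₀ (Real.exp_pos _) h2, inv_le_iff_one_le_mul₀ h2]
  nlinarith [Real.add_one_le_exp y]

/-- The chain `E[Z exp (-y)] ≤ E[Z (1 - y / 2)] = E[Z (1 - w / 2)] ≤ E[Z exp (-w / 2)]`. In
`ENNReal` the subtractions are replaced by adding `E[Z w / 2]` to both ends, and finiteness of
`E[Z]` allows it to be cancelled. -/
theorem lintegral_mul_exp_neg_le {Z : Ω → ENNReal} (hZ : Measurable Z) (hfin : ∫⁻ ω, Z ω ∂μ ≠ ⊤)
    {y w : Ω → ℝ} (hym : Measurable y) (hwm : Measurable w) (hy0 : ∀ ω, 0 ≤ y ω)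
    (hy1 : ∀ ω, y ω ≤ 1) (hw0 : ∀ ω, 0 ≤ w ω) (hw1 : ∀ ω, w ω ≤ 1)
    (heq : ∫⁻ ω, Z ω * ENNReal.ofReal (y ω) ∂μ = ∫⁻ ω, Z ω * ENNReal.ofReal (w ω) ∂μ) :
    ∫⁻ ω, Z ω * ENNReal.ofReal (Real.exp (-y ω)) ∂μ ≤
      ∫⁻ ω, Z ω * ENNReal.ofReal (Real.exp (-(w ω / 2))) ∂μ := by
  have hhalf : ∀ f : Ω → ℝ, ∫⁻ ω, Z ω * ENNReal.ofReal (f ω / 2) ∂μ =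
      (∫⁻ ω, Z ω * ENNReal.ofReal (f ω) ∂μ) * ENNReal.ofReal (1 / 2) := fun f => by
    rw [← lintegral_mul_const' _ _ ENNReal.ofReal_ne_top]
    refine lintegral_congr fun ω => ?_
    rw [mul_assoc, ← ENNReal.ofReal_mul' (by norm_num), mul_one_div]
  have hle : ∫⁻ ω, Z ω * ENNReal.ofReal (w ω / 2) ∂μ ≤ ∫⁻ ω, Z ω ∂μ :=
    lintegral_mono fun ω => mul_le_of_le_one_right' (ENNReal.ofReal_le_one.2 (by linarith [hw1 ω]))
  have hne : ∫⁻ ω, Z ω * ENNReal.ofReal (w ω / 2) ∂μ ≠ ⊤ := ne_top_of_le_ne_top hfin hle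
  have key : ∫⁻ ω, Z ω * ENNReal.ofReal (Real.exp (-y ω)) ∂μ
        + ∫⁻ ω, Z ω * ENNReal.ofReal (w ω / 2) ∂μ ≤
      ∫⁻ ω, Z ω * ENNReal.ofReal (Real.exp (-(w ω / 2))) ∂μ
        + ∫⁻ ω, Z ω * ENNReal.ofReal (w ω / 2) ∂μ := by
    have hwm2 : Measurable fun ω => Z ω * ENNReal.ofReal (w ω / 2) :=
      hZ.mul (ENNReal.measurable_ofReal.comp (hwm.div_const 2))
    have hym2 : Measurable fun ω => Z ω * ENNReal.ofReal (y ω / 2) :=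
      hZ.mul (ENNReal.measurable_ofReal.comp (hym.div_const 2))
    calc _ = ∫⁻ ω, Z ω * ENNReal.ofReal (Real.exp (-y ω)) ∂μ
          + ∫⁻ ω, Z ω * ENNReal.ofReal (y ω / 2) ∂μ := by rw [hhalf, hhalf, heq]
      _ = ∫⁻ ω, (Z ω * ENNReal.ofReal (Real.exp (-y ω)) + Z ω * ENNReal.ofReal (y ω / 2)) ∂μ :=
          (lintegral_add_right _ hym2).symm
      _ ≤ ∫⁻ ω, Z ω ∂μ := by
          refine lintegral_mono fun ω => ?_
          rw [← mul_add, ← ENNReal.ofReal_add (Real.exp_pos _).le (by linarith [hy0 ω])]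
          refine mul_le_of_le_one_right' (ENNReal.ofReal_le_one.2 ?_)
          linarith [exp_neg_le_one_sub_half (hy0 ω) (hy1 ω)]
      _ ≤ ∫⁻ ω, (Z ω * ENNReal.ofReal (Real.exp (-(w ω / 2)))
            + Z ω * ENNReal.ofReal (w ω / 2)) ∂μ := by
          refine lintegral_mono fun ω => ?_
          rw [← mul_add, ← ENNReal.ofReal_add (Real.exp_pos _).le (by linarith [hw0 ω])]
          refine le_mul_of_one_le_right' (ENNReal.one_le_ofReal.2 ?_)
          linarith [Real.add_one_le_exp (-(w ω / 2))]
      _ = _ := lintegral_add_right _ hwm2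
  exact (ENNReal.add_le_add_iff_right hne).1 key

variable {K : ℕ} [IsProbabilityMeasure μ]

/-- A multiplicative concentration inequality: if `w t ∈ [0, 1]` is the conditional expectation of
`y t ∈ [0, 1]` given the past `m t`, then `∑ w t ≤ 2 ∑ y t + 2 log (1 / δ)` with probability at
least `1 - δ`. -/
theorem measure_log_le_sum_le (m : Fin K → MeasurableSpace Ω) (hm : ∀ t, m t ≤ mΩ)
    {y w : Fin K → Ω → ℝ} (hy : ∀ s t, s < t → Measurable[m t] (y s))
    (hym : ∀ t, Measurable (y t))
    (hw : ∀ s t, s ≤ t → Measurable[m t] (w s))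
    (hy0 : ∀ t ω, 0 ≤ y t ω) (hy1 : ∀ t ω, y t ω ≤ 1)
    (hw0 : ∀ t ω, 0 ≤ w t ω) (hw1 : ∀ t ω, w t ω ≤ 1)
    (heq : ∀ t (Z : Ω → ENNReal), Measurable[m t] Z →
      ∫⁻ ω, Z ω * ENNReal.ofReal (y t ω) ∂μ = ∫⁻ ω, Z ω * ENNReal.ofReal (w t ω) ∂μ)
    {δ : ℝ} (hδ : 0 < δ) :
    μ {ω | Real.log (1 / δ) ≤ ∑ t, (w t ω / 2 - y t ω)} ≤ ENNReal.ofReal δ := by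
  have hwm : ∀ t, Measurable (w t) := fun t => (hw t t le_rfl).mono (hm t) le_rfl
  have key : ∀ n : ℕ, ∫⁻ ω, ENNReal.ofReal (Real.exp
      (∑ t : Fin K with t.1 < n, (w t ω / 2 - y t ω))) ∂μ ≤ 1 := by
    intro n
    induction n with
    | zero => simp
    | succ n ih =>
      by_cases hn : n < K
      · set k : Fin K := ⟨n, hn⟩ with hk
        have hset : (Finset.univ.filter fun t : Fin K => t.1 < n + 1)
            = insert k (Finset.univ.filter fun t : Fin K => t.1 < n) := by
          ext t
          simp only [Finset.mem_filter, Finset.mem_univ, true_and, Finset.mem_insert, Fin.ext_iff,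
            hk]
          omega
        have hnot : k ∉ (Finset.univ.filter fun t : Fin K => t.1 < n) := by simp [hk]
        set A : Ω → ℝ := fun ω => ∑ t : Fin K with t.1 < n, (w t ω / 2 - y t ω) with hA
        -- The new factor `exp (w k / 2)` depends on the past and is put into the weight. Replacing
        -- `exp (-y k)` by `exp (-w k / 2)` cancels it.
        set Z : Ω → ENNReal := fun ω => ENNReal.ofReal (Real.exp (A ω + w k ω / 2)) with hZ
        have hAm : Measurable[m k] A := by
          refine @Finset.measurable_sum _ _ _ _ _ _ (m k) _ _ fun t ht => ?_
          have htk : t < k := (Finset.mem_filter.1 ht).2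
          exact ((hw t k htk.le).div_const 2).sub (hy t k htk)
        have hZm : Measurable[m k] Z :=
          ENNReal.measurable_ofReal.comp (Real.measurable_exp.comp
            (hAm.add ((hw k k le_rfl).div_const 2)))
        have hfin : ∫⁻ ω, Z ω ∂μ ≠ ⊤ := by
          refine ne_top_of_le_ne_top (b := 1 * ENNReal.ofReal (Real.exp 1)) (by simp) ?_
          calc ∫⁻ ω, Z ω ∂μ ≤ ∫⁻ ω, ENNReal.ofReal (Real.exp (A ω))
                * ENNReal.ofReal (Real.exp 1) ∂μ := by
                refine lintegral_mono fun ω => ?_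
                rw [← ENNReal.ofReal_mul (Real.exp_pos _).le, ← Real.exp_add]
                refine ENNReal.ofReal_le_ofReal (Real.exp_le_exp.2 ?_)
                linarith [hw1 k ω]
            _ ≤ _ := by
                rw [lintegral_mul_const' _ _ ENNReal.ofReal_ne_top]
                gcongr
        have h := lintegral_mul_exp_neg_le (hZm.mono (hm k) le_rfl) hfin (hym k) (hwm k) (hy0 k)
          (hy1 k) (hw0 k) (hw1 k) (heq k Z hZm)
        have e1 : ∀ ω, Z ω * ENNReal.ofReal (Real.exp (-y k ω)) = ENNReal.ofReal (Real.exp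
            (∑ t : Fin K with t.1 < n + 1, (w t ω / 2 - y t ω))) := fun ω => by
          rw [hZ, hset, Finset.sum_insert hnot, ← ENNReal.ofReal_mul (Real.exp_pos _).le,
            ← Real.exp_add]
          congr 2
          ring
        have e2 : ∀ ω, Z ω * ENNReal.ofReal (Real.exp (-(w k ω / 2)))
            = ENNReal.ofReal (Real.exp (A ω)) := fun ω => by
          rw [hZ, ← ENNReal.ofReal_mul (Real.exp_pos _).le, ← Real.exp_add]
          congr 2
          ring
        simp_rw [e1, e2] at h
        exact h.trans ih
      · refine le_trans (le_of_eq ?_) ih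
        refine lintegral_congr fun ω => ?_
        congr 3
        ext t
        have := t.2
        simp only [Finset.mem_filter, Finset.mem_univ, true_and]
        omega
  have hK := key K
  have hall : (Finset.univ.filter fun t : Fin K => t.1 < K) = Finset.univ := by
    ext t; simp
  rw [hall] at hK
  have hmeas : Measurable fun ω => ENNReal.ofReal (Real.exp (∑ t, (w t ω / 2 - y t ω))) :=
    ENNReal.measurable_ofReal.comp (Real.measurable_exp.comp (Finset.measurable_sum _ fun t _ =>
      ((hwm t).div_const 2).sub (hym t)))
  have hmk := mul_meas_ge_le_lintegral hmeas (μ := μ) (ENNReal.ofReal (1 / δ))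
  have hsub : {ω | Real.log (1 / δ) ≤ ∑ t, (w t ω / 2 - y t ω)} ⊆
      {ω | ENNReal.ofReal (1 / δ) ≤
        ENNReal.ofReal (Real.exp (∑ t, (w t ω / 2 - y t ω)))} := by
    intro ω hω
    refine ENNReal.ofReal_le_ofReal ?_
    rw [← Real.exp_log (show 0 < 1 / δ by positivity)]
    exact Real.exp_le_exp.2 hω
  calc μ _ ≤ μ _ := measure_mono hsub
    _ = ENNReal.ofReal δ * (ENNReal.ofReal (1 / δ) * μ _) := by
        rw [← mul_assoc, ← ENNReal.ofReal_mul hδ.le, mul_one_div_cancel hδ.ne', ENNReal.ofReal_one,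
          one_mul]
    _ ≤ ENNReal.ofReal δ * 1 := by gcongr; exact hmk.trans hK
    _ = _ := mul_one _

end Concentration

/-! ### From conditional probabilities to kernel integrals -/

section Disintegration

variable {Ω S 𝒞 : Type*} [MeasurableSpace Ω] [MeasurableSpace S] [MeasurableSpace 𝒞] {μ : Measure Ω}
  [IsFiniteMeasure μ]

/-- A finite measure on a product is determined by rectangles, so the joint law is the law of `f`
composed with `κ`. Taking for `S` the space `Ω` with a smaller σ-algebra gives integrands depending
on the whole past. -/
theorem lintegral_eq_lintegral_kernel {f : Ω → S} (hf : Measurable f) {Y : Ω → 𝒞}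
    (hY : Measurable Y) (κ : Kernel S 𝒞) [IsMarkovKernel κ]
    (h : ∀ B, MeasurableSet B → ∀ A, MeasurableSet A →
      μ (f ⁻¹' B ∩ Y ⁻¹' A) = ∫⁻ ω in f ⁻¹' B, κ (f ω) A ∂μ)
    {F : S × 𝒞 → ENNReal} (hF : Measurable F) :
    ∫⁻ ω, F (f ω, Y ω) ∂μ = ∫⁻ ω, ∫⁻ c, F (f ω, c) ∂(κ (f ω)) ∂μ := by
  have hmap : μ.map (fun ω => (f ω, Y ω)) = (μ.map f) ⊗ₘ κ := by
    refine Measure.ext_prod fun {B A} hB hA => ?_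
    rw [Measure.compProd_apply_prod hB hA, Measure.map_apply (hf.prodMk hY) (hB.prod hA),
      setLIntegral_map hB (κ.measurable_coe hA) hf, ← h B hB A hA]
    rfl
  rw [← lintegral_map (f := F) hF (hf.prodMk hY), hmap, Measure.lintegral_compProd hF,
    lintegral_map hF.lintegral_kernel_prod_right' hf]

end Disintegration

theorem measure_inter_eq_of_condExp {Ω 𝒞 : Type*} {m mΩ : MeasurableSpace Ω} [MeasurableSpace 𝒞]
    {μ : Measure Ω} [IsFiniteMeasure μ] (hm : m ≤ mΩ) {Y : Ω → 𝒞} (hY : Measurable Y)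
    {κ : Ω → Measure 𝒞} [∀ ω, IsFiniteMeasure (κ ω)] {A : Set 𝒞} (hA : MeasurableSet A)
    (h : μ[(Y ⁻¹' A).indicator (fun _ => (1 : ℝ)) | m] =ᵐ[μ] fun ω => (κ ω).real A)
    {B : Set Ω} (hB : MeasurableSet[m] B) :
    μ (B ∩ Y ⁻¹' A) = ∫⁻ ω in B, κ ω A ∂μ := by
  have hYA : MeasurableSet (Y ⁻¹' A) := hY hA
  have hint : Integrable ((Y ⁻¹' A).indicator (fun _ => (1 : ℝ))) μ :=
    (integrable_const 1).indicator hYA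
  have h1 := setIntegral_condExp hm hint hB
  rw [setIntegral_congr_ae (g := fun ω => (κ ω).real A) (hm B hB) (h.mono fun ω hω _ => hω),
    setIntegral_indicator hYA, setIntegral_const, smul_eq_mul, mul_one] at h1
  have hint2 : Integrable (fun ω => (κ ω).real A) μ := (integrable_congr h).1 integrable_condExp
  have h2 : ∫⁻ ω in B, κ ω A ∂μ = ∫⁻ ω in B, ENNReal.ofReal ((κ ω).real A) ∂μ :=
    lintegral_congr fun ω => (ofReal_measureReal).symm
  rw [h2, ← ofReal_integral_eq_lintegral_ofReal hint2.restrict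
    (ae_of_all _ fun ω => measureReal_nonneg), h1, ofReal_measureReal]

/-! ### The played contexts have the law of a fresh trajectory -/

section Trajectory

variable {𝒞 Υ 𝓘 𝓙 : Type*} [MeasurableSpace 𝒞] [MeasurableSpace Υ] {H K : ℕ}
  {M : Market 𝒞 Υ 𝓘 𝓙 H}

instance (π : Policy 𝒞 Υ 𝓘 𝓙 H) (c : 𝒞) : IsProbabilityMeasure (M.trajLaw π c) := by
  unfold Market.trajLaw
  infer_instance

theorem Market.lintegral_trajLaw_zero (M : Market 𝒞 Υ 𝓘 𝓙 H) (π : Policy 𝒞 Υ 𝓘 𝓙 H) (c : 𝒞)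
    {f : 𝒞 → ENNReal} (hf : Measurable f) : ∫⁻ x, f (x 0) ∂(M.trajLaw π c) = f c := by
  have h := Kernel.traj_map_frestrictLe_apply (X := fun _ => 𝒞) (κ := M.stepKernel π) 0 0
    (fun _ => c)
  have hg : Measurable fun y : Finset.Iic 0 → 𝒞 => f (y ⟨0, Finset.mem_Iic.2 le_rfl⟩) :=
    hf.comp (measurable_pi_apply _)
  have h1 := lintegral_map (μ := M.trajLaw π c) hg
    (Preorder.measurable_frestrictLe (X := fun _ : ℕ => 𝒞) 0)
  refine Eq.trans h1.symm ?_
  unfold Market.trajLaw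
  rw [h, Kernel.partialTraj_self, Kernel.id_apply, lintegral_dirac' _ hg]

/-- Markov property at step `n`: the law of the next context is the law of the past composed with
`stepKernel`, which reads only the last context. -/
theorem Market.lintegral_trajLaw_succ (M : Market 𝒞 Υ 𝓘 𝓙 H) (π : Policy 𝒞 Υ 𝓘 𝓙 H) (c : 𝒞)
    (n : Fin H) {f : 𝒞 → ENNReal} (hf : Measurable f) :
    ∫⁻ x, f (x (n + 1)) ∂(M.trajLaw π c) =
      ∫⁻ x, ∫⁻ c', f c' ∂(M.P n (x n, π.act n (x n))) ∂(M.trajLaw π c) := by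
  have hstep : ∀ y : Finset.Iic n.1 → 𝒞, M.stepKernel π n y
      = M.P n (y ⟨n, Finset.mem_Iic.2 le_rfl⟩, π.act n (y ⟨n, Finset.mem_Iic.2 le_rfl⟩)) := by
    intro y
    unfold Market.stepKernel
    rw [dif_pos n.2, Kernel.comap_apply]
  have hm1 : Measurable fun x : ℕ → 𝒞 => x (n + 1) := measurable_pi_apply _
  have hg : Measurable fun y : Finset.Iic n.1 → 𝒞 => ∫⁻ c', f c' ∂(M.stepKernel π n y) :=
    hf.lintegral_kernel
  have hlaw : (M.trajLaw π c).map (fun x => x (n + 1)) =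
      (M.stepKernel π n ∘ₖ Kernel.partialTraj (X := fun _ => 𝒞) (M.stepKernel π) 0 n)
        (fun _ => c) := by
    have hev : Measurable fun y : Finset.Iic (n.1 + 1) → 𝒞 =>
        y ⟨n.1 + 1, Finset.mem_Iic.2 le_rfl⟩ := measurable_pi_apply _
    have h1 : (M.trajLaw π c).map (fun x => x (n + 1)) =
        ((M.trajLaw π c).map (Preorder.frestrictLe (π := fun _ : ℕ => 𝒞) (n.1 + 1))).map
          (fun y => y ⟨n.1 + 1, Finset.mem_Iic.2 le_rfl⟩) :=
      (Measure.map_map hev (Preorder.measurable_frestrictLe (X := fun _ : ℕ => 𝒞) _)).symm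
    rw [h1]
    unfold Market.trajLaw
    rw [Kernel.traj_map_frestrictLe_apply, ← Kernel.map_apply _ hev,
      Kernel.partialTraj_succ_eq_comp (Nat.zero_le _), Kernel.map_comp,
      Kernel.map_partialTraj_succ_self]
  calc _ = ∫⁻ c', f c' ∂((M.trajLaw π c).map fun x => x (n + 1)) := (lintegral_map hf hm1).symm
    _ = ∫⁻ y, ∫⁻ c', f c' ∂(M.stepKernel π n y)
          ∂(Kernel.partialTraj (X := fun _ => 𝒞) (M.stepKernel π) 0 n (fun _ => c)) := by
        rw [hlaw, Kernel.lintegral_comp _ _ _ hf]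
    _ = ∫⁻ x, ∫⁻ c', f c' ∂(M.stepKernel π n (Preorder.frestrictLe (π := fun _ : ℕ => 𝒞) n.1 x))
          ∂(M.trajLaw π c) := by
        rw [← Kernel.traj_map_frestrictLe_apply]
        exact lintegral_map hg (Preorder.measurable_frestrictLe (X := fun _ : ℕ => 𝒞) _)
    _ = _ := by
        refine lintegral_congr fun x => ?_
        rw [hstep]
        rfl

variable {Ω : Type*} [mΩ : MeasurableSpace Ω] {μ : Measure Ω} [IsProbabilityMeasure μ]

theorem measurable_lintegral_step {T : Type*} [MeasurableSpace T] (P : Kernel (𝒞 × Υ) 𝒞)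
    [IsMarkovKernel P] {a : T × 𝒞 → Υ} (ha : Measurable a) {f : T × 𝒞 → ENNReal}
    (hf : Measurable f) : Measurable fun y : T × 𝒞 => ∫⁻ c', f (y.1, c') ∂(P (y.2, a y)) := by
  have hk : Measurable fun y : T × 𝒞 => (y.2, a y) := measurable_snd.prodMk ha
  have hf' : Measurable fun z : (T × 𝒞) × 𝒞 => f (z.1.1, z.2) :=
    hf.comp ((measurable_fst.comp measurable_fst).prodMk measurable_snd)
  exact hf'.lintegral_kernel_prod_right' (κ := P.comap _ hk)

/-- The next context, given the information at step `h`. -/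
theorem Interaction.lintegral_transition (R : Interaction M K μ) (k : Fin K) (h : Fin H)
    {F : Ω × 𝒞 → ENNReal}
    (hF : Measurable[(R.ℱ (k * (H + 1) + h)).prod ‹MeasurableSpace 𝒞›] F) :
    ∫⁻ ω, F (ω, R.ctx k h.succ ω) ∂μ = ∫⁻ ω, ∫⁻ c, F (ω, c)
      ∂(M.P h (R.ctx k h.castSucc ω, (R.pol k ω).act h (R.ctx k h.castSucc ω))) ∂μ := by
  have := M.markov h
  have hpair : @Measurable Ω (𝒞 × Υ) (R.ℱ (k * (H + 1) + h)) _
      fun ω => (R.ctx k h.castSucc ω, (R.pol k ω).act h (R.ctx k h.castSucc ω)) :=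
    (R.measurable_ctx k h.castSucc).prodMk (R.measurable_record_act k h)
  have hY : Measurable (R.ctx k h.succ) :=
    (R.measurable_ctx k h.succ).mono (R.ℱ.le _) le_rfl
  have hMk := Kernel.IsMarkovKernel.comap (M.P h) hpair
  refine @lintegral_eq_lintegral_kernel Ω Ω 𝒞 mΩ (R.ℱ (k * (H + 1) + h)) _ μ _ id
    (measurable_id'' (R.ℱ.le _)) _ hY _ hMk (fun B hB A hA => ?_) F hF
  exact measure_inter_eq_of_condExp (R.ℱ.le _) hY hA (R.transition k h A hA) hB

/-- The contexts of episode `k` follow, given the information at the start of the episode, the law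
of the trajectory of its policy. -/
theorem Interaction.lintegral_ctx (R : Interaction M K μ) (k : Fin K) (n : ℕ) (hn : n < H + 1)
    {f : Ω × 𝒞 → ENNReal}
    (hf : Measurable[(R.ℱ (k * (H + 1))).prod ‹MeasurableSpace 𝒞›] f) :
    Measurable[R.ℱ (k * (H + 1))]
        (fun ω => ∫⁻ x, f (ω, x n) ∂(M.trajLaw (R.pol k ω) (R.ctx k 0 ω))) ∧
      ∀ Z : Ω → ENNReal, Measurable[R.ℱ (k * (H + 1))] Z →
        ∫⁻ ω, Z ω * f (ω, R.ctx k ⟨n, hn⟩ ω) ∂μ = ∫⁻ ω, Z ω *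
          ∫⁻ x, f (ω, x n) ∂(M.trajLaw (R.pol k ω) (R.ctx k 0 ω)) ∂μ := by
  induction n generalizing f with
  | zero =>
    have hsec : ∀ ω, Measurable fun c => f (ω, c) := fun ω =>
      hf.comp (@measurable_prodMk_left _ _ (R.ℱ (k * (H + 1))) _ ω)
    have h0 : ∀ ω, ∫⁻ x, f (ω, x 0) ∂(M.trajLaw (R.pol k ω) (R.ctx k 0 ω))
        = f (ω, R.ctx k 0 ω) := fun ω => M.lintegral_trajLaw_zero _ _ (hsec ω)
    simp_rw [h0]
    refine ⟨?_, fun Z _ => rfl⟩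
    have hc : Measurable[R.ℱ (k * (H + 1))] (R.ctx k 0) := R.measurable_ctx k 0
    exact hf.comp ((@measurable_id _ (R.ℱ (k * (H + 1)))).prodMk hc)
  | succ n ih =>
    have hnH : n < H := by omega
    set h : Fin H := ⟨n, hnH⟩ with hh
    have := M.markov h
    have hsec : ∀ ω, Measurable fun c => f (ω, c) := fun ω =>
      hf.comp (@measurable_prodMk_left _ _ (R.ℱ (k * (H + 1))) _ ω)
    -- The last transition is integrated out: `f` at step `n + 1` becomes its one-step average `g`
    -- at step `n`. It is still measurable in the information at the start of the episode, so the
    -- induction hypothesis applies.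
    set g : Ω × 𝒞 → ENNReal := fun y =>
      ∫⁻ c', f (y.1, c') ∂(M.P h (y.2, (R.pol k y.1).act h y.2)) with hg
    have hgm : Measurable[(R.ℱ (k * (H + 1))).prod ‹MeasurableSpace 𝒞›] g :=
      @measurable_lintegral_step _ _ _ _ _ (R.ℱ (k * (H + 1))) (M.P h) _ _ (R.measurable_act k h)
        _ hf
    obtain ⟨ih1, ih2⟩ := ih (by omega) hgm
    have hs : ∀ ω, ∫⁻ x, f (ω, x (n + 1)) ∂(M.trajLaw (R.pol k ω) (R.ctx k 0 ω))
        = ∫⁻ x, g (ω, x n) ∂(M.trajLaw (R.pol k ω) (R.ctx k 0 ω)) := fun ω =>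
      M.lintegral_trajLaw_succ _ _ h (hsec ω)
    simp_rw [hs]
    refine ⟨ih1, fun Z hZ => ?_⟩
    rw [← ih2 Z hZ]
    have hle : R.ℱ (k * (H + 1)) ≤ R.ℱ (k * (H + 1) + h) := R.ℱ.mono (Nat.le_add_right _ _)
    have hidm : @Measurable (Ω × 𝒞) (Ω × 𝒞)
        ((R.ℱ (k * (H + 1) + h)).prod ‹MeasurableSpace 𝒞›)
        ((R.ℱ (k * (H + 1))).prod ‹MeasurableSpace 𝒞›) id :=
      measurable_id'' (sup_le_sup (MeasurableSpace.comap_mono hle) le_rfl)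
    have hF : Measurable[(R.ℱ (k * (H + 1) + h)).prod ‹MeasurableSpace 𝒞›]
        fun y : Ω × 𝒞 => Z y.1 * f y := by
      have h1 : Measurable[(R.ℱ (k * (H + 1))).prod ‹MeasurableSpace 𝒞›]
          fun y : Ω × 𝒞 => Z y.1 * f y :=
        (hZ.comp (@measurable_fst _ _ (R.ℱ (k * (H + 1))) _)).mul hf
      exact h1.comp hidm
    have ht := R.lintegral_transition k h hF
    refine Eq.trans ht (lintegral_congr fun ω => ?_)
    exact lintegral_const_mul (Z ω) (hsec ω)

end Trajectory

/-! ### Measurability of the confidence norms -/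

section MatrixMeasurability

variable {ι T : Type*} [Fintype ι] [DecidableEq ι] [MeasurableSpace T]

theorem measurable_det {A : T → Matrix ι ι ℝ} (hA : ∀ i j, Measurable fun t => A t i j) :
    Measurable fun t => (A t).det := by
  simp_rw [det_apply]
  exact Finset.measurable_sum _ fun σ _ =>
    (Finset.measurable_prod _ fun i _ => hA _ _).const_smul _

theorem measurable_matNorm_inv {A : T → Matrix ι ι ℝ} (hA : ∀ i j, Measurable fun t => A t i j)
    {x : T → ι → ℝ} (hx : Measurable x) : Measurable fun t => matNorm (A t)⁻¹ (x t) := by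
  have hx' : ∀ i, Measurable fun t => x t i := fun i => (measurable_pi_apply i).comp hx
  have hinv : ∀ i j, Measurable fun t => (A t)⁻¹ i j := by
    intro i j
    -- Cramer's rule expresses the entries of the inverse by determinants, which are polynomials in
    -- the entries.
    have he : ∀ t, (A t)⁻¹ i j = (A t).det⁻¹ * ((A t).updateRow j (Pi.single i 1)).det := fun t => by
      rw [inv_def, Matrix.smul_apply, adjugate_apply, Ring.inverse_eq_inv', smul_eq_mul]
    simp_rw [he]
    refine (measurable_det hA).inv.mul (measurable_det fun a b => ?_)
    simp only [updateRow_apply]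
    split_ifs
    · exact measurable_const
    · exact hA a b
  unfold matNorm
  refine Measurable.sqrt ?_
  simp only [dotProduct, mulVec]
  exact Finset.measurable_sum _ fun i _ => (hx' i).mul
    (Finset.measurable_sum _ fun j _ => (hinv i j).mul (hx' j))

end MatrixMeasurability

/-! ### Expected and realized exploration bonuses -/

section Bonus

variable {𝒞 Υ 𝓘 𝓙 : Type*} [MeasurableSpace 𝒞] [MeasurableSpace Υ] {H K d : ℕ}
  {M : Market 𝒞 Υ 𝓘 𝓙 H} {Ω : Type*} [mΩ : MeasurableSpace Ω] {μ : Measure Ω}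

/-- The truncated exploration bonus of the matching that the policy of episode `k` implements in
the context `c` at step `h`. -/
noncomputable def Interaction.bonus (R : Interaction M K μ)
    (ψ : 𝒞 → Υ → EuclideanSpace ℝ (Fin d)) (φ : 𝓘 → 𝓙 → EuclideanSpace ℝ (Fin d)) (β : ℝ)
    (k : Fin K) (h : Fin H) (ω : Ω) (c : 𝒞) : ℝ :=
  ∑ p ∈ (R.pol k ω).mat h c, min 1 (β * matNorm ((R.record ω).gram ψ φ 1 k h)⁻¹
    (feature ψ φ c ((R.pol k ω).act h c) p.1 p.2))

theorem Interaction.bonus_nonneg (R : Interaction M K μ)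
    (ψ : 𝒞 → Υ → EuclideanSpace ℝ (Fin d)) (φ : 𝓘 → 𝓙 → EuclideanSpace ℝ (Fin d)) {β : ℝ}
    (hβ : 0 ≤ β) (k : Fin K) (h : Fin H) (ω : Ω) (c : 𝒞) : 0 ≤ R.bonus ψ φ β k h ω c :=
  Finset.sum_nonneg fun _ _ => le_min zero_le_one (mul_nonneg hβ (matNorm_nonneg _ _))

theorem Interaction.bonus_le (R : Interaction M K μ)
    (ψ : 𝒞 → Υ → EuclideanSpace ℝ (Fin d)) (φ : 𝓘 → 𝓙 → EuclideanSpace ℝ (Fin d)) (β : ℝ)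
    (k : Fin K) (h : Fin H) (ω : Ω) (c : 𝒞) {m : ℕ} (hm : ((R.pol k ω).mat h c).card ≤ m) :
    R.bonus ψ φ β k h ω c ≤ m := by
  refine (Finset.sum_le_card_nsmul _ _ 1 fun _ _ => min_le_left _ _).trans ?_
  rw [nsmul_eq_mul, mul_one]
  exact_mod_cast hm

/-- The expected sum of the bonuses over a fresh trajectory of the policy of episode `k`. -/
noncomputable def Interaction.expectedBonus (R : Interaction M K μ)
    (ψ : 𝒞 → Υ → EuclideanSpace ℝ (Fin d)) (φ : 𝓘 → 𝓙 → EuclideanSpace ℝ (Fin d)) (β : ℝ)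
    (k : Fin K) (ω : Ω) : ℝ :=
  ∫ x, ∑ h : Fin H, R.bonus ψ φ β k h ω (x h) ∂(M.trajLaw (R.pol k ω) (R.ctx k 0 ω))

theorem Interaction.expectedBonus_nonneg (R : Interaction M K μ)
    (ψ : 𝒞 → Υ → EuclideanSpace ℝ (Fin d)) (φ : 𝓘 → 𝓙 → EuclideanSpace ℝ (Fin d)) {β : ℝ}
    (hβ : 0 ≤ β) (k : Fin K) (ω : Ω) : 0 ≤ R.expectedBonus ψ φ β k ω :=
  integral_nonneg fun _ => Finset.sum_nonneg fun _ _ => R.bonus_nonneg ψ φ hβ _ _ _ _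

variable [Fintype 𝓘] [Fintype 𝓙]

theorem measurable_sum_mem {T α : Type*} [MeasurableSpace T] [Fintype α] {X : T → Finset α}
    (hX : ∀ p, MeasurableSet {t | p ∈ X t}) {f : α → T → ℝ} (hf : ∀ p, Measurable (f p)) :
    Measurable fun t => ∑ p ∈ X t, f p t := by
  classical
  have h : (fun t => ∑ p ∈ X t, f p t) = fun t => ∑ p, if p ∈ X t then f p t else 0 := by
    funext t
    rw [Finset.sum_ite_mem, Finset.univ_inter]
  rw [h]
  exact Finset.measurable_sum _ fun p _ => Measurable.ite (hX p) (hf p) measurable_const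

/-- Only samples of earlier episodes enter, and these are known when episode `k` starts. -/
theorem Interaction.measurable_gram (R : Interaction M K μ)
    {ψ : 𝒞 → Υ → EuclideanSpace ℝ (Fin d)} (hψ : Measurable (Function.uncurry ψ))
    (φ : 𝓘 → 𝓙 → EuclideanSpace ℝ (Fin d)) (k : Fin K) (h : Fin H) (a b : Fin d × Fin d) :
    Measurable[R.ℱ (k * (H + 1))] fun ω => (R.record ω).gram ψ φ 1 k h a b := by
  have hg : (fun ω => (R.record ω).gram ψ φ 1 k h a b) = fun ω =>
      (1 : Matrix (Fin d × Fin d) (Fin d × Fin d) ℝ) a b + ∑ t ∈ Finset.Iio k,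
        ∑ p ∈ (R.record ω).mat t h,
          (R.record ω).feat ψ φ h t p a * (R.record ω).feat ψ φ h t p b := by
    funext ω
    rw [Record.gram, one_smul, Matrix.add_apply, Matrix.sum_apply]
    congr 1
    refine Finset.sum_congr rfl fun t _ => ?_
    rw [Matrix.sum_apply]
    rfl
  rw [hg]
  refine Measurable.const_add ?_ _
  refine @Finset.measurable_sum _ _ _ _ _ _ (R.ℱ (k * (H + 1))) _ _ fun t ht => ?_
  have hle : (t : ℕ) * (H + 1) + h ≤ k * (H + 1) := by
    have h1 : (t : ℕ) + 1 ≤ k := Finset.mem_Iio.1 ht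
    have h2 := Nat.mul_le_mul_right (H + 1) h1
    have := h.2
    nlinarith
  refine @measurable_sum_mem _ _ (R.ℱ (k * (H + 1))) _ _
    (fun p => R.ℱ.mono hle _ (R.measurableSet_mem_mat t h p)) _ fun p => ?_
  have hf : Measurable[R.ℱ (k * (H + 1))] fun ω => (R.record ω).feat ψ φ h t p :=
    (R.measurable_feat hψ φ t h p).mono (R.ℱ.mono hle) le_rfl
  exact ((measurable_pi_apply a).comp hf).mul ((measurable_pi_apply b).comp hf)

theorem Interaction.measurable_bonus (R : Interaction M K μ)
    {ψ : 𝒞 → Υ → EuclideanSpace ℝ (Fin d)} (hψ : Measurable (Function.uncurry ψ))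
    (φ : 𝓘 → 𝓙 → EuclideanSpace ℝ (Fin d)) (β : ℝ) (k : Fin K) (h : Fin H) :
    Measurable[(R.ℱ (k * (H + 1))).prod ‹MeasurableSpace 𝒞›]
      fun y : Ω × 𝒞 => R.bonus ψ φ β k h y.1 y.2 := by
  have hfst := @measurable_fst Ω 𝒞 (R.ℱ (k * (H + 1))) ‹MeasurableSpace 𝒞›
  have hsnd := @measurable_snd Ω 𝒞 (R.ℱ (k * (H + 1))) ‹MeasurableSpace 𝒞›
  refine @measurable_sum_mem _ _ ((R.ℱ (k * (H + 1))).prod ‹MeasurableSpace 𝒞›) _ _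
    (fun p => R.measurable_mat k h p) _ fun p => ?_
  refine Measurable.min measurable_const (Measurable.const_mul ?_ β)
  exact @measurable_matNorm_inv _ _ _ _ ((R.ℱ (k * (H + 1))).prod ‹MeasurableSpace 𝒞›) _
    (fun a b => (R.measurable_gram hψ φ k h a b).comp hfst) _
    (@measurable_feature _ _ _ _ _ _ _ _ ((R.ℱ (k * (H + 1))).prod ‹MeasurableSpace 𝒞›) ψ hψ φ _ _
      hsnd (R.measurable_act k h) p.1 p.2)

theorem measurable_section {T α β : Type*} {m : MeasurableSpace T} [MeasurableSpace α]
    [MeasurableSpace β] {F : T × α → β} (hF : Measurable F) (ω : T) :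
    Measurable fun c => F (ω, c) := hF.comp measurable_prodMk_left

theorem measurable_graph {T α β : Type*} {m m' : MeasurableSpace T} [MeasurableSpace α]
    [MeasurableSpace β] {F : T × α → β} (hF : Measurable[m.prod ‹MeasurableSpace α›] F) {c : T → α}
    (hc : @Measurable T (T × α) m' (m.prod ‹MeasurableSpace α›) fun ω => (ω, c ω)) :
    Measurable[m'] fun ω => F (ω, c ω) := hF.comp hc

theorem Interaction.measurable_bonus_section (R : Interaction M K μ)
    {ψ : 𝒞 → Υ → EuclideanSpace ℝ (Fin d)} (hψ : Measurable (Function.uncurry ψ))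
    (φ : 𝓘 → 𝓙 → EuclideanSpace ℝ (Fin d)) (β : ℝ) (k : Fin K) (h : Fin H) (ω : Ω) :
    Measurable fun c => R.bonus ψ φ β k h ω c :=
  measurable_section (F := fun y : Ω × 𝒞 => R.bonus ψ φ β k h y.1 y.2)
    (R.measurable_bonus hψ φ β k h) ω

theorem Interaction.measurable_bonus_ctx (R : Interaction M K μ)
    {ψ : 𝒞 → Υ → EuclideanSpace ℝ (Fin d)} (hψ : Measurable (Function.uncurry ψ))
    (φ : 𝓘 → 𝓙 → EuclideanSpace ℝ (Fin d)) (β : ℝ) (k : Fin K) (h : Fin H) :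
    Measurable[R.ℱ (k * (H + 1) + h)] fun ω => R.bonus ψ φ β k h ω (R.ctx k h.castSucc ω) :=
  measurable_graph (F := fun y : Ω × 𝒞 => R.bonus ψ φ β k h y.1 y.2)
    (R.measurable_bonus hψ φ β k h) (R.measurable_pair k h)

theorem Interaction.integrable_bonus (R : Interaction M K μ)
    {ψ : 𝒞 → Υ → EuclideanSpace ℝ (Fin d)} (hψ : Measurable (Function.uncurry ψ))
    (φ : 𝓘 → 𝓙 → EuclideanSpace ℝ (Fin d)) {β : ℝ} (hβ : 0 ≤ β) {m : Fin H → ℕ}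
    (hm : ∀ k ω h c, ((R.pol k ω).mat h c).card ≤ m h) (k : Fin K) (h : Fin H) (ω : Ω) :
    Integrable (fun x : ℕ → 𝒞 => R.bonus ψ φ β k h ω (x h))
      (M.trajLaw (R.pol k ω) (R.ctx k 0 ω)) := by
  have hsec := R.measurable_bonus_section hψ φ β k h ω
  have hev : Measurable fun x : ℕ → 𝒞 => x h := measurable_pi_apply _
  refine Integrable.of_bound (hsec.comp hev).aestronglyMeasurable (m h)
    (ae_of_all _ fun x => ?_)
  rw [Real.norm_eq_abs, abs_of_nonneg (R.bonus_nonneg ψ φ hβ _ _ _ _)]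
  exact R.bonus_le ψ φ β k h ω _ (hm k ω h _)

theorem Interaction.ofReal_expectedBonus (R : Interaction M K μ)
    {ψ : 𝒞 → Υ → EuclideanSpace ℝ (Fin d)} (hψ : Measurable (Function.uncurry ψ))
    (φ : 𝓘 → 𝓙 → EuclideanSpace ℝ (Fin d)) {β : ℝ} (hβ : 0 ≤ β) {m : Fin H → ℕ}
    (hm : ∀ k ω h c, ((R.pol k ω).mat h c).card ≤ m h) (k : Fin K) (ω : Ω) :
    ENNReal.ofReal (R.expectedBonus ψ φ β k ω) = ∑ h : Fin H, ∫⁻ x,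
      ENNReal.ofReal (R.bonus ψ φ β k h ω (x h)) ∂(M.trajLaw (R.pol k ω) (R.ctx k 0 ω)) := by
  rw [Interaction.expectedBonus,
    integral_finsetSum _ fun h _ => R.integrable_bonus hψ φ hβ hm k h ω,
    ENNReal.ofReal_sum_of_nonneg fun h _ =>
      integral_nonneg fun x => R.bonus_nonneg ψ φ hβ _ _ _ _]
  exact Finset.sum_congr rfl fun h _ => ofReal_integral_eq_lintegral_ofReal
    (R.integrable_bonus hψ φ hβ hm k h ω) (ae_of_all _ fun x => R.bonus_nonneg ψ φ hβ _ _ _ _)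

variable [IsProbabilityMeasure μ]

/-- With probability at least `1 - δ`, the sum of the expected bonuses is bounded by the sum of the
bonuses along the trajectories of the interaction. -/
theorem Interaction.measure_expectedBonus_le (R : Interaction M K μ)
    {ψ : 𝒞 → Υ → EuclideanSpace ℝ (Fin d)} (hψ : Measurable (Function.uncurry ψ))
    (φ : 𝓘 → 𝓙 → EuclideanSpace ℝ (Fin d)) {β : ℝ} (hβ : 0 ≤ β) {m : Fin H → ℕ}
    (hm : ∀ k ω h c, ((R.pol k ω).mat h c).card ≤ m h) (hpos : 0 < ∑ h, (m h : ℝ))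
    {δ : ℝ} (hδ : 0 < δ) :
    μ {ω | 2 * (∑ k, ∑ h : Fin H, R.bonus ψ φ β k h ω (R.ctx k h.castSucc ω))
        + 2 * (∑ h, (m h : ℝ)) * Real.log (1 / δ) ≤ ∑ k, R.expectedBonus ψ φ β k ω} ≤
      ENNReal.ofReal δ := by
  set S : ℝ := ∑ h, (m h : ℝ) with hS
  set Y : Fin K → Ω → ℝ := fun k ω => ∑ h : Fin H, R.bonus ψ φ β k h ω (R.ctx k h.castSucc ω)
    with hYdef
  set G : Fin K → Ω → ℝ := fun k ω => R.expectedBonus ψ φ β k ω with hGdef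
  have hf : ∀ (k : Fin K) (h : Fin H), Measurable[(R.ℱ (k * (H + 1))).prod ‹MeasurableSpace 𝒞›]
      fun y : Ω × 𝒞 => ENNReal.ofReal (R.bonus ψ φ β k h y.1 y.2) := fun k h =>
    ENNReal.measurable_ofReal.comp (R.measurable_bonus hψ φ β k h)
  have hG0 : ∀ k ω, 0 ≤ G k ω := fun k ω => R.expectedBonus_nonneg ψ φ hβ k ω
  have hY0 : ∀ k ω, 0 ≤ Y k ω := fun k ω =>
    Finset.sum_nonneg fun h _ => R.bonus_nonneg ψ φ hβ _ _ _ _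
  have hYS : ∀ k ω, Y k ω ≤ S := fun k ω =>
    Finset.sum_le_sum fun h _ => R.bonus_le ψ φ β k h ω _ (hm k ω h _)
  have hGS : ∀ k ω, G k ω ≤ S := fun k ω => by
    have h1 := integral_mono (μ := M.trajLaw (R.pol k ω) (R.ctx k 0 ω))
      (integrable_finsetSum _ fun h _ => R.integrable_bonus hψ φ hβ hm k h ω)
      (integrable_const S)
      (fun x => Finset.sum_le_sum fun h _ => R.bonus_le ψ φ β k h ω _ (hm k ω h _))
    rw [integral_const, probReal_univ, one_smul] at h1
    exact h1
  have hGm : ∀ k : Fin K, Measurable[R.ℱ (k * (H + 1))] (G k) := fun k => by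
    have h1 : Measurable[R.ℱ (k * (H + 1))] fun ω => ENNReal.ofReal (G k ω) := by
      simp only [hGdef, R.ofReal_expectedBonus hψ φ hβ hm]
      exact @Finset.measurable_sum _ _ _ _ _ _ (R.ℱ (k * (H + 1))) _ _ fun h _ =>
        (R.lintegral_ctx k h (by omega) (hf k h)).1
    have h2 : G k = fun ω => (ENNReal.ofReal (G k ω)).toReal := by
      funext ω
      rw [ENNReal.toReal_ofReal (hG0 k ω)]
    rw [h2]
    exact ENNReal.measurable_toReal.comp h1
  have hYm : ∀ s t : Fin K, s < t → Measurable[R.ℱ (t * (H + 1))] (Y s) := fun s t hst => by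
    refine @Finset.measurable_sum _ _ _ _ _ _ (R.ℱ (t * (H + 1))) _ _ fun h _ => ?_
    have h1 : Measurable[R.ℱ (s * (H + 1) + h)]
        fun ω => R.bonus ψ φ β s h ω (R.ctx s h.castSucc ω) :=
      R.measurable_bonus_ctx hψ φ β s h
    refine h1.mono (R.ℱ.mono ?_) le_rfl
    have h1 : (s : ℕ) + 1 ≤ t := hst
    have h2 := Nat.mul_le_mul_right (H + 1) h1
    have := h.2
    nlinarith
  have hYmΩ : ∀ t, Measurable (Y t) := fun t => Finset.measurable_sum _ fun h _ =>
    (R.measurable_bonus_ctx hψ φ β t h).mono (R.ℱ.le _) le_rfl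
  -- The expected bonus is the conditional expectation of the realized one at the start of the
  -- episode, tested against nonnegative weights. Division by `S`, a bound for the bonus of one
  -- episode, brings both into `[0, 1]`.
  have heq : ∀ (t : Fin K) (Z : Ω → ENNReal), Measurable[R.ℱ (t * (H + 1))] Z →
      ∫⁻ ω, Z ω * ENNReal.ofReal (Y t ω / S) ∂μ = ∫⁻ ω, Z ω * ENNReal.ofReal (G t ω / S) ∂μ := by
    intro t Z hZ
    have hZm : Measurable Z := hZ.mono (R.ℱ.le _) le_rfl
    have hdiv : ∀ f : Ω → ℝ, (∀ ω, 0 ≤ f ω) → ∫⁻ ω, Z ω * ENNReal.ofReal (f ω / S) ∂μ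
        = (∫⁻ ω, Z ω * ENNReal.ofReal (f ω) ∂μ) * ENNReal.ofReal (1 / S) := fun f hf0 => by
      rw [← lintegral_mul_const' _ _ ENNReal.ofReal_ne_top]
      refine lintegral_congr fun ω => ?_
      rw [mul_assoc, ← ENNReal.ofReal_mul (hf0 ω), mul_one_div]
    rw [hdiv _ (hY0 t), hdiv _ (hG0 t)]
    congr 1
    have e1 : ∀ ω, Z ω * ENNReal.ofReal (Y t ω) = ∑ h : Fin H,
        Z ω * ENNReal.ofReal (R.bonus ψ φ β t h ω (R.ctx t h.castSucc ω)) := fun ω => by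
      rw [hYdef, ENNReal.ofReal_sum_of_nonneg fun h _ => R.bonus_nonneg ψ φ hβ _ _ _ _,
        Finset.mul_sum]
    have e2 : ∀ ω, Z ω * ENNReal.ofReal (G t ω) = ∑ h : Fin H, Z ω * ∫⁻ x, ENNReal.ofReal
        (R.bonus ψ φ β t h ω (x h)) ∂(M.trajLaw (R.pol t ω) (R.ctx t 0 ω)) := fun ω => by
      rw [hGdef]
      simp only
      rw [R.ofReal_expectedBonus hψ φ hβ hm, Finset.mul_sum]
    simp_rw [e1, e2]
    rw [lintegral_finsetSum, lintegral_finsetSum]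
    · exact Finset.sum_congr rfl fun h _ =>
        (R.lintegral_ctx t h (by omega) (hf t h)).2 Z hZ
    · exact fun h _ => hZm.mul (((R.lintegral_ctx t h (by omega) (hf t h)).1).mono (R.ℱ.le _) le_rfl)
    · exact fun h _ => hZm.mul (ENNReal.measurable_ofReal.comp
        ((R.measurable_bonus_ctx hψ φ β t h).mono (R.ℱ.le _) le_rfl))
  have key := measure_log_le_sum_le (μ := μ) (fun t : Fin K => R.ℱ (t * (H + 1)))
    (fun t => R.ℱ.le _) (y := fun t ω => Y t ω / S) (w := fun t ω => G t ω / S)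
    (fun s t hst => (hYm s t hst).div_const S) (fun t => (hYmΩ t).div_const S)
    (fun s t hst => ((hGm s).mono (R.ℱ.mono (Nat.mul_le_mul_right _ hst)) le_rfl).div_const S)
    (fun t ω => div_nonneg (hY0 t ω) hpos.le) (fun t ω => (div_le_one hpos).2 (hYS t ω))
    (fun t ω => div_nonneg (hG0 t ω) hpos.le) (fun t ω => (div_le_one hpos).2 (hGS t ω)) heq hδ
  refine (measure_mono fun ω hω => ?_).trans key
  simp only [Set.mem_ofPred_eq] at hω ⊢
  have hsum : ∑ t, (G t ω / S / 2 - Y t ω / S) = (∑ t, G t ω - 2 * ∑ t, Y t ω) / (2 * S) := by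
    rw [Finset.sum_sub_distrib, ← Finset.sum_div, ← Finset.sum_div, ← Finset.sum_div]
    field_simp
  rw [hsum, le_div_iff₀ (by positivity)]
  linarith

end Bonus

/-! ### Decomposition of the agents' regret -/

section Regret

variable {𝒞 Υ 𝓘 𝓙 : Type*} [MeasurableSpace 𝒞] [MeasurableSpace Υ]
  {H K d : ℕ} {M : Market 𝒞 Υ 𝓘 𝓙 H} {Ω : Type*} [mΩ : MeasurableSpace Ω] {μ : Measure Ω}
  {ψ : 𝒞 → Υ → EuclideanSpace ℝ (Fin d)} {φ : 𝓘 → 𝓙 → EuclideanSpace ℝ (Fin d)}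
  {θ γ : Fin H → EuclideanSpace ℝ (Fin d × Fin d)}
  {ν : Fin H → VectorMeasure 𝒞 (EuclideanSpace ℝ (Fin d))} {W : Fin H → ℝ}

/-- `min {|Iₕ|, |Jₕ|}`. -/
def Market.size (M : Market 𝒞 Υ 𝓘 𝓙 H) (h : Fin H) : ℕ := min (M.I h).card (M.J h).card

theorem Market.size_le_maxSize (M : Market 𝒞 Υ 𝓘 𝓙 H) (h : Fin H) : M.size h ≤ M.maxSize :=
  Finset.le_sup (f := fun h => min (M.I h).card (M.J h).card) (Finset.mem_univ h)

/-- The factor in the bound of the failure of optimism by the likelihood ratio. -/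
noncomputable def tailFactor (d K m : ℕ) (b : ℝ) : ℝ :=
  Real.exp (-(b ^ 2) / 2) * √((1 + (K : ℝ) * m) ^ (d ^ 2 - 1))

theorem tailFactor_nonneg (d K m : ℕ) (b : ℝ) : 0 ≤ tailFactor d K m b := by
  unfold tailFactor; positivity

/-- The sum of the likelihood ratios of the two sides. -/
noncomputable def Interaction.mixtures (R : Interaction M K μ)
    (ψ : 𝒞 → Υ → EuclideanSpace ℝ (Fin d)) (φ : 𝓘 → 𝓙 → EuclideanSpace ℝ (Fin d))
    (k : Fin K) (h : Fin H) (ω : Ω) : ℝ :=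
  (R.record ω).mixture ψ φ (R.sideNoise Side.buyer ω) k h
    + (R.record ω).mixture ψ φ (R.sideNoise Side.seller ω) k h

theorem Interaction.mixtures_nonneg (R : Interaction M K μ)
    (ψ : 𝒞 → Υ → EuclideanSpace ℝ (Fin d)) (φ : 𝓘 → 𝓙 → EuclideanSpace ℝ (Fin d))
    (k : Fin K) (h : Fin H) (ω : Ω) : 0 ≤ R.mixtures ψ φ k h ω :=
  add_nonneg (Record.mixture_nonneg _ _ _ _ _ _) (Record.mixture_nonneg _ _ _ _ _ _)

theorem Interaction.card_mat_le {R : Interaction M K μ} {βu βV : ℝ}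
    (hR : R.FollowsSOM ψ φ W 1 βu βV) (k : Fin K) (ω : Ω) (h : Fin H) (c : 𝒞) :
    ((R.pol k ω).mat h c).card ≤ M.size h :=
  ((hR k ω h c).2.1).card_le

/-- The errors of the optimistic utility estimates of one side. -/
theorem Interaction.ucb_error (hM : M.IsLinear ψ φ θ γ ν W) {R : Interaction M K μ} {b βV : ℝ}
    (hb : 0 ≤ b) (hR : R.FollowsSOM ψ φ W 1 (b + d) βV) (s : Side) (k : Fin K) (hk : (k : ℕ) ≠ 0)
    (h : Fin H) (ω : Ω) {ϑ : EuclideanSpace ℝ (Fin d × Fin d)} (hϑ : ‖ϑ‖ ≤ d)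
    {y : Fin K → Fin H → 𝓘 → 𝓙 → ℝ}
    (hy : ∀ t i j, y t h i j = (R.record ω).feat ψ φ h t (i, j) ⬝ᵥ ϑ.ofLp + R.noise t h s i j ω)
    (c : 𝒞) (e : Υ) (i : 𝓘) (j : 𝓙) (hu : |feature ψ φ c e i j ⬝ᵥ ϑ.ofLp| ≤ 1) :
    feature ψ φ c e i j ⬝ᵥ ϑ.ofLp - (R.record ω).ucb ψ φ 1 (b + d) y k h c e i j ≤
        tailFactor d K M.maxSize b * (R.record ω).mixture ψ φ (R.sideNoise s ω) k h ∧
      (R.record ω).ucb ψ φ 1 (b + d) y k h c e i j - feature ψ φ c e i j ⬝ᵥ ϑ.ofLp ≤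
        2 * min 1 ((b + d) * matNorm ((R.record ω).gram ψ φ 1 k h)⁻¹ (feature ψ φ c e i j))
        + tailFactor d K M.maxSize b * (R.record ω).mixture ψ φ (R.sideNoise s ω) k h := by
  have hz := (R.record ω).abs_ridge_sub_le ψ φ y (R.sideNoise s ω) k h ϑ hϑ hy
    (feature ψ φ c e i j)
  have hex := Record.excess_le (D := R.record ω) hM.ψ_le hM.φ_le (m := M.maxSize) (h := h)
    (fun t => (Interaction.card_mat_le hR t ω h _).trans (M.size_le_maxSize h))
    (R.sideNoise s ω) k hb (feature_dotProduct_self_le hM.ψ_le hM.φ_le c e i j)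
  unfold Record.ucb
  rw [if_neg hk]
  exact ⟨(sub_clip_le hu (matNorm_nonneg _ _) hz).trans hex,
    (clip_sub_le hu (matNorm_nonneg _ _) hz hb (Nat.cast_nonneg d)).trans (add_le_add le_rfl hex)⟩

/-- The two sides contribute the width twice each, hence `4 * bonus`. The excess occurs once on the
implemented pairs and once on a competing matching, each with at most `M.size h` pairs, hence `2 *
M.size h`. In the first episode the estimates are identically `1`, so each side is overestimated by
at most `2` per pair and never underestimated. -/
theorem Interaction.stepSI_le (hM : M.IsLinear ψ φ θ γ ν W) {R : Interaction M K μ} {b βV : ℝ}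
    (hb : 0 ≤ b) (hR : R.FollowsSOM ψ φ W 1 (b + d) βV) (k : Fin K) (h : Fin H) (ω : Ω) (c : 𝒞) :
    M.stepSI (R.pol k ω) h c ≤ 4 * R.bonus ψ φ (b + d) k h ω c
      + (2 * M.size h * (tailFactor d K M.maxSize b * R.mixtures ψ φ k h ω)
        + if (k : ℕ) = 0 then 4 * (M.size h : ℝ) else 0) := by
  have hopt := (hR k ω h c).2
  have hcard : (((R.pol k ω).mat h c).card : ℝ) ≤ M.size h := by
    exact_mod_cast Interaction.card_mat_le hR k ω h c
  have hβ : 0 ≤ b + d := by positivity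
  have hbon := R.bonus_nonneg ψ φ hβ k h ω c
  have htail := tailFactor_nonneg d K M.maxSize b
  set e := (R.pol k ω).act h c with he
  set T := tailFactor d K M.maxSize b * R.mixtures ψ φ k h ω with hT
  have hT0 : 0 ≤ T := mul_nonneg htail (R.mixtures_nonneg ψ φ k h ω)
  by_cases hk : (k : ℕ) = 0
  · rw [if_pos hk]
    have h1 := subsetInstability_le (u := M.u h c e) (v := M.v h c e) (f := fun _ _ => 2)
      (g := fun _ _ => 2) (a := 0) hopt le_rfl
      (fun i j => by
        simp only [Record.ucb, if_pos hk]
        linarith [(abs_le.1 (hM.u_le h c e i j)).2, (abs_le.1 (hM.v_le h c e i j)).2])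
      (fun i j => by
        simp only [Record.ucb, if_pos hk]
        linarith [(abs_le.1 (hM.u_le h c e i j)).1]) (fun _ _ => zero_le_two)
      (fun i j => by
        simp only [Record.ucb, if_pos hk]
        linarith [(abs_le.1 (hM.v_le h c e i j)).1]) (fun _ _ => zero_le_two)
    refine h1.trans ?_
    rw [Finset.sum_const, nsmul_eq_mul, mul_zero, add_zero]
    have : 0 ≤ 2 * (M.size h : ℝ) * T := by positivity
    linarith
  · rw [if_neg hk, add_zero]
    set Tu := tailFactor d K M.maxSize b
      * (R.record ω).mixture ψ φ (R.sideNoise Side.buyer ω) k h with hTu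
    set Tv := tailFactor d K M.maxSize b
      * (R.record ω).mixture ψ φ (R.sideNoise Side.seller ω) k h with hTv
    have hTuv : T = Tu + Tv := by rw [hT, Interaction.mixtures, mul_add]
    have hTu0 : 0 ≤ Tu := mul_nonneg htail (Record.mixture_nonneg _ _ _ _ _ _)
    have hTv0 : 0 ≤ Tv := mul_nonneg htail (Record.mixture_nonneg _ _ _ _ _ _)
    have hu := fun i j => Interaction.ucb_error hM hb hR Side.buyer k hk h ω (hM.θ_le h)
      (y := (R.record ω).obsU)
      (fun t i j => congrArg (· + R.noise t h Side.buyer i j ω) (hM.u_eq h _ _ i j)) c e i j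
      (hM.u_eq h c e i j ▸ hM.u_le h c e i j)
    have hv := fun i j => Interaction.ucb_error hM hb hR Side.seller k hk h ω (hM.γ_le h)
      (y := (R.record ω).obsV)
      (fun t i j => congrArg (· + R.noise t h Side.seller i j ω) (hM.v_eq h _ _ i j)) c e i j
      (hM.v_eq h c e i j ▸ hM.v_le h c e i j)
    simp only [← hM.u_eq] at hu
    simp only [← hM.v_eq] at hv
    set B : 𝓘 → 𝓙 → ℝ := fun i j => min 1 ((b + d) *
      matNorm ((R.record ω).gram ψ φ 1 k h)⁻¹ (feature ψ φ c e i j)) with hB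
    have hB0 : ∀ i j, 0 ≤ B i j := fun i j =>
      le_min zero_le_one (mul_nonneg hβ (matNorm_nonneg _ _))
    have h1 := subsetInstability_le (u := M.u h c e) (v := M.v h c e)
      (f := fun i j => 2 * B i j + Tu) (g := fun i j => 2 * B i j + Tv) (a := Tu + Tv) hopt
      (by positivity)
      (fun i j => by linarith [(hu i j).1, (hv i j).1])
      (fun i j => (hu i j).2) (fun i j => by linarith [hB0 i j])
      (fun i j => (hv i j).2) (fun i j => by linarith [hB0 i j])
    refine h1.trans ?_
    have hsum : ∑ p ∈ (R.pol k ω).mat h c, (2 * B p.1 p.2 + Tu + (2 * B p.1 p.2 + Tv))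
        = 4 * R.bonus ψ φ (b + d) k h ω c + ((R.pol k ω).mat h c).card * T := by
      rw [Interaction.bonus, Finset.mul_sum, ← nsmul_eq_mul, ← Finset.sum_const,
        ← Finset.sum_add_distrib]
      refine Finset.sum_congr rfl fun p _ => ?_
      rw [hTuv]
      ring
    rw [hsum, ← hTuv]
    have h2 := mul_le_mul_of_nonneg_right hcard hT0
    change _ + (M.size h : ℝ) * T ≤ _
    linarith

variable [Fintype 𝓘] [Fintype 𝓙]

theorem Interaction.agentsRegret_le (hM : M.IsLinear ψ φ θ γ ν W) {R : Interaction M K μ}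
    {b βV : ℝ} (hb : 0 ≤ b) (hR : R.FollowsSOM ψ φ W 1 (b + d) βV) (ω : Ω) :
    R.agentsRegret ω ≤ 4 * ∑ k, R.expectedBonus ψ φ (b + d) k ω
      + 2 * tailFactor d K M.maxSize b
        * (∑ k, ∑ h, (M.size h : ℝ) * R.mixtures ψ φ k h ω)
      + 4 * ∑ h, (M.size h : ℝ) := by
  have hβ : 0 ≤ b + d := by positivity
  set S : ℝ := ∑ h, (M.size h : ℝ) with hS
  have hS0 : 0 ≤ S := Finset.sum_nonneg fun _ _ => Nat.cast_nonneg _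
  have hep : ∀ k, M.expectedSI (R.pol k ω) (R.ctx k 0 ω) ≤
      4 * R.expectedBonus ψ φ (b + d) k ω + (2 * tailFactor d K M.maxSize b
        * (∑ h, (M.size h : ℝ) * R.mixtures ψ φ k h ω) + if (k : ℕ) = 0 then 4 * S else 0) := by
    intro k
    have hI := fun h => R.integrable_bonus hM.measurable_ψ φ hβ (Interaction.card_mat_le hR) k h ω
    set q : Fin H → ℝ := fun h => 2 * M.size h
      * (tailFactor d K M.maxSize b * R.mixtures ψ φ k h ω)
        + if (k : ℕ) = 0 then 4 * (M.size h : ℝ) else 0 with hq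
    have hIs : Integrable (fun x : ℕ → 𝒞 => ∑ h : Fin H, R.bonus ψ φ (b + d) k h ω (x h))
        (M.trajLaw (R.pol k ω) (R.ctx k 0 ω)) := integrable_finsetSum _ fun h _ => hI h
    have h1 : M.expectedSI (R.pol k ω) (R.ctx k 0 ω) ≤
        ∫ x, (4 * (∑ h : Fin H, R.bonus ψ φ (b + d) k h ω (x h)) + ∑ h, q h)
          ∂(M.trajLaw (R.pol k ω) (R.ctx k 0 ω)) := by
      -- Since the instability is nonnegative, only the upper bound has to be shown integrable.
      refine integral_mono_of_nonneg (ae_of_all _ fun x => ?_)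
        ((hIs.const_mul 4).add (integrable_const _)) (ae_of_all _ fun x => ?_)
      · exact Finset.sum_nonneg fun h _ => subsetInstability_nonneg _ _ _ _ _ _
      · simp only
        rw [Finset.mul_sum, ← Finset.sum_add_distrib]
        exact Finset.sum_le_sum fun h _ => Interaction.stepSI_le hM hb hR k h ω _
    rw [integral_add (hIs.const_mul 4) (integrable_const _), integral_const_mul, integral_const,
      probReal_univ, one_smul] at h1
    refine h1.trans (le_of_eq ?_)
    rw [← Interaction.expectedBonus, hq, Finset.sum_add_distrib]
    congr 2
    · rw [Finset.mul_sum]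
      exact Finset.sum_congr rfl fun h _ => by ring
    · split_ifs
      · rw [← Finset.mul_sum]
      · exact Finset.sum_const_zero
  have hfirst : ∑ k : Fin K, (if (k : ℕ) = 0 then 4 * S else 0) ≤ 4 * S := by
    rw [Fin.sum_univ_eq_sum_range (fun n => if n = 0 then 4 * S else 0), Finset.sum_ite_eq']
    split_ifs
    · exact le_rfl
    · positivity
  calc R.agentsRegret ω ≤ _ := Finset.sum_le_sum fun k _ => hep k
    _ ≤ _ := by
      rw [Finset.sum_add_distrib, Finset.sum_add_distrib, ← Finset.mul_sum, ← Finset.mul_sum]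
      linarith

variable [IsProbabilityMeasure μ]

/-- With probability at least `1 - δ`, the likelihood ratios are bounded on average. -/
theorem Interaction.measure_mixtures_le (R : Interaction M K μ)
    (hψ : Measurable (Function.uncurry ψ)) (φ : 𝓘 → 𝓙 → EuclideanSpace ℝ (Fin d))
    (hK : 0 < K) (hpos : 0 < ∑ h, (M.size h : ℝ)) {δ : ℝ} (hδ : 0 < δ) :
    μ {ω | 2 * K * (∑ h, (M.size h : ℝ)) / δ ≤
        ∑ k, ∑ h, (M.size h : ℝ) * R.mixtures ψ φ k h ω} ≤ ENNReal.ofReal δ := by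
  set S : ℝ := ∑ h, (M.size h : ℝ) with hS
  have hK' : (0 : ℝ) < K := by exact_mod_cast hK
  set Q : Fin K → Fin H → Ω → ENNReal := fun k h ω => ENNReal.ofReal (M.size h : ℝ) *
    (ENNReal.ofReal ((R.record ω).mixture ψ φ (R.sideNoise Side.buyer ω) k h)
      + ENNReal.ofReal ((R.record ω).mixture ψ φ (R.sideNoise Side.seller ω) k h)) with hQ
  set X : Ω → ENNReal := fun ω => ∑ k : Fin K, ∑ h, Q k h ω with hX
  have hb := fun k h => R.lintegral_mixture_le_one Side.buyer hψ φ k h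
  have hs := fun k h => R.lintegral_mixture_le_one Side.seller hψ φ k h
  have hQm : ∀ k h, Measurable (Q k h) := fun k h => ((hb k h).2.add (hs k h).2).const_mul _
  have hXm : Measurable X := Finset.measurable_sum _ fun k _ => Finset.measurable_sum _ fun h _ =>
    hQm k h
  have hXe : ∀ ω, ENNReal.ofReal (∑ k, ∑ h, (M.size h : ℝ) * R.mixtures ψ φ k h ω) = X ω := by
    intro ω
    rw [ENNReal.ofReal_sum_of_nonneg fun k _ => Finset.sum_nonneg fun h _ =>
      mul_nonneg (Nat.cast_nonneg _) (R.mixtures_nonneg ψ φ k h ω)]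
    refine Finset.sum_congr rfl fun k _ => ?_
    rw [ENNReal.ofReal_sum_of_nonneg fun h _ =>
      mul_nonneg (Nat.cast_nonneg _) (R.mixtures_nonneg ψ φ k h ω)]
    refine Finset.sum_congr rfl fun h _ => ?_
    rw [ENNReal.ofReal_mul (Nat.cast_nonneg _), Interaction.mixtures,
      ENNReal.ofReal_add (Record.mixture_nonneg _ _ _ _ _ _) (Record.mixture_nonneg _ _ _ _ _ _)]
  -- Each side has mean ratio at most `1`, which gives the `2`. The single Markov inequality for
  -- this weighted sum takes the place of a union bound over episodes, steps and sides.
  have hXi : ∫⁻ ω, X ω ∂μ ≤ ENNReal.ofReal (2 * K * S) := by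
    simp only [hX]
    rw [lintegral_finsetSum _ fun k _ => Finset.measurable_sum _ fun h _ => hQm k h]
    calc _ ≤ ∑ k : Fin K, ENNReal.ofReal (2 * S) := by
          refine Finset.sum_le_sum fun k _ => ?_
          rw [lintegral_finsetSum _ fun h _ => hQm k h, hS,
            Finset.mul_sum, ENNReal.ofReal_sum_of_nonneg fun h _ => by positivity]
          refine Finset.sum_le_sum fun h _ => ?_
          simp only [hQ]
          rw [lintegral_const_mul' _ _ ENNReal.ofReal_ne_top, lintegral_add_left (hb k h).2,
            mul_comm 2, ENNReal.ofReal_mul (Nat.cast_nonneg _)]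
          gcongr
          calc _ ≤ (1 : ENNReal) + 1 := add_le_add (hb k h).1 (hs k h).1
            _ = _ := by rw [one_add_one_eq_two, ENNReal.ofReal_ofNat]
      _ = _ := by
          rw [Finset.sum_const, Finset.card_univ, Fintype.card_fin, nsmul_eq_mul,
            ← ENNReal.ofReal_natCast, ← ENNReal.ofReal_mul (Nat.cast_nonneg _)]
          congr 1
          ring
  have hmk := mul_meas_ge_le_lintegral hXm (μ := μ) (ENNReal.ofReal (2 * K * S / δ))
  have hsub : {ω | 2 * K * S / δ ≤ ∑ k, ∑ h, (M.size h : ℝ) * R.mixtures ψ φ k h ω} ⊆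
      {ω | ENNReal.ofReal (2 * K * S / δ) ≤ X ω} := fun ω hω =>
    (ENNReal.ofReal_le_ofReal hω).trans (le_of_eq (hXe ω))
  have hε : 0 < 2 * K * S / δ := by positivity
  calc μ _ ≤ μ _ := measure_mono hsub
    _ = ENNReal.ofReal (1 / (2 * K * S / δ)) * (ENNReal.ofReal (2 * K * S / δ) * μ _) := by
        rw [← mul_assoc, ← ENNReal.ofReal_mul (by positivity), one_div_mul_cancel hε.ne',
          ENNReal.ofReal_one, one_mul]
    _ ≤ ENNReal.ofReal (1 / (2 * K * S / δ)) * ENNReal.ofReal (2 * K * S) := by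
        gcongr; exact hmk.trans hXi
    _ = _ := by
        rw [← ENNReal.ofReal_mul (by positivity)]
        congr 1
        field_simp

end Regret

/-! ### Choice of the radius and logarithmic bookkeeping -/

/-- The confidence radius, without the contribution of the regularization. -/
noncomputable def noiseRadius (d K m : ℕ) (δ : ℝ) : ℝ :=
  √(max ((d : ℝ) ^ 2) 2 * Real.log (2 * (1 + (d : ℝ) ^ 2 * K * m) / δ))

theorem betaU_eq (d K m : ℕ) (δ : ℝ) : betaU d K m 1 δ = noiseRadius d K m δ + d := by
  rw [betaU, noiseRadius, one_mul, Real.sqrt_one, one_mul]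

theorem one_le_confidence_ratio {d K m : ℕ} {δ : ℝ} (hδ : 0 < δ) (hδ1 : δ ≤ 1) :
    1 ≤ 2 * (1 + (d : ℝ) ^ 2 * K * m) / δ := by
  rw [one_le_div hδ]
  have : 0 ≤ (d : ℝ) ^ 2 * K * m := by positivity
  linarith

theorem noiseRadius_sq {d K m : ℕ} {δ : ℝ} (hδ : 0 < δ) (hδ1 : δ ≤ 1) :
    noiseRadius d K m δ ^ 2 =
      max ((d : ℝ) ^ 2) 2 * Real.log (2 * (1 + (d : ℝ) ^ 2 * K * m) / δ) :=
  Real.sq_sqrt (mul_nonneg (by positivity) (Real.log_nonneg (one_le_confidence_ratio hδ hδ1)))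

/-- With `n = max (d ^ 2) 2`, the radius is chosen so that `exp (-b ^ 2) = (δ / P) ^ n`, which has
to beat `K * (1 + K m) ^ (d ^ 2 - 1) / δ ^ 2`. The factor `K` fills the missing power of `P`, and `n
≥ 2` supplies the two powers of `δ`, also when `d = 1`. -/
theorem tailFactor_noiseRadius_le {d K m : ℕ} (hd : 1 ≤ d) (hm : 1 ≤ m) (hK : 1 ≤ K) {δ : ℝ}
    (hδ : 0 < δ) (hδ1 : δ ≤ 1) :
    tailFactor d K m (noiseRadius d K m δ) ≤ δ / √K := by
  set P : ℝ := 2 * (1 + (d : ℝ) ^ 2 * K * m) with hP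
  have hd' : (1 : ℝ) ≤ (d : ℝ) ^ 2 := one_le_pow₀ (by exact_mod_cast hd)
  have hm' : (1 : ℝ) ≤ m := by exact_mod_cast hm
  have hK' : (1 : ℝ) ≤ K := by exact_mod_cast hK
  have hKm : (K : ℝ) ≤ K * m := le_mul_of_one_le_right (by linarith) hm'
  have hdKm : (K : ℝ) * m ≤ (d : ℝ) ^ 2 * K * m := by
    rw [mul_assoc]
    exact le_mul_of_one_le_left (by linarith) hd'
  have hP1 : 1 + (K : ℝ) * m ≤ P := by rw [hP]; linarith
  have hPK : (K : ℝ) ≤ P := by linarith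
  have hP0 : 1 ≤ P := by linarith
  have hB : P ≤ P / δ := le_div_self (by linarith) hδ hδ1
  set n : ℕ := max (d ^ 2) 2 with hn
  have hn2 : 2 ≤ n := le_max_right _ _
  have hnd : d ^ 2 ≤ n := le_max_left _ _
  have hd2 : 1 ≤ d ^ 2 := Nat.one_le_pow _ _ hd
  have hexp : Real.exp (-(noiseRadius d K m δ ^ 2)) * (P / δ) ^ n = 1 := by
    have hpos : 0 < P / δ := by positivity
    have hcast : max ((d : ℝ) ^ 2) 2 = (n : ℝ) := by rw [hn]; push_cast; rfl
    rw [noiseRadius_sq hδ hδ1, hcast, ← Real.log_pow, Real.exp_neg, Real.exp_log (by positivity)]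
    exact inv_mul_cancel₀ (by positivity)
  have hmain : K * (1 + (K : ℝ) * m) ^ (d ^ 2 - 1) ≤ δ ^ 2 * (P / δ) ^ n := by
    calc K * (1 + (K : ℝ) * m) ^ (d ^ 2 - 1) ≤ P * P ^ (d ^ 2 - 1) := by gcongr
      _ = P ^ (d ^ 2) := by rw [← pow_succ', Nat.sub_add_cancel hd2]
      _ ≤ P ^ n := pow_le_pow_right₀ hP0 hnd
      _ = P ^ 2 * P ^ (n - 2) := by rw [← pow_add, Nat.add_sub_cancel' hn2]
      _ ≤ P ^ 2 * (P / δ) ^ (n - 2) := by gcongr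
      _ = δ ^ 2 * ((P / δ) ^ 2 * (P / δ) ^ (n - 2)) := by
          rw [← mul_assoc, ← mul_pow, mul_div_cancel₀ _ hδ.ne']
      _ = _ := by rw [← pow_add, Nat.add_sub_cancel' hn2]
  have hsq : tailFactor d K m (noiseRadius d K m δ) ^ 2 ≤ (δ / √K) ^ 2 := by
    rw [div_pow, Real.sq_sqrt (by positivity), le_div_iff₀ (by linarith), tailFactor, mul_pow,
      Real.sq_sqrt (by positivity), ← Real.exp_nat_mul]
    have he : ((2 : ℕ) : ℝ) * (-(noiseRadius d K m δ ^ 2) / 2) = -(noiseRadius d K m δ ^ 2) := by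
      push_cast; ring
    rw [he]
    calc _ = Real.exp (-(noiseRadius d K m δ ^ 2)) * (K * (1 + (K : ℝ) * m) ^ (d ^ 2 - 1)) := by
          ring
      _ ≤ Real.exp (-(noiseRadius d K m δ ^ 2)) * (δ ^ 2 * (P / δ) ^ n) := by gcongr
      _ = δ ^ 2 * (Real.exp (-(noiseRadius d K m δ ^ 2)) * (P / δ) ^ n) := by ring
      _ = _ := by rw [hexp, mul_one]
  exact le_of_sq_le_sq hsq (by positivity)

/-- The logarithmic factors are bounded by multiples of `log (d K m' / δ)`. -/
theorem log_factors_le {d K m : ℕ} {m' δ : ℝ} (hd : 1 ≤ d) (hm : (m : ℝ) ≤ m') (hm' : 1 ≤ m')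
    (hK : 1 ≤ K) (hδ : 0 < δ) (hδ1 : δ < 1 / 2) :
    1 / 2 ≤ Real.log (d * K * m' / δ) ∧ Real.log (1 / δ) ≤ Real.log (d * K * m' / δ) ∧
      Real.log (2 * (1 + (d : ℝ) ^ 2 * K * m) / δ) ≤ 4 * Real.log (d * K * m' / δ) ∧
      Real.log (1 + (K : ℝ) * m) ≤ 4 * Real.log (d * K * m' / δ) := by
  have hd' : (1 : ℝ) ≤ d := by exact_mod_cast hd
  have hK' : (1 : ℝ) ≤ K := by exact_mod_cast hK
  have hdK : 1 ≤ (d : ℝ) * K := one_le_mul_of_one_le_of_one_le hd' hK'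
  have hdKm : 1 ≤ (d : ℝ) * K * m' := one_le_mul_of_one_le_of_one_le hdK hm'
  have hm0 : (0 : ℝ) ≤ m := Nat.cast_nonneg m
  set x : ℝ := d * K * m' / δ with hx
  have hx1 : 1 / δ ≤ x := by rw [hx]; gcongr
  have hδ2 : 2 ≤ 1 / δ := by rw [le_div_iff₀ hδ]; linarith
  have hx2 : 2 ≤ x := hδ2.trans hx1
  -- The ratio is at most `4 d x`, and `d ≤ x`, `2 ≤ x` give `4 d x ≤ 4 x ^ 2 ≤ x ^ 4`.
  have hPx : 2 * (1 + (d : ℝ) ^ 2 * K * m) / δ ≤ x ^ 4 := by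
    have h1 : 1 + (d : ℝ) ^ 2 * K * m ≤ 2 * (d * (d * K * m')) := by
      have h2 : (d : ℝ) ^ 2 * K * m ≤ d * (d * K * m') := by
        calc (d : ℝ) ^ 2 * K * m ≤ (d : ℝ) ^ 2 * K * m' := by gcongr
          _ = _ := by ring
      have h3 : 1 ≤ d * ((d : ℝ) * K * m') := one_le_mul_of_one_le_of_one_le hd' hdKm
      linarith
    have h4 : (d : ℝ) ≤ x := by
      calc (d : ℝ) ≤ d * (K * m') :=
            le_mul_of_one_le_right (by linarith) (one_le_mul_of_one_le_of_one_le hK' hm')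
        _ = d * K * m' := by ring
        _ ≤ x := le_div_self (by linarith) hδ (by linarith)
    calc 2 * (1 + (d : ℝ) ^ 2 * K * m) / δ ≤ 2 * (2 * (d * (d * K * m'))) / δ := by gcongr
      _ = 4 * d * x := by rw [hx]; ring
      _ ≤ 4 * x * x := by gcongr
      _ ≤ x ^ 4 := by nlinarith [mul_self_nonneg (x ^ 2 - 4), mul_self_nonneg x]
  have hlog4 : Real.log (x ^ 4) = 4 * Real.log x := by rw [Real.log_pow]; norm_num
  have hKmP : 1 + (K : ℝ) * m ≤ 2 * (1 + (d : ℝ) ^ 2 * K * m) / δ := by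
    have h1 : (K : ℝ) * m ≤ (d : ℝ) ^ 2 * K * m := by
      rw [mul_assoc]
      exact le_mul_of_one_le_left (by positivity) (one_le_pow₀ hd')
    have h2 : 2 * (1 + (d : ℝ) ^ 2 * K * m) ≤ 2 * (1 + (d : ℝ) ^ 2 * K * m) / δ :=
      le_div_self (by positivity) hδ (by linarith)
    have h3 : 0 ≤ (d : ℝ) ^ 2 * K * m := by positivity
    linarith
  refine ⟨?_, Real.log_le_log (by positivity) hx1, ?_, ?_⟩
  · have h1 := Real.log_le_log (by norm_num) hx2
    linarith [Real.log_two_gt_d9]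
  · rw [← hlog4]
    exact Real.log_le_log (by positivity) hPx
  · rw [← hlog4]
    exact Real.log_le_log (by positivity) (hKmP.trans hPx)

/-- Both roots are at most `√8 d √κ ≤ 3 d √κ`, and `κ ≥ 1 / 2` gives `d ≤ 3 / 2 * d √κ`. The product
is `27 / 2 * d ^ 2 κ`. -/
theorem bonus_sum_le {d κ L₁ L₂ : ℝ} (hd : 1 ≤ d) (hκ : 1 / 2 ≤ κ) (hL₁ : L₁ ≤ 4 * κ)
    (hL₂ : L₂ ≤ 4 * κ) :
    (√(max (d ^ 2) 2 * L₁) + d) * √(2 * (d ^ 2 * L₂)) ≤ 15 * (d ^ 2 * κ) := by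
  have hs0 : 0 ≤ √κ := Real.sqrt_nonneg _
  have hs : √κ ^ 2 = κ := Real.sq_sqrt (by linarith)
  have hmax : max (d ^ 2) 2 ≤ 2 * d ^ 2 := max_le (by nlinarith) (by nlinarith)
  have h1 : √(max (d ^ 2) 2 * L₁) ≤ 3 * d * √κ := by
    refine Real.sqrt_le_iff.2 ⟨by positivity, ?_⟩
    calc max (d ^ 2) 2 * L₁ ≤ max (d ^ 2) 2 * (4 * κ) := by gcongr
      _ ≤ 2 * d ^ 2 * (4 * κ) := by gcongr
      _ ≤ _ := by rw [mul_pow, hs]; nlinarith [mul_nonneg (sq_nonneg d) (by linarith : 0 ≤ κ)]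
  have h2 : √(2 * (d ^ 2 * L₂)) ≤ 3 * d * √κ := by
    refine Real.sqrt_le_iff.2 ⟨by positivity, ?_⟩
    calc 2 * (d ^ 2 * L₂) ≤ 2 * (d ^ 2 * (4 * κ)) := by gcongr
      _ ≤ _ := by rw [mul_pow, hs]; nlinarith [mul_nonneg (sq_nonneg d) (by linarith : 0 ≤ κ)]
  have h3 : 1 ≤ 3 / 2 * √κ := by
    by_contra hlt
    push Not at hlt
    nlinarith
  have h4 : d ≤ 3 / 2 * d * √κ := by nlinarith
  calc _ ≤ (3 * d * √κ + 3 / 2 * d * √κ) * (3 * d * √κ) := by gcongr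
    _ = 27 / 2 * (d ^ 2 * √κ ^ 2) := by ring
    _ ≤ _ := by
      rw [hs]
      have : 0 ≤ d ^ 2 * κ := mul_nonneg (sq_nonneg d) (by linarith)
      linarith

end MarkovMatching

/-! ### The regret bound -/

open MarkovMatching in
theorem mainTheorem2 :
    ∃ C : ℝ, 0 < C ∧
      ∀ {𝒞 Υ 𝓘 𝓙 Ω : Type*} [MeasurableSpace 𝒞] [MeasurableSpace Υ] [Fintype 𝓘] [Fintype 𝓙]
        [MeasurableSpace Ω] (μ : Measure Ω) [IsProbabilityMeasure μ] (d H K : ℕ) (_hd : 1 ≤ d)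
        (M : MarkovMatching.Market 𝒞 Υ 𝓘 𝓙 H)
        (ψ : 𝒞 → Υ → EuclideanSpace ℝ (Fin d)) (φ : 𝓘 → 𝓙 → EuclideanSpace ℝ (Fin d))
        (θ γ : Fin H → EuclideanSpace ℝ (Fin d × Fin d))
        (ν : Fin H → VectorMeasure 𝒞 (EuclideanSpace ℝ (Fin d))) (W : Fin H → ℝ)
        (_hM : M.IsLinear ψ φ θ γ ν W) (δ : ℝ) (_hδ : 0 < δ) (βV : ℝ)
        (R : MarkovMatching.Interaction M K μ)
        (_hR : R.FollowsSOM ψ φ W 1 (MarkovMatching.betaU d K M.maxSize 1 δ) βV),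
        ENNReal.ofReal (1 - 2 * δ) ≤
          μ {ω | R.agentsRegret ω ≤
            C * ((d : ℝ) ^ 2 * (∑ h : Fin H, (min (M.I h).card (M.J h).card : ℝ)) *
              Real.log (d * K * min (Fintype.card 𝓘 : ℝ) (Fintype.card 𝓙) / δ) * √K)} := by
  refine ⟨200, by norm_num, ?_⟩
  intro 𝒞 Υ 𝓘 𝓙 Ω _ _ _ _ _ μ _ d H K hd M ψ φ θ γ ν W hM δ hδ βV R hR
  rcases le_or_gt (1 / 2) δ with hδ2 | hδ2
  · rw [ENNReal.ofReal_of_nonpos (by linarith)]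
    exact zero_le
  rw [betaU_eq] at hR
  set b := noiseRadius d K M.maxSize δ with hb
  have hb0 : 0 ≤ b := Real.sqrt_nonneg _
  have hβ0 : 0 ≤ b + d := by positivity
  have hd' : (1 : ℝ) ≤ d := by exact_mod_cast hd
  have hsize : ∑ h : Fin H, (min (M.I h).card (M.J h).card : ℝ) = ∑ h, (M.size h : ℝ) :=
    Finset.sum_congr rfl fun h _ => (Nat.cast_min _ _).symm
  rw [hsize]
  set S : ℝ := ∑ h, (M.size h : ℝ) with hS
  set κ : ℝ := Real.log (d * K * min (Fintype.card 𝓘 : ℝ) (Fintype.card 𝓙) / δ) with hκdef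
  have hreg := Interaction.agentsRegret_le hM hb0 hR
  have hS0 : 0 ≤ S := Finset.sum_nonneg fun _ _ => Nat.cast_nonneg _
  have htriv : (∀ ω, R.agentsRegret ω ≤ 200 * ((d : ℝ) ^ 2 * S * κ * √K)) →
      ENNReal.ofReal (1 - 2 * δ) ≤
        μ {ω | R.agentsRegret ω ≤ 200 * ((d : ℝ) ^ 2 * S * κ * √K)} := fun h => by
    have : {ω | R.agentsRegret ω ≤ 200 * ((d : ℝ) ^ 2 * S * κ * √K)} = Set.univ :=
      Set.eq_univ_of_forall h
    rw [this, measure_univ]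
    exact ENNReal.ofReal_le_one.2 (by linarith)
  rcases Nat.eq_zero_or_pos K with hK0 | hKpos
  · refine htriv fun ω => ?_
    subst hK0
    simp [Interaction.agentsRegret]
  rcases hS0.eq_or_lt with hSz | hSpos
  · refine htriv fun ω => ?_
    have hz : ∀ h, (M.size h : ℝ) = 0 := fun h =>
      (Finset.sum_eq_zero_iff_of_nonneg fun _ _ => Nat.cast_nonneg _).1 hSz.symm h
        (Finset.mem_univ h)
    have hbz : ∀ k h c, R.bonus ψ φ (b + d) k h ω c = 0 := fun k h c =>
      le_antisymm ((R.bonus_le ψ φ _ k h ω c (Interaction.card_mat_le hR k ω h c)).trans (hz h).le)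
        (R.bonus_nonneg ψ φ hβ0 k h ω c)
    have h1 := hreg ω
    simp only [Interaction.expectedBonus, hbz, hz, zero_mul, Finset.sum_const_zero, integral_zero,
      mul_zero, add_zero] at h1
    rw [← hSz]
    simpa using h1
  obtain ⟨h₀, -, hh₀⟩ : ∃ h ∈ Finset.univ, (M.size h : ℝ) ≠ 0 := by
    by_contra hall
    push Not at hall
    exact hSpos.ne' (Finset.sum_eq_zero hall)
  have hm1 : 1 ≤ M.maxSize :=
    (Nat.one_le_iff_ne_zero.2 (by exact_mod_cast hh₀)).trans (M.size_le_maxSize h₀)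
  have hmle : M.maxSize ≤ min (Fintype.card 𝓘) (Fintype.card 𝓙) :=
    Finset.sup_le fun h _ => min_le_min (Finset.card_le_univ _) (Finset.card_le_univ _)
  have hmle' : (M.maxSize : ℝ) ≤ min (Fintype.card 𝓘 : ℝ) (Fintype.card 𝓙) := by
    rw [← Nat.cast_min]; exact_mod_cast hmle
  have hm1' : (1 : ℝ) ≤ M.maxSize := by exact_mod_cast hm1
  obtain ⟨hκ, hκδ, hκβ, hκK⟩ :=
    log_factors_le (d := d) (K := K) hd hmle' (hm1'.trans hmle') hKpos hδ hδ2
  have htail := tailFactor_noiseRadius_le hd hm1 hKpos hδ (by linarith)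
  have hsK : 1 ≤ √(K : ℝ) := Real.one_le_sqrt.2 (by exact_mod_cast hKpos)
  have hKsq : √(K : ℝ) * √K = K := Real.mul_self_sqrt (Nat.cast_nonneg K)
  set bad₁ := {ω | 2 * (∑ k, ∑ h : Fin H, R.bonus ψ φ (b + d) k h ω (R.ctx k h.castSucc ω))
    + 2 * S * Real.log (1 / δ) ≤ ∑ k, R.expectedBonus ψ φ (b + d) k ω} with hbad₁
  set bad₂ := {ω | 2 * K * S / δ ≤ ∑ k, ∑ h, (M.size h : ℝ) * R.mixtures ψ φ k h ω} with hbad₂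
  have hμ₁ : μ bad₁ ≤ ENNReal.ofReal δ :=
    R.measure_expectedBonus_le hM.measurable_ψ φ hβ0 (Interaction.card_mat_le hR) hSpos hδ
  have hμ₂ : μ bad₂ ≤ ENNReal.ofReal δ :=
    R.measure_mixtures_le hM.measurable_ψ φ hKpos hSpos hδ
  set good := {ω | R.agentsRegret ω ≤ 200 * ((d : ℝ) ^ 2 * S * κ * √K)} with hgood
  have hsub : (Set.univ : Set Ω) ⊆ good ∪ (bad₁ ∪ bad₂) := by
    intro ω _
    by_cases h₁ : ω ∈ bad₁
    · exact Or.inr (Or.inl h₁)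
    by_cases h₂ : ω ∈ bad₂
    · exact Or.inr (Or.inr h₂)
    refine Or.inl ?_
    simp only [hbad₁, Set.mem_ofPred_eq, not_le] at h₁
    simp only [hbad₂, Set.mem_ofPred_eq, not_le] at h₂
    have hY : ∑ k, ∑ h : Fin H, R.bonus ψ φ (b + d) k h ω (R.ctx k h.castSucc ω) ≤
        S * (√K * (15 * ((d : ℝ) ^ 2 * κ))) := by
      rw [Finset.sum_comm, hS, Finset.sum_mul]
      refine Finset.sum_le_sum fun h _ => ?_
      have h1 := Record.sum_bonus_le (D := R.record ω) hM.ψ_le hM.φ_le (h := h) (m := M.size h)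
        (m' := M.maxSize) (fun t => Interaction.card_mat_le hR t ω h _) (M.size_le_maxSize h)
        (β := b + d) (by linarith)
      refine le_trans h1 (mul_le_mul_of_nonneg_left ?_ (Nat.cast_nonneg _))
      have h2 := bonus_sum_le hd' hκ hκβ hκK
      calc _ = √(K : ℝ) * ((b + d) * √(2 * ((d : ℝ) ^ 2 * Real.log (1 + (K : ℝ) * M.maxSize)))) := by
            ring
        _ ≤ _ := mul_le_mul_of_nonneg_left h2 (by linarith)
    have hX : 2 * tailFactor d K M.maxSize b
        * (∑ k, ∑ h, (M.size h : ℝ) * R.mixtures ψ φ k h ω) ≤ 4 * (S * √K) := by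
      have hK0 : (0 : ℝ) < √K := by linarith
      calc _ ≤ 2 * (δ / √K) * (2 * K * S / δ) := by
            refine mul_le_mul (by linarith) h₂.le ?_ (by positivity)
            exact Finset.sum_nonneg fun k _ => Finset.sum_nonneg fun h _ =>
              mul_nonneg (Nat.cast_nonneg _) (R.mixtures_nonneg ψ φ k h ω)
        _ = 4 * (S * (K / √K)) := by field_simp; ring
        _ = _ := by rw [Real.div_sqrt]
    have hU : S * √K ≤ 2 * ((d : ℝ) ^ 2 * S * κ * √K) := by
      have h1 : 1 ≤ 2 * ((d : ℝ) ^ 2 * κ) := by nlinarith [one_le_pow₀ (n := 2) hd']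
      calc S * √K = 1 * (S * √K) := (one_mul _).symm
        _ ≤ 2 * ((d : ℝ) ^ 2 * κ) * (S * √K) := by gcongr
        _ = _ := by ring
    have hV : S * κ ≤ (d : ℝ) ^ 2 * S * κ * √K := by
      have h1 : 1 ≤ (d : ℝ) ^ 2 * √K :=
        one_le_mul_of_one_le_of_one_le (one_le_pow₀ hd') hsK
      have h2 : 0 ≤ S * κ := mul_nonneg hS0 (by linarith)
      calc S * κ ≤ S * κ * ((d : ℝ) ^ 2 * √K) := le_mul_of_one_le_right h2 h1
        _ = _ := by ring
    have hS1 : S ≤ S * √K := le_mul_of_one_le_right hS0 hsK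
    have hδκ : S * Real.log (1 / δ) ≤ S * κ := mul_le_mul_of_nonneg_left hκδ hS0
    have hYU : S * (√K * (15 * ((d : ℝ) ^ 2 * κ))) = 15 * ((d : ℝ) ^ 2 * S * κ * √K) := by ring
    have hr := hreg ω
    simp only [hgood, Set.mem_ofPred_eq]
    linarith
  have htot : (1 : ENNReal) ≤ μ good + ENNReal.ofReal (2 * δ) := by
    calc (1 : ENNReal) = μ Set.univ := measure_univ.symm
      _ ≤ μ (good ∪ (bad₁ ∪ bad₂)) := measure_mono hsub
      _ ≤ μ good + (μ bad₁ + μ bad₂) :=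
          (measure_union_le _ _).trans (by gcongr; exact measure_union_le _ _)
      _ ≤ μ good + (ENNReal.ofReal δ + ENNReal.ofReal δ) := by gcongr
      _ = _ := by rw [← ENNReal.ofReal_add hδ.le hδ.le, two_mul]
  rw [ENNReal.ofReal_sub _ (by positivity), ENNReal.ofReal_one]
  exact tsub_le_iff_right.2 htot
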